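/- Let $X$ be a compact connected complex manifold of dimension $m$ with a Kähler form $\omega_0$, and let $D=\sum_{j=1}^N D_j$ be a divisor with simple normal crossings in $X$, with smooth irreducible components $D_1,\dots,D_N$. For each $j$ let $\sigma_j$ be a holomorphic defining section of $D_j$ in the line bundle $[D_j]$ (so that $D_j=\{\sigma_j=0\}$, with multiplicity one), and let $|\cdot|_j$ be a smooth Hermitian metric on $[D_j]$ such that $\rho_j:=-\log(|\sigma_j|_j^2)\ge 1$ on $X\setminus D_j$. Let $A_1,\dots,A_N>0$ and $\lambda\ge 0$, put $u_j:=\log(\lambda+\rho_j)$, and consider on $X\setminus D$ the real $(1,1)$-form $$\omega:=\omega_0-\sum_{j=1}^N A_j\, i\partial\bar\partial u_j ,$$ where $\lambda$ is so large that $\omega\ge\varepsilon\,\omega_0$ on $X\setminus D$ for some $\varepsilon>0$; thus $\omega$ is a Kähler form on $X\setminus D$. Let $g$ be a smooth Riemannian metric on $X\setminus D$ that is quasi-isometric to $\omega$, i.e. for some $c>0$ one has $c\,\omega(v,Jv)\le g(v,v)\le c^{-1}\omega(v,Jv)$ for all tangent vectors $v$ of $X\setminus D$, where $J$ is the complex structure.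 Then there exists a constant $C_P>0$ such that for every real function $v\in H^1(X\setminus D,g)$ (that is, $v$ and its weak differential $dv$ are square integrable with respect to $g$) with $\int_{X\setminus D} v\,\mathrm{vol}^g=0$ one has $$\int_{X\setminus D}|v|^2\,\mathrm{vol}^g\le C_P\int_{X\setminus D}|dv|_g^2\,\mathrm{vol}^g .$$ -/

import Mathlib

open scoped ContDiff Manifold Topology
open Bundle MeasureTheory

namespace PoincareType

noncomputable section

/-! ### Riemannian manifolds: volume measure, differentials, Sobolev space -/

section Riemannian

variable {E : Type*} [NormedAddCommGroup E] [NormedSpace ℝ E]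
  {M : Type*} [TopologicalSpace M] [ChartedSpace E M]

/-- The differential at `y` of the inverse of a chart `φ`, a linear map `E → T_{φ⁻¹ y} M`. -/
def dChartSymm (φ : OpenPartialHomeomorph M E) (y : E) :
    E →L[ℝ] TangentSpace 𝓘(ℝ, E) (φ.symm y) :=
  mfderiv 𝓘(ℝ, E) 𝓘(ℝ, E) φ.symm y

variable (E M) in
/-- A smooth Riemannian metric on the manifold `M` (modelled on `E`, without boundary). -/
abbrev SmoothMetric [IsManifold 𝓘(ℝ, E) ∞ M] : Type _ :=
  ContMDiffRiemannianMetric 𝓘(ℝ, E) ∞ E (fun x : M => TangentSpace 𝓘(ℝ, E) x)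

variable (E M) in
/-- A field of covectors (a not necessarily continuous `1`-form) on `M`. -/
abbrev CovectorField : Type _ := ∀ x : M, TangentSpace 𝓘(ℝ, E) x →L[ℝ] ℝ

/-- The expression in the chart `φ` of a field of covectors: its pull-back by `φ⁻¹`. -/
def CovectorField.inChart (α : CovectorField E M) (φ : OpenPartialHomeomorph M E) (y : E) :
    E →L[ℝ] ℝ :=
  (α (φ.symm y)).comp (dChartSymm φ y)

variable [IsManifold 𝓘(ℝ, E) ∞ M]

/-- The squared norm `|α|_g²` of a field of covectors at `x`, for the dual norm on `T_x^* M`. -/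
def normSq (g : SmoothMetric E M) (α : CovectorField E M) (x : M) : ℝ :=
  sSup {r : ℝ | ∃ v : TangentSpace 𝓘(ℝ, E) x, g.inner x v v ≤ 1 ∧ r = (α x v) ^ 2}

variable [FiniteDimensional ℝ E]

/-- The determinant of the matrix of `g` in the chart `φ`, with respect to a fixed basis of `E`. -/
def chartDet (g : SmoothMetric E M) (φ : OpenPartialHomeomorph M E) (y : E) : ℝ :=
  Matrix.det (Matrix.of fun i j =>
    g.inner (φ.symm y) (dChartSymm φ y (Module.finBasis ℝ E i))
      (dChartSymm φ y (Module.finBasis ℝ E j)))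

variable [MeasurableSpace E] [BorelSpace E]

variable (E) in
/-- Lebesgue measure in the coordinates given by the fixed basis of `E`. -/
def lebesgue : Measure E := (Module.finBasis ℝ E).addHaar

/-- `α` is the weak (distributional) differential of the function `v` on `M`: in every smooth
chart, `v` and `α` are locally integrable, and the components of `α` are the partial
derivatives of `v` in the sense of distributions. -/
def IsWeakDifferential (v : M → ℝ) (α : CovectorField E M) : Prop :=
  ∀ φ ∈ IsManifold.maximalAtlas 𝓘(ℝ, E) ∞ M,
    LocallyIntegrableOn (fun y => v (φ.symm y)) φ.target (lebesgue E) ∧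
    LocallyIntegrableOn (α.inChart φ) φ.target (lebesgue E) ∧
    ∀ ψ : E → ℝ, ContDiff ℝ ∞ ψ → HasCompactSupport ψ → tsupport ψ ⊆ φ.target →
      ∀ w : E, ∫ y, v (φ.symm y) * fderiv ℝ ψ y w ∂(lebesgue E) =
        - ∫ y, α.inChart φ y w * ψ y ∂(lebesgue E)

variable [MeasurableSpace M]

/-- The measure on `M`, carried by the domain of the chart `φ`, which reads `√(det g) dy` in `φ`. -/
def chartVolume (g : SmoothMetric E M) (φ : OpenPartialHomeomorph M E) : Measure M :=
  (((lebesgue E).restrict φ.target).withDensity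
    (fun y => ENNReal.ofReal (Real.sqrt (chartDet g φ y)))).map φ.symm

/-- The Riemannian volume measure of `g`, characterized by the fact that it restricts on the
domain of each smooth chart `φ` to the measure `√(det g) dy`; that is to say, it is the smallest
measure that is at least `chartVolume g φ` for every smooth chart `φ`. -/
def riemannianVolume (g : SmoothMetric E M) : Measure M :=
  ⨆ φ ∈ IsManifold.maximalAtlas 𝓘(ℝ, E) ∞ M, chartVolume g φ

/-- The real function `v` belongs to the Sobolev space `H¹(M, g)`, with weak differential `α`:
both `v` and `|α|_g` are square integrable for the Riemannian volume. -/
structure MemH1 (g : SmoothMetric E M) (v : M → ℝ) (α : CovectorField E M) : Prop where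
  memLp : MemLp v 2 (riemannianVolume g)
  isWeakDifferential : IsWeakDifferential v α
  integrable_normSq : Integrable (normSq g α) (riemannianVolume g)

end Riemannian

/-! ### Complex manifolds, Kähler forms -/

/-- The model space `ℂᵐ`. -/
abbrev Cn (m : ℕ) : Type := Fin m → ℂ

section Complex

variable {m : ℕ} {X : Type*} [TopologicalSpace X] [ChartedSpace (Cn m) X]

/-- A complex manifold is in particular a smooth real manifold. -/
instance instRealManifold [IsManifold 𝓘(ℂ, Cn m) ω X] : IsManifold 𝓘(ℝ, Cn m) ∞ X := by
  apply isManifold_of_contDiffOn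
  intro e e' he he'
  have h := (contDiffGroupoid ω 𝓘(ℂ, Cn m)).compatible he he'
  have h1 := (contDiffGroupoid_le (I := 𝓘(ℂ, Cn m)) (le_top : (∞ : WithTop ℕ∞) ≤ ω)) h
  have h2 := mem_groupoid_of_pregroupoid.1 h1
  exact ContDiffOn.restrict_scalars ℝ h2.1

/-- The complex structure `J` of the real tangent space: multiplication by `i`. -/
def J (x : X) : TangentSpace 𝓘(ℝ, Cn m) x →L[ℝ] TangentSpace 𝓘(ℝ, Cn m) x :=
  (Complex.I • ContinuousLinearMap.id ℝ (Cn m) : Cn m →L[ℝ] Cn m)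

/-- The expression in the chart `φ` of a field of `2`-forms: its pull-back by `φ⁻¹`. -/
def twoFormInChart (Ω : ∀ x : X, TangentSpace 𝓘(ℝ, Cn m) x [⋀^Fin 2]→L[ℝ] ℝ)
    (φ : OpenPartialHomeomorph X (Cn m)) (y : Cn m) : Cn m [⋀^Fin 2]→L[ℝ] ℝ :=
  (Ω (φ.symm y)).compContinuousLinearMap (dChartSymm φ y)

variable (m X) in
/-- A Kähler form: a smooth closed positive real `(1,1)`-form. -/
structure KahlerForm [IsManifold 𝓘(ℂ, Cn m) ω X] where
  toForm : ∀ x : X, TangentSpace 𝓘(ℝ, Cn m) x [⋀^Fin 2]→L[ℝ] ℝ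
  smooth : ∀ φ ∈ IsManifold.maximalAtlas 𝓘(ℝ, Cn m) ∞ X,
    ContDiffOn ℝ ∞ (twoFormInChart toForm φ) φ.target
  closed : ∀ φ ∈ IsManifold.maximalAtlas 𝓘(ℝ, Cn m) ∞ X,
    ∀ y ∈ φ.target, extDeriv (twoFormInChart toForm φ) y = 0
  type_one_one : ∀ (x : X) (v w : TangentSpace 𝓘(ℝ, Cn m) x),
    toForm x ![J x v, J x w] = toForm x ![v, w]
  pos : ∀ (x : X) (v : TangentSpace 𝓘(ℝ, Cn m) x), v ≠ 0 → 0 < toForm x ![v, J x v]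

/-- The real Hessian of `f` at `x`, in the holomorphic chart at `x` (the chart by which
`T_x X` is identified with `ℂᵐ`). -/
def chartHessian (f : X → ℝ) (x : X) : Cn m →L[ℝ] Cn m →L[ℝ] ℝ :=
  fderiv ℝ (fderiv ℝ (f ∘ (chartAt (Cn m) x).symm)) (chartAt (Cn m) x x)

/-- The value `(i ∂∂̄ f)_x (v, w)` of the real `(1,1)`-form `i ∂∂̄ f`, for `f` of class `C²`. In
holomorphic coordinates, `i ∂∂̄ f = i ∑ ∂²f/∂z_j∂z̄_k dz_j ∧ dz̄_k`, whose value on `(v, w)` is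
`(D²f(iv, w) - D²f(v, iw)) / 2`. -/
def iddbar (f : X → ℝ) (x : X) (v w : TangentSpace 𝓘(ℝ, Cn m) x) : ℝ :=
  (chartHessian (m := m) f x (J x v) w - chartHessian (m := m) f x v (J x w)) / 2

/-- The value at `(v, w)` of the restriction of a Kähler form to an open subset. -/
def KahlerForm.restrict [IsManifold 𝓘(ℂ, Cn m) ω X] (Ω : KahlerForm m X)
    (U : TopologicalSpace.Opens X) (x : U) (v w : TangentSpace 𝓘(ℝ, Cn m) x) : ℝ :=
  Ω.toForm x.1 ![mfderiv 𝓘(ℝ, Cn m) 𝓘(ℝ, Cn m) (Subtype.val : U → X) x v,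
    mfderiv 𝓘(ℝ, Cn m) 𝓘(ℝ, Cn m) (Subtype.val : U → X) x w]

end Complex

/-! ### Line bundles and divisors with simple normal crossings -/

section LineBundle

variable (m : ℕ) {X : Type*} [TopologicalSpace X] [ChartedSpace (Cn m) X]
  (L : X → Type*) [∀ x, AddCommGroup (L x)] [∀ x, Module ℂ (L x)]
  [∀ x, TopologicalSpace (L x)] [TopologicalSpace (TotalSpace ℂ L)] [FiberBundle ℂ L]

/-- A smooth Hermitian metric on the complex line bundle `L`, given by the squared norms
`|ξ|²` of the vectors `ξ` of `L`; smoothness means that the squared norm of the local frame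
given by a local trivialization is a smooth function. -/
structure HermitianMetric where
  normSq : ∀ x, L x → ℝ
  normSq_smul : ∀ (x : X) (c : ℂ) (ξ : L x), normSq x (c • ξ) = ‖c‖ ^ 2 * normSq x ξ
  normSq_pos : ∀ (x : X) (ξ : L x), ξ ≠ 0 → 0 < normSq x ξ
  smooth : ∀ x₀ : X, ContMDiffOn 𝓘(ℝ, Cn m) 𝓘(ℝ, ℝ) ∞
    (fun x => normSq x ((trivializationAt ℂ L x₀).symm x 1)) (trivializationAt ℂ L x₀).baseSet

end LineBundle

section Divisor

variable {m : ℕ} {X : Type*} [TopologicalSpace X] [ChartedSpace (Cn m) X]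

variable {N : ℕ} {L : Fin N → X → Type*} [∀ j x, AddCommGroup (L j x)] [∀ j x, Module ℂ (L j x)]
  [∀ j x, TopologicalSpace (L j x)] [∀ j, TopologicalSpace (TotalSpace ℂ (L j))]
  [∀ j, FiberBundle ℂ (L j)] [∀ j, VectorBundle ℂ ℂ (L j)]

/-- The differential at `x` of the holomorphic function that represents the section `s` in the
local trivialization around `x`. -/
def localDifferential {K : X → Type*} [∀ x, AddCommGroup (K x)] [∀ x, Module ℂ (K x)]
    [∀ x, TopologicalSpace (K x)] [TopologicalSpace (TotalSpace ℂ K)] [FiberBundle ℂ K]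
    [VectorBundle ℂ ℂ K] (s : Cₛ^ω⟮𝓘(ℂ, Cn m); ℂ, K⟯) (x : X) :
    TangentSpace 𝓘(ℂ, Cn m) x →L[ℂ] ℂ :=
  mfderiv 𝓘(ℂ, Cn m) 𝓘(ℂ, ℂ) (fun y => (trivializationAt ℂ K x ⟨y, s y⟩).2) x

/-- The zero loci `D_j = {σ_j = 0}` of the holomorphic sections `σ_j` of the line bundles `L_j`
are the components of a divisor `D = ∑ D_j` with simple normal crossings, and `σ_j` is a
defining section of `D_j` (it vanishes along `D_j` with multiplicity one): each `D_j` is nonempty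
and connected, and at every point the differentials of those `σ_j` that vanish at the
point are linearly independent over `ℂ`. (So the `D_j` are smooth; being smooth
and connected, they are irreducible.) -/
structure IsSNCDivisor (σ : ∀ j, Cₛ^ω⟮𝓘(ℂ, Cn m); ℂ, L j⟯) : Prop where
  connected : ∀ j, IsConnected {x : X | σ j x = 0}
  transversal : ∀ x : X, LinearIndependent ℂ
    (fun j : {j : Fin N // σ j x = 0} => localDifferential (σ j.1) x)

theorem isOpen_ne_zero {K : X → Type*} [∀ x, AddCommGroup (K x)] [∀ x, Module ℂ (K x)]
    [∀ x, TopologicalSpace (K x)] [TopologicalSpace (TotalSpace ℂ K)] [FiberBundle ℂ K]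
    [VectorBundle ℂ ℂ K] (s : Cₛ^ω⟮𝓘(ℂ, Cn m); ℂ, K⟯) : IsOpen {x : X | s x ≠ 0} := by
  rw [isOpen_iff_mem_nhds]
  intro x hx
  have hb : x ∈ (trivializationAt ℂ K x).baseSet := FiberBundle.mem_baseSet_trivializationAt' x
  have hc : ContinuousAt (fun y => (trivializationAt ℂ K x ⟨y, s y⟩).2) x := by
    have h1 := (contMDiffAt_section (IB := 𝓘(ℂ, Cn m)) (n := ω) (F := ℂ) (E := K) (s := fun y => s y) (x₀ := x)).1
      s.contMDiff.contMDiffAt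
    exact h1.continuousAt
  have key : ∀ y ∈ (trivializationAt ℂ K x).baseSet,
      (s y = 0 ↔ (trivializationAt ℂ K x ⟨y, s y⟩).2 = 0) := by
    intro y hy
    have := ((trivializationAt ℂ K x).continuousLinearEquivAt ℂ y hy).map_eq_zero_iff (x := s y)
    exact this.symm
  have hx0 : (trivializationAt ℂ K x ⟨x, s x⟩).2 ≠ 0 := fun h => hx ((key x hb).2 h)
  filter_upwards [hc.eventually_ne hx0, (trivializationAt ℂ K x).open_baseSet.mem_nhds hb]
    with y h1 h2 h3
  exact h1 ((key y h2).1 h3)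

/-- The open set `X ∖ D`, the complement of the zero loci of the sections `σ_j`. -/
def complement (σ : ∀ j, Cₛ^ω⟮𝓘(ℂ, Cn m); ℂ, L j⟯) : TopologicalSpace.Opens X where
  carrier := {x | ∀ j, σ j x ≠ 0}
  is_open' := by
    have : {x : X | ∀ j, σ j x ≠ 0} = ⋂ j, {x : X | σ j x ≠ 0} := by ext; simp
    rw [this]
    exact isOpen_iInter_of_finite fun j => isOpen_ne_zero (σ j)

/-- The function `u_j = log (λ + ρ_j)` on `X ∖ D`, where `ρ_j = - log |σ_j|_j²`. -/
def potential (σ : ∀ j, Cₛ^ω⟮𝓘(ℂ, Cn m); ℂ, L j⟯) (h : ∀ j, HermitianMetric m (L j)) (lam : ℝ)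
    (j : Fin N) (x : complement σ) : ℝ :=
  Real.log (lam - Real.log ((h j).normSq x.1 (σ j x.1)))

/-- The value at `(v, w)` of the model form `ω = ω₀ - ∑ A_j i ∂∂̄ u_j` on `X ∖ D`. -/
def modelForm [IsManifold 𝓘(ℂ, Cn m) ω X] (Ω : KahlerForm m X)
    (σ : ∀ j, Cₛ^ω⟮𝓘(ℂ, Cn m); ℂ, L j⟯) (h : ∀ j, HermitianMetric m (L j)) (A : Fin N → ℝ)
    (lam : ℝ) (x : complement σ) (v w : TangentSpace 𝓘(ℝ, Cn m) x) : ℝ :=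
  Ω.restrict (complement σ) x v w - ∑ j, A j * iddbar (potential σ h lam j) x v w

/-- The metric `g` on `X ∖ D` is quasi-isometric to (mutually bounded with) the metric
`(v, w) ↦ ω (v, J w)` of the model form `ω`. -/
def IsQuasiIsometric [IsManifold 𝓘(ℂ, Cn m) ω X] (Ω : KahlerForm m X)
    (σ : ∀ j, Cₛ^ω⟮𝓘(ℂ, Cn m); ℂ, L j⟯) (h : ∀ j, HermitianMetric m (L j)) (A : Fin N → ℝ)
    (lam : ℝ) (g : SmoothMetric (Cn m) (complement σ)) : Prop :=
  ∃ c : ℝ, 0 < c ∧ ∀ (x : complement σ) (v : TangentSpace 𝓘(ℝ, Cn m) x),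
    c * modelForm Ω σ h A lam x v (J x v) ≤ g.inner x v v ∧
    g.inner x v v ≤ c⁻¹ * modelForm Ω σ h A lam x v (J x v)

end Divisor

end

end PoincareType

/-! Near a point of `D` there are holomorphic coordinates in which the components through that point
are coordinate hyperplanes `z_i = 0`. Since `log |z_i|²` is pluriharmonic, `-i∂∂̄ log (λ + ρ_j)` is,
up to constants and bounded terms, the Poincaré metric `|dz_i|² / (|z_i|² log² |z_i|)` of the
punctured disc. The bounded terms have no sign; the hypothesis `ω ≥ ε ω₀` absorbs them
(`exists_comparison`). Hence `g` is quasi-isometric near each point to a product of Poincaré and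
Euclidean metrics (`exists_metricAt_bound`).

The map `(x, y) ↦ exp (-l/x + i(2πy - π))` parametrizes a slit punctured disc by the unit square,
and turns the Poincaré metric into `x⁻² dx² + (2π/l)² x² dy²`. So the cusp becomes the face `x = 0`
of a cube, the volume is comparable to Lebesgue measure, and the `k`-th coordinate vector has length
at most a multiple of `1 / x_k`: this is `IsCubeChart`. In such a chart the energy of `v` dominates
`∑ ∫ x_k² (∂_k v)²`.

This degenerate energy still controls the oscillation of `v`, by Hardy's inequality. The base point
is taken at the end of the interval away from the degeneration, so no boundary condition at the cusp
is needed (`hardy_interval`). The inequality is tensorized in `lintegral_lintegral_sub_sq_cube` and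
extended to weakly differentiable functions by mollification on smaller cubes in
`lintegral_lintegral_sub_sq_unitCube`. The slits and `D` itself cost nothing: the weak derivative is
tested inside the open cube only, and the slits are null sets.

To globalize, oscillation is measured by `∬ (v x - v y)²`, which involves no mean value and can be
chained through overlaps of positive volume (`exists_dirichletDiff_univ_le`). The charts come from
an open cover of `X`, not of `X ∖ D`: compactness of `X` makes it finite and connectedness of `X`
provides the chains. For `v` of mean zero the double integral bounds the total volume, which is
finite, times `∫ v²` (`mul_ofReal_integral_sq_le`). -/

open scoped ContDiff Manifold Topology
open Bundle MeasureTheory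

namespace PoincareType

noncomputable section

/-! ### A weighted Poincaré inequality on the unit cube -/

section Cube

open Set
open scoped ENNReal

/-- Hardy's inequality on an interval, with base point at the right end. -/
theorem hardy_interval {f : ℝ → ℝ} (hf : ContDiff ℝ 1 f) {a b : ℝ} (ha : 0 ≤ a) (hab : a ≤ b) :
    ∫ s in a..b, (f s - f b) ^ 2 ≤ 4 * ∫ s in a..b, s ^ 2 * (deriv f s) ^ 2 := by
  have hc : Continuous f := hf.continuous
  have hd : Continuous (deriv f) := hf.continuous_deriv le_rfl
  have hD : ∀ s, HasDerivAt f (deriv f s) s := fun s =>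
    (hf.differentiable one_ne_zero s).hasDerivAt
  -- This primitive vanishes at both ends, by its first factor at `a` and by its second at `b`, so
  -- the integral of its derivative is zero.
  have h1 : ∀ s ∈ uIcc a b, HasDerivAt (fun s => (s - a) * (f s - f b) ^ 2)
      ((f s - f b) ^ 2 + (s - a) * (2 * (f s - f b) * deriv f s)) s := by
    intro s _
    have := ((hasDerivAt_id s).sub_const a).mul (((hD s).sub_const (f b)).pow 2)
    convert! this using 1
    simp
  have h2 := intervalIntegral.integral_eq_sub_of_hasDerivAt h1
    (Continuous.intervalIntegrable (by fun_prop) _ _)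
  -- With `F = f s - f b`, the cross term `2 (s - a) F f'` is at least `-F²/2 - 2 (s - a)² f'²`, and
  -- `s - a ≤ s` because `a ≥ 0`. Integration gives `∫ F² / 2 ≤ 2 ∫ s² f'²`, whence the factor 4.
  have h3 : ∫ s in a..b, (1 / 2 * (f s - f b) ^ 2 - 2 * (s ^ 2 * (deriv f s) ^ 2)) ≤
      ∫ s in a..b, ((f s - f b) ^ 2 + (s - a) * (2 * (f s - f b) * deriv f s)) := by
    apply intervalIntegral.integral_mono_on hab
    · exact Continuous.intervalIntegrable (by fun_prop) _ _
    · exact Continuous.intervalIntegrable (by fun_prop) _ _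
    · intro s hs
      have h4 : (s - a) ^ 2 ≤ s ^ 2 := by nlinarith [hs.1, hs.2]
      nlinarith [sq_nonneg ((f s - f b) + 2 * (s - a) * deriv f s),
        mul_le_mul_of_nonneg_right h4 (sq_nonneg (deriv f s))]
  rw [h2, intervalIntegral.integral_sub, intervalIntegral.integral_const_mul,
    intervalIntegral.integral_const_mul] at h3
  · simp at h3; linarith
  · exact Continuous.intervalIntegrable (by fun_prop) _ _
  · exact Continuous.intervalIntegrable (by fun_prop) _ _

theorem ofReal_sub_sq_le (x y z : ℝ) : ENNReal.ofReal ((x - y) ^ 2) ≤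
    2 * ENNReal.ofReal ((x - z) ^ 2) + 2 * ENNReal.ofReal ((z - y) ^ 2) := by
  rw [← ENNReal.ofReal_ofNat 2, ← ENNReal.ofReal_mul (by norm_num),
    ← ENNReal.ofReal_mul (by norm_num), ← ENNReal.ofReal_add (by positivity) (by positivity)]
  apply ENNReal.ofReal_le_ofReal
  nlinarith [sq_nonneg (x - z - (z - y))]

/-- Both values are compared with `f b`. Each of the two resulting terms carries a factor 2 and an
interval length at most 1, so Hardy's constant 4 becomes `4 * 4`. -/
theorem lintegral_lintegral_sub_sq_interval {f : ℝ → ℝ} (hf : ContDiff ℝ 1 f) {a b : ℝ}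
    (ha : 0 ≤ a) (hb : b ≤ 1) :
    ∫⁻ s in Ioo a b, ∫⁻ t in Ioo a b, ENNReal.ofReal ((f s - f t) ^ 2) ≤
      16 * ∫⁻ s in Ioo a b, ENNReal.ofReal (s ^ 2 * (deriv f s) ^ 2) := by
  rcases lt_or_ge b a with hab | hab
  · simp [Ioo_eq_empty (not_lt.2 hab.le)]
  have hc : Continuous f := hf.continuous
  have hd : Continuous (deriv f) := hf.continuous_deriv le_rfl
  have hvol : volume (Ioo a b) ≤ 1 := by
    rw [Real.volume_Ioo]; exact ENNReal.ofReal_le_one.2 (by linarith)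
  have conv : ∀ u : ℝ → ℝ, Continuous u → (∀ s, 0 ≤ u s) →
      ∫⁻ s in Ioo a b, ENNReal.ofReal (u s) = ENNReal.ofReal (∫ s in a..b, u s) := by
    intro u hu h0
    rw [intervalIntegral.integral_of_le hab, integral_Ioc_eq_integral_Ioo,
      ofReal_integral_eq_lintegral_ofReal]
    · exact (hu.integrableOn_Icc (a := a) (b := b)).mono_set Ioo_subset_Icc_self
    · exact Filter.Eventually.of_forall h0
  set I := ∫⁻ s in Ioo a b, ENNReal.ofReal ((f s - f b) ^ 2) with hI
  have hI4 : I ≤ 4 * ∫⁻ s in Ioo a b, ENNReal.ofReal (s ^ 2 * (deriv f s) ^ 2) := by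
    rw [hI, conv _ (by fun_prop) (fun s => by positivity), conv _ (by fun_prop)
      (fun s => by positivity), ← ENNReal.ofReal_ofNat 4, ← ENNReal.ofReal_mul (by norm_num)]
    exact ENNReal.ofReal_le_ofReal (hardy_interval hf ha hab)
  have hm : Measurable fun s => ENNReal.ofReal ((f s - f b) ^ 2) := by fun_prop
  have inner : ∀ s, ∫⁻ t in Ioo a b, ENNReal.ofReal ((f s - f t) ^ 2) ≤
      2 * ENNReal.ofReal ((f s - f b) ^ 2) + 2 * I := by
    intro s
    calc ∫⁻ t in Ioo a b, ENNReal.ofReal ((f s - f t) ^ 2)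
        ≤ ∫⁻ t in Ioo a b, (2 * ENNReal.ofReal ((f s - f b) ^ 2) +
            2 * ENNReal.ofReal ((f t - f b) ^ 2)) := by
          apply lintegral_mono; intro t
          have := ofReal_sub_sq_le (f s) (f t) (f b)
          rwa [show (f b - f t) ^ 2 = (f t - f b) ^ 2 by ring] at this
      _ = 2 * ENNReal.ofReal ((f s - f b) ^ 2) * volume (Ioo a b) + 2 * I := by
          rw [lintegral_add_left measurable_const, lintegral_const, lintegral_const_mul _ hm,
            Measure.restrict_apply_univ]
      _ ≤ _ := by
          refine add_le_add ?_ le_rfl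
          exact mul_le_of_le_one_right zero_le hvol
  calc _ ≤ ∫⁻ s in Ioo a b, (2 * ENNReal.ofReal ((f s - f b) ^ 2) + 2 * I) :=
        lintegral_mono inner
    _ = 2 * I + 2 * I * volume (Ioo a b) := by
        rw [lintegral_add_right _ measurable_const, lintegral_const, lintegral_const_mul _ hm,
          Measure.restrict_apply_univ]
    _ ≤ 2 * I + 2 * I := by
        refine add_le_add le_rfl ?_
        exact mul_le_of_le_one_right zero_le hvol
    _ = 4 * I := by ring
    _ ≤ 4 * (4 * ∫⁻ s in Ioo a b, ENNReal.ofReal (s ^ 2 * (deriv f s) ^ 2)) := by gcongr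
    _ = _ := by ring

/-- The partial derivative in the `k`-th direction of `ℝⁿ`, weighted by the coordinate `x_k`:
`x_k² (∂_k f)²`. -/
def weightedPartialSq {n : ℕ} (f : (Fin n → ℝ) → ℝ) (k : Fin n) (x : Fin n → ℝ) : ℝ :=
  x k ^ 2 * (fderiv ℝ f x (Pi.single k 1)) ^ 2

-- Induction on the dimension, with one coordinate split off. The constant is uniform in the subcube
-- `(a, b)ⁿ`, because mollified functions are controlled only on cubes slightly smaller than the
-- unit cube.
set_option maxHeartbeats 1000000 in
theorem lintegral_lintegral_sub_sq_cube (n : ℕ) : ∃ K : ℝ≥0∞, K ≠ ⊤ ∧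
    ∀ (a b : ℝ), 0 ≤ a → b ≤ 1 → ∀ f : (Fin n → ℝ) → ℝ, ContDiff ℝ 1 f →
    ∫⁻ x, ∫⁻ y, ENNReal.ofReal ((f x - f y) ^ 2)
      ∂(Measure.pi fun _ : Fin n => (volume : Measure ℝ).restrict (Ioo a b))
      ∂(Measure.pi fun _ : Fin n => (volume : Measure ℝ).restrict (Ioo a b)) ≤
    K * ∑ k, ∫⁻ x, ENNReal.ofReal (weightedPartialSq f k x)
      ∂(Measure.pi fun _ : Fin n => (volume : Measure ℝ).restrict (Ioo a b)) := by
  induction n with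
  | zero =>
    refine ⟨0, by simp, fun a b ha hb f hf => ?_⟩
    have : ∀ x y : Fin 0 → ℝ, f x - f y = 0 := fun x y => by rw [Subsingleton.elim x y, sub_self]
    simp [this]
  | succ n ih =>
    obtain ⟨K, hK, ih⟩ := ih
    -- The split coordinate contributes `2 * 16` and the others `2 * K`; their sum serves for all
    -- coordinates.
    refine ⟨32 + 2 * K, by finiteness, fun a b ha hb f hf => ?_⟩
    set ν : Measure ℝ := (volume : Measure ℝ).restrict (Ioo a b) with hν
    set P : Measure (Fin n → ℝ) := Measure.pi fun _ => ν with hP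
    have hν1 : ν univ ≤ 1 := by
      rw [hν, Measure.restrict_apply_univ, Real.volume_Ioo]
      exact ENNReal.ofReal_le_one.2 (by linarith)
    have hP1 : P univ ≤ 1 := by
      rw [hP, Measure.pi_univ]; exact Finset.prod_le_one' (fun _ _ => hν1)
    have hmp := (measurePreserving_piFinSuccAbove (fun _ : Fin (n + 1) => ν) 0).symm
    have hsplit : ∀ u : (Fin (n + 1) → ℝ) → ℝ≥0∞, Measurable u →
        ∫⁻ x, u x ∂(Measure.pi fun _ : Fin (n + 1) => ν) =
          ∫⁻ s, ∫⁻ x, u (Fin.cons s x) ∂P ∂ν := by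
      intro u hu
      rw [← hmp.lintegral_comp hu, lintegral_prod _ (by fun_prop)]
      simp only [MeasurableEquiv.piFinSuccAbove_symm_apply, Fin.insertNthEquiv_zero]
      rfl
    have hcons : Measurable fun p : ℝ × (Fin n → ℝ) => (Fin.cons p.1 p.2 : Fin (n + 1) → ℝ) := by
      rw [measurable_pi_iff]
      intro i
      refine Fin.cases ?_ (fun j => ?_) i
      · simpa using measurable_fst
      · exact (measurable_pi_apply j).comp measurable_snd
    have hfc : Continuous f := hf.continuous
    have hm : ∀ k, Measurable fun x => ENNReal.ofReal (weightedPartialSq f k x) := by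
      intro k
      have : Continuous (fderiv ℝ f) := hf.continuous_fderiv one_ne_zero
      unfold weightedPartialSq
      fun_prop
    have hfm : Measurable f := hfc.measurable
    -- the derivative along the first coordinate
    have h1 : ∀ x : Fin n → ℝ, ∫⁻ s, ∫⁻ t, ENNReal.ofReal
        ((f (Fin.cons s x) - f (Fin.cons t x)) ^ 2) ∂ν ∂ν ≤
        16 * ∫⁻ s, ENNReal.ofReal (weightedPartialSq f 0 (Fin.cons s x)) ∂ν := by
      intro x
      have haff : ∀ s : ℝ, HasFDerivAt (fun s : ℝ => (Fin.cons s x : Fin (n + 1) → ℝ))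
          (ContinuousLinearMap.toSpanSingleton ℝ (Pi.single 0 1 : Fin (n + 1) → ℝ)) s := by
        intro s
        rw [hasFDerivAt_pi']
        intro i
        refine Fin.cases ?_ (fun j => ?_) i
        · rw [show (ContinuousLinearMap.proj 0).comp (ContinuousLinearMap.toSpanSingleton ℝ
            (Pi.single 0 1 : Fin (n + 1) → ℝ)) = ContinuousLinearMap.id ℝ ℝ by ext; simp]
          exact hasFDerivAt_id s
        · rw [show (ContinuousLinearMap.proj j.succ).comp (ContinuousLinearMap.toSpanSingleton ℝ
            (Pi.single 0 1 : Fin (n + 1) → ℝ)) = 0 by ext; simp]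
          exact hasFDerivAt_const (x j) s
      have hcd : ContDiff ℝ 1 fun s : ℝ => f (Fin.cons s x) := by
        apply hf.comp
        rw [contDiff_pi]
        intro i
        refine Fin.cases ?_ (fun j => ?_) i
        · exact contDiff_id
        · simpa using contDiff_const
      have := lintegral_lintegral_sub_sq_interval hcd ha hb
      refine this.trans (le_of_eq ?_)
      congr 1
      apply lintegral_congr
      intro s
      congr 1
      unfold weightedPartialSq
      have hd := ((hf.differentiable one_ne_zero (Fin.cons s x)).hasFDerivAt.comp s
        (haff s)).hasDerivAt.deriv
      have e : (f ∘ fun s : ℝ => (Fin.cons s x : Fin (n + 1) → ℝ)) = fun s => f (Fin.cons s x) := rfl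
      rw [e] at hd
      rw [hd]
      simp
    -- the derivatives along the other coordinates
    have h2 : ∀ t : ℝ, ∫⁻ x, ∫⁻ y, ENNReal.ofReal
        ((f (Fin.cons t x) - f (Fin.cons t y)) ^ 2) ∂P ∂P ≤
        K * ∑ k : Fin n, ∫⁻ x, ENNReal.ofReal (weightedPartialSq f k.succ (Fin.cons t x)) ∂P := by
      intro t
      have haff : ∀ x : Fin n → ℝ, HasFDerivAt (fun x : Fin n → ℝ => (Fin.cons t x : Fin (n + 1) → ℝ))
          (ContinuousLinearMap.pi (Fin.cons 0 fun j => ContinuousLinearMap.proj j :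
            Fin (n + 1) → (Fin n → ℝ) →L[ℝ] ℝ)) x := by
        intro x
        rw [hasFDerivAt_pi']
        intro i
        refine Fin.cases ?_ (fun j => ?_) i
        · convert! hasFDerivAt_const t x using 1
        · convert! (ContinuousLinearMap.proj (R := ℝ) (φ := fun _ : Fin n => ℝ) j).hasFDerivAt using 1
      have hcd : ContDiff ℝ 1 fun x : Fin n → ℝ => f (Fin.cons t x) := by
        apply hf.comp
        rw [contDiff_pi]
        intro i
        refine Fin.cases ?_ (fun j => ?_) i
        · simpa using contDiff_const
        · simpa using contDiff_apply _ _ j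
      refine (ih a b ha hb _ hcd).trans (le_of_eq ?_)
      congr 1
      apply Finset.sum_congr rfl
      intro k _
      apply lintegral_congr
      intro x
      congr 1
      unfold weightedPartialSq
      have hd := ((hf.differentiable one_ne_zero (Fin.cons t x)).hasFDerivAt.comp x
        (haff x)).fderiv
      have e : (f ∘ fun x : Fin n → ℝ => (Fin.cons t x : Fin (n + 1) → ℝ)) =
        fun x => f (Fin.cons t x) := rfl
      rw [e] at hd
      rw [hd]
      have e2 : ContinuousLinearMap.pi (Fin.cons 0 fun j => ContinuousLinearMap.proj j :
          Fin (n + 1) → (Fin n → ℝ) →L[ℝ] ℝ) (Pi.single k 1) = Pi.single k.succ 1 := by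
        ext i
        refine Fin.cases ?_ (fun j => ?_) i
        · simp
        · simp [Pi.single_apply]
      rw [ContinuousLinearMap.comp_apply, e2]
      simp
    have hSm : ∀ k, ∫⁻ x, ENNReal.ofReal (weightedPartialSq f k x)
        ∂(Measure.pi fun _ : Fin (n + 1) => ν) =
        ∫⁻ s, ∫⁻ x, ENNReal.ofReal (weightedPartialSq f k (Fin.cons s x)) ∂P ∂ν :=
      fun k => hsplit _ (hm k)
    have hfcons : Measurable fun p : ℝ × (Fin n → ℝ) => f (Fin.cons p.1 p.2) := hfm.comp hcons
    have hA : Measurable fun q : (ℝ × (Fin n → ℝ)) × ℝ =>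
        ENNReal.ofReal ((f (Fin.cons q.1.1 q.1.2) - f (Fin.cons q.2 q.1.2)) ^ 2) := by
      have e1 : Measurable fun q : (ℝ × (Fin n → ℝ)) × ℝ => f (Fin.cons q.1.1 q.1.2) :=
        hfcons.comp measurable_fst
      have e2 : Measurable fun q : (ℝ × (Fin n → ℝ)) × ℝ => f (Fin.cons q.2 q.1.2) :=
        hfcons.comp (measurable_snd.prodMk (measurable_snd.comp measurable_fst))
      exact ((e1.sub e2).pow_const 2).ennreal_ofReal
    have hB : Measurable fun q : ((Fin n → ℝ) × ℝ) × (Fin n → ℝ) =>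
        ENNReal.ofReal ((f (Fin.cons q.1.2 q.1.1) - f (Fin.cons q.1.2 q.2)) ^ 2) := by
      have e1 : Measurable fun q : ((Fin n → ℝ) × ℝ) × (Fin n → ℝ) =>
          f (Fin.cons q.1.2 q.1.1) := hfcons.comp (measurable_swap.comp measurable_fst)
      have e2 : Measurable fun q : ((Fin n → ℝ) × ℝ) × (Fin n → ℝ) => f (Fin.cons q.1.2 q.2) :=
        hfcons.comp ((measurable_snd.comp measurable_fst).prodMk measurable_snd)
      exact ((e1.sub e2).pow_const 2).ennreal_ofReal
    have hm2 : Measurable fun q : (Fin (n + 1) → ℝ) × (Fin (n + 1) → ℝ) =>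
        ENNReal.ofReal ((f q.1 - f q.2) ^ 2) := by fun_prop
    set T1 : ℝ≥0∞ := ∫⁻ s, ∫⁻ x, ENNReal.ofReal (weightedPartialSq f 0 (Fin.cons s x)) ∂P ∂ν
      with hT1
    set T2 : ℝ≥0∞ := ∑ k : Fin n, ∫⁻ s, ∫⁻ x,
      ENNReal.ofReal (weightedPartialSq f k.succ (Fin.cons s x)) ∂P ∂ν with hT2
    have hA1 : Measurable fun q : ℝ × (Fin n → ℝ) => ∫⁻ t, ENNReal.ofReal
        ((f (Fin.cons q.1 q.2) - f (Fin.cons t q.2)) ^ 2) ∂ν := hA.lintegral_prod_right'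
    have hB1 : Measurable fun q : (Fin n → ℝ) × ℝ => ∫⁻ y, ENNReal.ofReal
        ((f (Fin.cons q.2 q.1) - f (Fin.cons q.2 y)) ^ 2) ∂P := hB.lintegral_prod_right'
    have step1 : ∫⁻ s, ∫⁻ x, ∫⁻ t, ENNReal.ofReal
        ((f (Fin.cons s x) - f (Fin.cons t x)) ^ 2) ∂ν ∂P ∂ν ≤ 16 * T1 := by
      rw [lintegral_lintegral_swap hA1.aemeasurable]
      refine (lintegral_mono h1).trans ?_
      have hw : Measurable fun q : (Fin n → ℝ) × ℝ =>
          ENNReal.ofReal (weightedPartialSq f 0 (Fin.cons q.2 q.1)) :=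
        (hm 0).comp (hcons.comp measurable_swap)
      rw [lintegral_const_mul _ hw.lintegral_prod_right', hT1,
        lintegral_lintegral_swap (f := fun s x => ENNReal.ofReal
          (weightedPartialSq f 0 (Fin.cons s x))) ((hm 0).comp hcons).aemeasurable]
    have step2 : ∫⁻ x, ∫⁻ t, ∫⁻ y, ENNReal.ofReal
        ((f (Fin.cons t x) - f (Fin.cons t y)) ^ 2) ∂P ∂ν ∂P ≤ K * T2 := by
      rw [lintegral_lintegral_swap hB1.aemeasurable]
      refine (lintegral_mono h2).trans ?_
      have hw : ∀ k, Measurable fun s => ∫⁻ x,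
          ENNReal.ofReal (weightedPartialSq f k (Fin.cons s x)) ∂P :=
        fun k => ((hm k).comp hcons).lintegral_prod_right'
      rw [lintegral_const_mul _ (Finset.measurable_sum _ fun k _ => hw _),
        lintegral_finsetSum _ fun k _ => hw _]
    have hsum : ∑ k, ∫⁻ x, ENNReal.ofReal (weightedPartialSq f k x)
        ∂(Measure.pi fun _ : Fin (n + 1) => ν) = T1 + T2 := by
      rw [Fin.sum_univ_succ]
      simp only [hSm]
      rfl
    have hL : Measurable fun x => ∫⁻ y, ENNReal.ofReal ((f x - f y) ^ 2)
        ∂(Measure.pi fun _ : Fin (n + 1) => ν) := hm2.lintegral_prod_right'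
    rw [hsum, hsplit _ hL]
    -- The points `(s, x)` and `(t, y)` are compared through `(t, x)`, so that each half of the path
    -- varies only one block of coordinates. The variable left over integrates to a mass at most 1.
    calc ∫⁻ s, ∫⁻ x, ∫⁻ y, ENNReal.ofReal ((f (Fin.cons s x) - f y) ^ 2)
          ∂(Measure.pi fun _ : Fin (n + 1) => ν) ∂P ∂ν
        ≤ ∫⁻ s, ∫⁻ x, (2 * ∫⁻ t, ENNReal.ofReal
            ((f (Fin.cons s x) - f (Fin.cons t x)) ^ 2) ∂ν + 2 * ∫⁻ t, ∫⁻ y, ENNReal.ofReal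
            ((f (Fin.cons t x) - f (Fin.cons t y)) ^ 2) ∂P ∂ν) ∂P ∂ν := by
          refine lintegral_mono fun s => lintegral_mono fun x => ?_
          have hu : Measurable fun y => ENNReal.ofReal ((f (Fin.cons s x) - f y) ^ 2) :=
            ((measurable_const.sub hfm).pow_const 2).ennreal_ofReal
          have hAs : Measurable fun t => ENNReal.ofReal
              ((f (Fin.cons s x) - f (Fin.cons t x)) ^ 2) :=
            hA.comp (measurable_const.prodMk measurable_id : Measurable fun t : ℝ => ((s, x), t))
          have hBx : Measurable fun t => ∫⁻ y, ENNReal.ofReal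
              ((f (Fin.cons t x) - f (Fin.cons t y)) ^ 2) ∂P :=
            hB1.comp (measurable_const.prodMk measurable_id : Measurable fun t : ℝ => (x, t))
          show ∫⁻ y, ENNReal.ofReal ((f (Fin.cons s x) - f y) ^ 2)
            ∂(Measure.pi fun _ : Fin (n + 1) => ν) ≤ _
          rw [hsplit _ hu, ← lintegral_const_mul _ hAs, ← lintegral_const_mul _ hBx,
            ← lintegral_add_left (hAs.const_mul 2)]
          refine lintegral_mono fun t => ?_
          calc ∫⁻ y, ENNReal.ofReal ((f (Fin.cons s x) - f (Fin.cons t y)) ^ 2) ∂P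
              ≤ ∫⁻ y, (2 * ENNReal.ofReal ((f (Fin.cons s x) - f (Fin.cons t x)) ^ 2) +
                2 * ENNReal.ofReal ((f (Fin.cons t x) - f (Fin.cons t y)) ^ 2)) ∂P :=
                lintegral_mono fun y => ofReal_sub_sq_le _ _ _
            _ ≤ _ := by
                rw [lintegral_add_left measurable_const, lintegral_const,
                  lintegral_const_mul' _ _ (by simp)]
                exact add_le_add (mul_le_of_le_one_right zero_le hP1) le_rfl
      _ = 2 * (∫⁻ s, ∫⁻ x, ∫⁻ t, ENNReal.ofReal
            ((f (Fin.cons s x) - f (Fin.cons t x)) ^ 2) ∂ν ∂P ∂ν) +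
          2 * (∫⁻ x, ∫⁻ t, ∫⁻ y, ENNReal.ofReal
            ((f (Fin.cons t x) - f (Fin.cons t y)) ^ 2) ∂P ∂ν ∂P) * ν univ := by
          have e : ∀ s, ∫⁻ x, (2 * ∫⁻ t, ENNReal.ofReal
            ((f (Fin.cons s x) - f (Fin.cons t x)) ^ 2) ∂ν + 2 * ∫⁻ t, ∫⁻ y, ENNReal.ofReal
            ((f (Fin.cons t x) - f (Fin.cons t y)) ^ 2) ∂P ∂ν) ∂P =
            2 * (∫⁻ x, ∫⁻ t, ENNReal.ofReal
            ((f (Fin.cons s x) - f (Fin.cons t x)) ^ 2) ∂ν ∂P) +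
            2 * (∫⁻ x, ∫⁻ t, ∫⁻ y, ENNReal.ofReal
            ((f (Fin.cons t x) - f (Fin.cons t y)) ^ 2) ∂P ∂ν ∂P) := by
            intro s
            rw [lintegral_add_right _ (hB1.lintegral_prod_right'.const_mul 2),
              lintegral_const_mul' _ _ (by simp), lintegral_const_mul' _ _ (by simp)]
          simp only [e]
          rw [lintegral_add_right _ measurable_const, lintegral_const,
            lintegral_const_mul' _ _ (by simp)]
      _ ≤ 2 * (16 * T1) + 2 * (K * T2) := by
          refine add_le_add (by gcongr) ((mul_le_of_le_one_right zero_le hν1).trans (by gcongr))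
      _ ≤ (32 + 2 * K) * T1 + (32 + 2 * K) * T2 := by
          rw [← mul_assoc, ← mul_assoc]
          gcongr
          · norm_num
          · exact le_add_self
      _ = _ := by ring

end Cube

end

end PoincareType

open scoped ContDiff Manifold Topology
open Bundle MeasureTheory

namespace PoincareType

noncomputable section

/-! ### The weighted inequality for weakly differentiable functions. -/

section WeakCube

open Set Filter Convolution
open scoped ENNReal

/-- Jensen's inequality for a density of mass at most 1: Cauchy–Schwarz applied to `p h = p^(1/2) *
(p^(1/2) h)`. -/
theorem sq_lintegral_mul_le {α : Type*} [MeasurableSpace α] (μ : Measure α) {p h : α → ℝ≥0∞}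
    (hp : AEMeasurable p μ) (hh : AEMeasurable h μ) (hp1 : ∫⁻ t, p t ∂μ ≤ 1) :
    (∫⁻ t, p t * h t ∂μ) ^ 2 ≤ ∫⁻ t, p t * h t ^ 2 ∂μ := by
  have hsq : ∀ u : ℝ≥0∞, u ^ (1 / 2 : ℝ) * u ^ (1 / 2 : ℝ) = u := fun u => by
    rw [← ENNReal.rpow_add_of_nonneg _ _ (by norm_num) (by norm_num)]; norm_num
  have key := ENNReal.lintegral_mul_le_Lp_mul_Lq μ Real.HolderConjugate.two_two
    (f := fun t => p t ^ (1 / 2 : ℝ)) (g := fun t => p t ^ (1 / 2 : ℝ) * h t)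
    (hp.pow_const _) ((hp.pow_const _).mul hh)
  have e1 : ∀ t, ((fun t => p t ^ (1 / 2 : ℝ)) * fun t => p t ^ (1 / 2 : ℝ) * h t) t =
      p t * h t := fun t => by
    simp only [Pi.mul_apply]; rw [← mul_assoc, hsq]
  have e2 : ∀ u : ℝ≥0∞, (u ^ (1 / 2 : ℝ)) ^ (2 : ℝ) = u := fun u => by
    rw [← ENNReal.rpow_mul]; norm_num
  have e3 : ∀ t, (p t ^ (1 / 2 : ℝ) * h t) ^ (2 : ℝ) = p t * h t ^ 2 := fun t => by
    rw [ENNReal.mul_rpow_of_nonneg _ _ (by norm_num), e2, ENNReal.rpow_two]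
  simp only [e1, e2, e3] at key
  calc (∫⁻ t, p t * h t ∂μ) ^ 2
      ≤ ((∫⁻ t, p t ∂μ) ^ (1 / 2 : ℝ) * (∫⁻ t, p t * h t ^ 2 ∂μ) ^ (1 / 2 : ℝ)) ^ 2 := by gcongr
    _ ≤ (1 * (∫⁻ t, p t * h t ^ 2 ∂μ) ^ (1 / 2 : ℝ)) ^ 2 := by
        gcongr; exact ENNReal.rpow_le_one hp1 (by norm_num)
    _ = _ := by rw [one_mul, ← ENNReal.rpow_two, e2]

/-- The open unit cube of `ℝⁿ`. -/
def unitCube (n : ℕ) : Set (Fin n → ℝ) := Set.pi univ fun _ => Ioo 0 1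

theorem isOpen_unitCube (n : ℕ) : IsOpen (unitCube n) :=
  isOpen_set_pi finite_univ fun _ _ => isOpen_Ioo

/-- `f k` is the weak partial derivative of `w` in the direction `k`, on the unit cube. -/
def IsWeakPartial {n : ℕ} (w : (Fin n → ℝ) → ℝ) (k : Fin n) (f : (Fin n → ℝ) → ℝ) : Prop :=
  LocallyIntegrableOn f (unitCube n) ∧
  ∀ ψ : (Fin n → ℝ) → ℝ, ContDiff ℝ ∞ ψ → HasCompactSupport ψ → tsupport ψ ⊆ unitCube n →
    ∫ y, w y * fderiv ℝ ψ y (Pi.single k 1) = - ∫ y, f y * ψ y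

/-- The weighted gradient energy of a mollification is controlled by that of the function. -/
theorem lintegral_weightedPartialSq_mollify {n : ℕ} {w f : (Fin n → ℝ) → ℝ} {k : Fin n}
    (hw : IntegrableOn w (unitCube n)) (hf : IsWeakPartial w k f)
    (Φ : ContDiffBump (0 : Fin n → ℝ)) :
    ∫⁻ x in Set.pi univ fun _ => Ioo (2 * Φ.rOut) (1 - 2 * Φ.rOut), ENNReal.ofReal
      (weightedPartialSq (Φ.normed volume ⋆[ContinuousLinearMap.lsmul ℝ ℝ, volume]
        (unitCube n).indicator w) k x) ≤
      4 * ∫⁻ x in unitCube n, ENNReal.ofReal (x k ^ 2 * f x ^ 2) := by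
  set φ : (Fin n → ℝ) → ℝ := Φ.normed volume with hφ
  set δ := Φ.rOut with hδ
  have hδ0 : 0 < δ := Φ.rOut_pos
  set W := φ ⋆[ContinuousLinearMap.lsmul ℝ ℝ, volume] (unitCube n).indicator w with hW
  have hQm : MeasurableSet (unitCube n) := (isOpen_unitCube n).measurableSet
  have hwi : Integrable ((unitCube n).indicator w) := hw.integrable_indicator hQm
  have hφc : ContDiff ℝ ∞ φ := Φ.contDiff_normed
  have hφs : HasCompactSupport φ := Φ.hasCompactSupport_normed
  have hφ0 : ∀ t, 0 ≤ φ t := fun t => Φ.nonneg_normed t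
  -- A point of the smaller cube has `x k > 2δ`, so moving it by `δ` at most halves `x k`. This lets
  -- the weight pass through the mollifier, and `2² = 4` is the constant of the statement.
  have hball : ∀ x ∈ Set.pi univ (fun _ : Fin n => Ioo (2 * δ) (1 - 2 * δ)),
      Metric.closedBall x δ ⊆ unitCube n ∧ ∀ t ∈ Metric.closedBall x δ, |x k| ≤ 2 * |t k| := by
    intro x hx
    have hc : ∀ t ∈ Metric.closedBall x δ, ∀ i, |t i - x i| ≤ δ := fun t ht i => by
      rw [← Real.dist_eq]; exact (dist_le_pi_dist t x i).trans ht
    refine ⟨fun t ht i _ => ?_, fun t ht => ?_⟩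
    · have h1 := abs_le.1 (hc t ht i); have h2 := hx i trivial
      exact ⟨by linarith [h2.1, h1.1], by linarith [h2.2, h1.2]⟩
    · have h1 := abs_le.1 (hc t ht k); have h2 := hx k trivial
      rw [abs_of_pos (by linarith [h2.1] : 0 < x k), abs_of_pos (by linarith [h2.1] : 0 < t k)]
      linarith [h2.1]
  have hsupp : ∀ x t, t ∉ Metric.closedBall x δ → φ (x - t) = 0 := by
    intro x t ht
    apply image_eq_zero_of_notMem_tsupport
    rw [hφ, Φ.tsupport_normed_eq]
    intro h
    apply ht
    rw [Metric.mem_closedBall, dist_eq_norm] at h ⊢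
    rw [← norm_neg]; simpa using h
  -- The derivative falls on the mollifier; `t ↦ φ (x - t)` is supported in a ball inside the open
  -- cube, hence is an admissible test function for the weak derivative.
  have hD : ∀ x ∈ Set.pi univ (fun _ : Fin n => Ioo (2 * δ) (1 - 2 * δ)),
      fderiv ℝ W x (Pi.single k 1) = ∫ t, f t * φ (x - t) := by
    intro x hx
    have hflip : W = (unitCube n).indicator w ⋆[(ContinuousLinearMap.lsmul ℝ ℝ).flip, volume] φ := by
      rw [hW, convolution_flip]
    have h1 := hφs.hasFDerivAt_convolution_right (μ := volume)
      ((ContinuousLinearMap.lsmul ℝ ℝ).flip) hwi.locallyIntegrable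
      (hφc.of_le (by exact_mod_cast le_top)) x
    rw [hflip, h1.fderiv, convolution_precompR_apply _ hwi.locallyIntegrable (hφs.fderiv ℝ)
      (hφc.continuous_fderiv (by simp)), convolution_def]
    have hψc : ContDiff ℝ ∞ fun t => φ (x - t) := hφc.comp (contDiff_const.sub contDiff_id)
    have hψt : tsupport (fun t => φ (x - t)) ⊆ Metric.closedBall x δ :=
      closure_minimal (fun t ht => by
        by_contra h; exact ht (hsupp x t h)) Metric.isClosed_closedBall
    have hψd : ∀ t e, fderiv ℝ (fun t => φ (x - t)) t e = - fderiv ℝ φ (x - t) e := by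
      intro t e
      have h := ((hφc.differentiable (by simp) (x - t)).hasFDerivAt.comp t
        ((hasFDerivAt_id t).const_sub x)).fderiv
      rw [show (φ ∘ HSub.hSub x) = fun t => φ (x - t) from rfl] at h
      rw [h]; simp
    have h2 := hf.2 (fun t => φ (x - t)) hψc
      (HasCompactSupport.of_support_subset_isCompact (isCompact_closedBall x δ)
        (subset_tsupport _ |>.trans hψt)) (hψt.trans (hball x hx).1)
    rw [← neg_eq_iff_eq_neg] at h2
    rw [← h2, ← integral_neg]
    apply integral_congr_ae
    refine Eventually.of_forall fun t => ?_
    simp only [hψd, ContinuousLinearMap.flip_apply, ContinuousLinearMap.lsmul_apply, smul_eq_mul]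
    by_cases ht : t ∈ unitCube n
    · rw [indicator_of_mem ht]; ring
    · have : fderiv ℝ (fun t => φ (x - t)) t = 0 :=
        image_eq_zero_of_notMem_tsupport fun h => ht ((hball x hx).1 (hψt
          (tsupport_fderiv_subset ℝ h)))
      have h3 := hψd t (Pi.single k 1)
      rw [this] at h3
      rw [indicator_of_notMem ht, neg_eq_zero.1 h3.symm]; simp
  have hfm : AEMeasurable ((unitCube n).indicator f) := by
    have := (hf.1.aestronglyMeasurable).aemeasurable
    exact (aemeasurable_indicator_iff hQm).2 this
  have hφm : Measurable φ := hφc.continuous.measurable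
  set g : (Fin n → ℝ) → ℝ≥0∞ := fun t => ‖(unitCube n).indicator f t‖ₑ with hg
  have hgm : AEMeasurable g := hfm.enorm
  have hφ1 : ∀ x, ∫⁻ t, ENNReal.ofReal (φ (x - t)) = 1 := by
    intro x
    rw [lintegral_sub_left_eq_self (fun t => ENNReal.ofReal (φ t)) x,
      ← ofReal_integral_eq_lintegral_ofReal Φ.integrable_normed (Eventually.of_forall hφ0),
      Φ.integral_normed, ENNReal.ofReal_one]
  have hpt : ∀ x ∈ Set.pi univ (fun _ : Fin n => Ioo (2 * δ) (1 - 2 * δ)),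
      ENNReal.ofReal (weightedPartialSq W k x) ≤
        4 * ∫⁻ t, ENNReal.ofReal (φ (x - t)) * (ENNReal.ofReal (t k ^ 2) * g t ^ 2) := by
    intro x hx
    have hpm : AEMeasurable fun t => ENNReal.ofReal (φ (x - t)) :=
      (hφm.comp (measurable_const.sub measurable_id)).ennreal_ofReal.aemeasurable
    have h1 : ENNReal.ofReal ((fderiv ℝ W x (Pi.single k 1)) ^ 2) ≤
        ∫⁻ t, ENNReal.ofReal (φ (x - t)) * g t ^ 2 := by
      refine le_trans ?_ (sq_lintegral_mul_le volume hpm hgm (hφ1 x).le)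
      rw [hD x hx, ← sq_abs, ENNReal.ofReal_pow (abs_nonneg _), ← Real.norm_eq_abs,
        ofReal_norm]
      gcongr
      refine (enorm_integral_le_lintegral_enorm _).trans (lintegral_mono fun t => ?_)
      simp only [hg]
      rw [enorm_mul, mul_comm, Real.enorm_of_nonneg (hφ0 _)]
      by_cases ht : t ∈ unitCube n
      · rw [indicator_of_mem ht]
      · rw [hsupp x t fun h => ht ((hball x hx).1 h)]; simp
    unfold weightedPartialSq
    rw [ENNReal.ofReal_mul (sq_nonneg _)]
    calc _ ≤ ENNReal.ofReal (x k ^ 2) * ∫⁻ t, ENNReal.ofReal (φ (x - t)) * g t ^ 2 := by gcongr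
      _ = ∫⁻ t, ENNReal.ofReal (x k ^ 2) * (ENNReal.ofReal (φ (x - t)) * g t ^ 2) := by
          rw [lintegral_const_mul' _ _ (by simp)]
      _ ≤ ∫⁻ t, 4 * (ENNReal.ofReal (φ (x - t)) * (ENNReal.ofReal (t k ^ 2) * g t ^ 2)) := by
          refine lintegral_mono fun t => ?_
          by_cases ht : t ∈ Metric.closedBall x δ
          · have h2 := (hball x hx).2 t ht
            have h3 : ENNReal.ofReal (x k ^ 2) ≤ 4 * ENNReal.ofReal (t k ^ 2) := by
              rw [← ENNReal.ofReal_ofNat 4, ← ENNReal.ofReal_mul (by norm_num)]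
              apply ENNReal.ofReal_le_ofReal
              rw [← sq_abs, ← sq_abs (t k)]
              nlinarith [abs_nonneg (x k), abs_nonneg (t k)]
            calc _ ≤ 4 * ENNReal.ofReal (t k ^ 2) * (ENNReal.ofReal (φ (x - t)) * g t ^ 2) := by
                  gcongr
              _ = _ := by ring
          · rw [hsupp x t ht]; simp
      _ = _ := by rw [lintegral_const_mul' _ _ (by simp)]
  have hmeas : AEMeasurable (fun t : Fin n → ℝ => ENNReal.ofReal (t k ^ 2) * g t ^ 2) :=
    (((measurable_pi_apply k).pow_const 2).ennreal_ofReal.aemeasurable).mul (hgm.pow_const 2)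
  calc _ ≤ ∫⁻ x in Set.pi univ fun _ : Fin n => Ioo (2 * δ) (1 - 2 * δ),
        4 * ∫⁻ t, ENNReal.ofReal (φ (x - t)) * (ENNReal.ofReal (t k ^ 2) * g t ^ 2) :=
        setLIntegral_mono' (MeasurableSet.univ_pi fun _ => measurableSet_Ioo) hpt
    _ ≤ ∫⁻ x, 4 * ∫⁻ t, ENNReal.ofReal (φ (x - t)) * (ENNReal.ofReal (t k ^ 2) * g t ^ 2) :=
        setLIntegral_le_lintegral _ _
    _ = 4 * ∫⁻ x, ∫⁻ t, ENNReal.ofReal (φ (x - t)) * (ENNReal.ofReal (t k ^ 2) * g t ^ 2) := by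
        rw [lintegral_const_mul' _ _ (by simp)]
    -- By Tonelli, integration in `x` comes first and only sees the mollifier, of mass one.
    _ = 4 * ∫⁻ t, ∫⁻ x, ENNReal.ofReal (φ (x - t)) * (ENNReal.ofReal (t k ^ 2) * g t ^ 2) := by
        rw [lintegral_lintegral_swap]
        exact ((hφm.comp (measurable_fst.sub measurable_snd)).ennreal_ofReal.aemeasurable).mul
          (hmeas.comp_quasiMeasurePreserving Measure.quasiMeasurePreserving_snd)
    _ = 4 * ∫⁻ t, ENNReal.ofReal (t k ^ 2) * g t ^ 2 := by
        congr 1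
        apply lintegral_congr
        intro t
        have hpm : Measurable fun x => ENNReal.ofReal (φ (x - t)) :=
          (hφm.comp (measurable_id.sub measurable_const)).ennreal_ofReal
        rw [lintegral_mul_const _ hpm, lintegral_sub_right_eq_self (fun x => ENNReal.ofReal (φ x)) t]
        have := hφ1 0
        rw [lintegral_sub_left_eq_self (fun t => ENNReal.ofReal (φ t)) 0] at this
        rw [this, one_mul]
    _ = 4 * ∫⁻ t in unitCube n, ENNReal.ofReal (t k ^ 2 * f t ^ 2) := by
        rw [← lintegral_indicator hQm]
        congr 1
        apply lintegral_congr
        intro t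
        simp only [hg]
        by_cases ht : t ∈ unitCube n
        · rw [indicator_of_mem ht, indicator_of_mem ht, ENNReal.ofReal_mul (sq_nonneg _),
            ← sq_abs (f t), ENNReal.ofReal_pow (abs_nonneg _), ← Real.norm_eq_abs,
            ofReal_norm]
        · rw [indicator_of_notMem ht, indicator_of_notMem ht]; simp

/-- Mollifications converge almost everywhere and satisfy the smooth inequality on cubes exhausting
the unit cube, with a fixed right-hand side. Fatou's lemma suffices on the left, so no convergence
of derivatives is needed and the right-hand side may be infinite. -/
theorem lintegral_lintegral_sub_sq_unitCube (n : ℕ) : ∃ K : ℝ≥0∞, K ≠ ⊤ ∧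
    ∀ (w : (Fin n → ℝ) → ℝ) (f : Fin n → (Fin n → ℝ) → ℝ), IntegrableOn w (unitCube n) →
    (∀ k, IsWeakPartial w k (f k)) →
    ∫⁻ x in unitCube n, ∫⁻ y in unitCube n, ENNReal.ofReal ((w x - w y) ^ 2) ≤
    K * ∑ k, ∫⁻ x in unitCube n, ENNReal.ofReal (x k ^ 2 * f k x ^ 2) := by
  obtain ⟨K, hK, hsm⟩ := lintegral_lintegral_sub_sq_cube n
  refine ⟨K * 4, by finiteness, fun w f hw hf => ?_⟩
  have hQm : MeasurableSet (unitCube n) := (isOpen_unitCube n).measurableSet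
  have hwi : Integrable ((unitCube n).indicator w) := hw.integrable_indicator hQm
  set δ : ℕ → ℝ := fun i => 1 / ((i : ℝ) + 1) with hδ
  have hδ0 : ∀ i, 0 < δ i := fun i => by positivity
  have hδt : Tendsto δ atTop (𝓝 0) := tendsto_one_div_add_atTop_nhds_zero_nat
  -- The outer radius is twice the inner one. A bounded ratio of radii is what the almost everywhere
  -- convergence of mollifications requires.
  let Φ : ℕ → ContDiffBump (0 : Fin n → ℝ) := fun i =>
    ⟨δ i / 2, δ i, by linarith [hδ0 i], by linarith [hδ0 i]⟩
  set W : ℕ → (Fin n → ℝ) → ℝ := fun i =>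
    (Φ i).normed volume ⋆[ContinuousLinearMap.lsmul ℝ ℝ, volume] (unitCube n).indicator w with hW
  have hWc : ∀ i, ContDiff ℝ 1 (W i) := fun i =>
    (Φ i).hasCompactSupport_normed.contDiff_convolution_left (n := 1) _ (Φ i).contDiff_normed
      hwi.locallyIntegrable
  have hae : ∀ᵐ x, Tendsto (fun i => W i x) atTop (𝓝 ((unitCube n).indicator w x)) :=
    ContDiffBump.ae_convolution_tendsto_right_of_locallyIntegrable (K := 2) hδt
      (Eventually.of_forall fun i => by simp [Φ]; linarith) hwi.locallyIntegrable
  let R : ℕ → Set (Fin n → ℝ) := fun i => Set.pi univ fun _ => Ioo (2 * δ i) (1 - 2 * δ i)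
  have hRm : ∀ i, MeasurableSet (R i) := fun i => MeasurableSet.univ_pi fun _ => measurableSet_Ioo
  have hRev : ∀ x ∈ unitCube n, ∀ᶠ i in atTop, x ∈ R i := by
    intro x hx
    have h1 : ∀ k : Fin n, ∀ᶠ i in atTop, x k ∈ Ioo (2 * δ i) (1 - 2 * δ i) := by
      intro k
      have h2 := hx k trivial
      have h3 : Tendsto (fun i => 2 * δ i) atTop (𝓝 0) := by simpa using hδt.const_mul 2
      have h4 : Tendsto (fun i => 1 - 2 * δ i) atTop (𝓝 1) := by simpa using h3.const_sub 1
      filter_upwards [h3.eventually_lt_const h2.1, h4.eventually_const_lt h2.2] with i h5 h6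
      exact ⟨h5, h6⟩
    filter_upwards [eventually_all.2 h1] with i hi k _ using hi k
  have hRsub : ∀ i, R i ⊆ unitCube n := fun i x hx k _ =>
    ⟨by linarith [(hx k trivial).1, hδ0 i], by linarith [(hx k trivial).2, hδ0 i]⟩
  -- The indicators bring the integrals over the varying cubes `R i` to the fixed unit cube; each of
  -- them is eventually 1 at a given point.
  let F : ℕ → (Fin n → ℝ) → (Fin n → ℝ) → ℝ≥0∞ := fun i x y =>
    (R i).indicator 1 x * (R i).indicator 1 y * ENNReal.ofReal ((W i x - W i y) ^ 2)
  have hFm : ∀ i, Measurable fun q : (Fin n → ℝ) × (Fin n → ℝ) => F i q.1 q.2 := by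
    intro i
    have h1 : Measurable ((R i).indicator (1 : (Fin n → ℝ) → ℝ≥0∞)) :=
      measurable_one.indicator (hRm i)
    have h2 := (hWc i).continuous.measurable
    exact ((h1.comp measurable_fst).mul (h1.comp measurable_snd)).mul
      (((h2.comp measurable_fst).sub (h2.comp measurable_snd)).pow_const 2).ennreal_ofReal
  set ν := (volume : Measure (Fin n → ℝ)).restrict (unitCube n) with hν
  have hae' : ∀ᵐ x ∂ν, x ∈ unitCube n ∧ Tendsto (fun i => W i x) atTop (𝓝 (w x)) := by
    filter_upwards [ae_restrict_mem hQm, ae_restrict_of_ae hae] with x h1 h2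
    rw [indicator_of_mem h1] at h2
    exact ⟨h1, h2⟩
  have hlim : ∀ᵐ x ∂ν, ∀ᵐ y ∂ν, ENNReal.ofReal ((w x - w y) ^ 2) = liminf (fun i => F i x y) atTop := by
    filter_upwards [hae'] with x hx
    filter_upwards [hae'] with y hy
    refine (Tendsto.liminf_eq ?_).symm
    have h1 : Tendsto (fun i => ENNReal.ofReal ((W i x - W i y) ^ 2)) atTop
        (𝓝 (ENNReal.ofReal ((w x - w y) ^ 2))) :=
      ENNReal.tendsto_ofReal ((hx.2.sub hy.2).pow 2)
    refine h1.congr' ?_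
    filter_upwards [hRev x hx.1, hRev y hy.1] with i h2 h3
    simp [F, h2, h3]
  have hbd : ∀ i, ∫⁻ x, ∫⁻ y, F i x y ∂ν ∂ν ≤
      K * 4 * ∑ k, ∫⁻ x in unitCube n, ENNReal.ofReal (x k ^ 2 * f k x ^ 2) := by
    intro i
    have hpi : (Measure.pi fun _ : Fin n => (volume : Measure ℝ).restrict
        (Ioo (2 * δ i) (1 - 2 * δ i))) = volume.restrict (R i) := by
      rw [← Measure.restrict_pi_pi]; rfl
    have h1 := hsm (2 * δ i) (1 - 2 * δ i) (by linarith [hδ0 i]) (by linarith [hδ0 i]) (W i) (hWc i)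
    rw [hpi] at h1
    have h2 : ∫⁻ x, ∫⁻ y, F i x y ∂ν ∂ν ≤ ∫⁻ x in R i, ∫⁻ y in R i,
        ENNReal.ofReal ((W i x - W i y) ^ 2) := by
      rw [hν, ← lintegral_indicator (hRm i)]
      refine (setLIntegral_le_lintegral _ _).trans (lintegral_mono fun x => ?_)
      by_cases hx : x ∈ R i
      · rw [indicator_of_mem hx, ← lintegral_indicator (hRm i)]
        refine (setLIntegral_le_lintegral _ _).trans (lintegral_mono fun y => ?_)
        by_cases hy : y ∈ R i <;> simp [F, hx, hy]
      · simp [F, hx]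
    refine h2.trans (h1.trans ?_)
    rw [mul_assoc K, Finset.mul_sum _ _ (4 : ℝ≥0∞)]
    exact mul_le_mul' le_rfl (Finset.sum_le_sum fun k _ => lintegral_weightedPartialSq_mollify hw (hf k) (Φ i))
  calc ∫⁻ x, ∫⁻ y, ENNReal.ofReal ((w x - w y) ^ 2) ∂ν ∂ν
      = ∫⁻ x, ∫⁻ y, liminf (fun i => F i x y) atTop ∂ν ∂ν := by
        apply lintegral_congr_ae
        filter_upwards [hlim] with x hx using lintegral_congr_ae hx
    _ ≤ ∫⁻ x, liminf (fun i => ∫⁻ y, F i x y ∂ν) atTop ∂ν :=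
        lintegral_mono fun x => lintegral_liminf_le fun i =>
          (hFm i).comp (measurable_const.prodMk measurable_id)
    _ ≤ liminf (fun i => ∫⁻ x, ∫⁻ y, F i x y ∂ν ∂ν) atTop :=
        lintegral_liminf_le fun i => (hFm i).lintegral_prod_right'
    _ ≤ _ := by
        refine liminf_le_of_le (by isBoundedDefault) fun b hb => ?_
        obtain ⟨i, hi⟩ := hb.exists
        exact hi.trans (hbd i)

end WeakCube

end

end PoincareType

open scoped ContDiff Manifold Topology
open Bundle MeasureTheory

namespace PoincareType

noncomputable section

/-! ### The Riemannian volume read in a chart. -/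

section Volume

open Set Filter
open scoped ENNReal

/-- The supremum of a family of measures carried by the sets of an open cover, which agree on the
overlaps, restricts to each of them. -/
theorem iSup_measure_apply_of_compatible {α ι : Type*} [TopologicalSpace α]
    [SecondCountableTopology α] [MeasurableSpace α] [BorelSpace α] (μ : ι → Measure α)
    (U : ι → Set α) (hU : ∀ i, IsOpen (U i)) (hcov : ⋃ i, U i = univ)
    (hcarr : ∀ i, μ i (U i)ᶜ = 0)
    (hcomp : ∀ i j A, MeasurableSet A → A ⊆ U i ∩ U j → μ i A = μ j A)
    (i : ι) {A : Set α} (hA : MeasurableSet A) (hAU : A ⊆ U i) : (⨆ i, μ i) A = μ i A := by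
  refine le_antisymm ?_ (Measure.le_iff'.1 (le_iSup μ i) A)
  rcases isEmpty_or_nonempty α with hα | hα
  · simp [Set.eq_empty_of_isEmpty A]
  obtain ⟨T, hTc, hTU⟩ := TopologicalSpace.isOpen_iUnion_countable U hU
  rw [hcov] at hTU
  have hTne : T.Nonempty := by
    rw [Set.nonempty_iff_ne_empty]; rintro rfl
    simp at hTU
    exact (Set.univ_nonempty (α := α)).ne_empty hTU.symm
  obtain ⟨f, rfl⟩ := hTc.exists_eq_range hTne
  rw [biUnion_range] at hTU
  set B : ℕ → Set α := disjointed fun n => U (f n) with hB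
  have hBm : ∀ n, MeasurableSet (B n) :=
    MeasurableSet.disjointed fun n => (hU (f n)).measurableSet
  have hBd : Pairwise (Function.onFun Disjoint B) := disjoint_disjointed _
  have hBU : ∀ n, B n ⊆ U (f n) := fun n => disjointed_subset _ n
  have hBc : ⋃ n, B n = univ := by rw [hB, iUnion_disjointed, hTU]
  -- A countable subcover, made disjoint, glues the `μ i` into a measure `ν`. Compatibility on
  -- overlaps shows that `ν` dominates every `μ j`, hence their supremum, and that it agrees with `μ
  -- i` inside `U i`.
  set ν : Measure α := Measure.sum fun n => (μ (f n)).restrict (B n) with hν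
  have hsplit : ∀ (ρ : Measure α) (S : Set α), MeasurableSet S → ρ S = ∑' n, ρ (S ∩ B n) := by
    intro ρ S hS
    rw [← measure_iUnion (fun a b hab => (hBd hab).mono inter_subset_right inter_subset_right)
      fun n => hS.inter (hBm n), ← inter_iUnion, hBc, inter_univ]
  have hνA : ∀ S, MeasurableSet S → ν S = ∑' n, μ (f n) (S ∩ B n) := by
    intro S hS
    rw [hν, Measure.sum_apply _ hS]
    exact tsum_congr fun n => Measure.restrict_apply hS
  have hcar : ∀ j S, MeasurableSet S → μ j S = μ j (S ∩ U j) := fun j S hS =>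
    (measure_inter_conull (hcarr j)).symm
  have hle : ⨆ j, μ j ≤ ν := by
    refine iSup_le fun j => Measure.le_iff.2 fun S hS => ?_
    rw [hcar j S hS, hsplit (μ j) _ (hS.inter (hU j).measurableSet), hνA S hS]
    refine ENNReal.tsum_le_tsum fun n => ?_
    rw [hcomp j (f n) _ ((hS.inter (hU j).measurableSet).inter (hBm n))
      (fun x hx => ⟨hx.1.2, hBU n hx.2⟩)]
    exact measure_mono (inter_subset_inter_left _ inter_subset_left)
  refine (Measure.le_iff'.1 hle A).trans (le_of_eq ?_)
  rw [hνA A hA, hsplit (μ i) A hA]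
  exact tsum_congr fun n => hcomp _ _ _ (hA.inter (hBm n)) fun x hx => ⟨hBU n hx.2, hAU hx.1⟩

variable {E : Type*} [NormedAddCommGroup E] [NormedSpace ℝ E]
  {M : Type*} [TopologicalSpace M] [ChartedSpace E M] [IsManifold 𝓘(ℝ, E) ∞ M]

theorem contDiffOn_transition {φ ψ : OpenPartialHomeomorph M E}
    (hφ : φ ∈ IsManifold.maximalAtlas 𝓘(ℝ, E) ∞ M) (hψ : ψ ∈ IsManifold.maximalAtlas 𝓘(ℝ, E) ∞ M) :
    ContDiffOn ℝ ∞ (ψ ∘ φ.symm) (φ.target ∩ φ.symm ⁻¹' ψ.source) := by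
  rw [← contMDiffOn_iff_contDiffOn]
  exact (contMDiffOn_of_mem_maximalAtlas hψ).comp ((contMDiffOn_symm_of_mem_maximalAtlas hφ).mono
    inter_subset_left) inter_subset_right

theorem isOpen_transition (φ ψ : OpenPartialHomeomorph M E) :
    IsOpen (φ.target ∩ φ.symm ⁻¹' ψ.source) :=
  φ.isOpen_inter_preimage_symm ψ.open_source

theorem hasFDerivAt_transition {φ ψ : OpenPartialHomeomorph M E}
    (hφ : φ ∈ IsManifold.maximalAtlas 𝓘(ℝ, E) ∞ M) (hψ : ψ ∈ IsManifold.maximalAtlas 𝓘(ℝ, E) ∞ M)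
    {y : E} (hy : y ∈ φ.target ∩ φ.symm ⁻¹' ψ.source) :
    HasFDerivAt (ψ ∘ φ.symm) (fderiv ℝ (ψ ∘ φ.symm) y) y :=
  (((contDiffOn_transition hφ hψ).contDiffAt ((isOpen_transition φ ψ).mem_nhds hy)).differentiableAt
    (by simp)).hasFDerivAt

theorem mdifferentiableAt_chart_symm {φ : OpenPartialHomeomorph M E}
    (hφ : φ ∈ IsManifold.maximalAtlas 𝓘(ℝ, E) ∞ M) {y : E} (hy : y ∈ φ.target) :
    MDifferentiableAt 𝓘(ℝ, E) 𝓘(ℝ, E) φ.symm y :=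
  ((contMDiffOn_symm_of_mem_maximalAtlas hφ).contMDiffAt
    (φ.open_target.mem_nhds hy)).mdifferentiableAt (by simp)

theorem dChartSymm_eq_comp {φ ψ : OpenPartialHomeomorph M E}
    (hφ : φ ∈ IsManifold.maximalAtlas 𝓘(ℝ, E) ∞ M) (hψ : ψ ∈ IsManifold.maximalAtlas 𝓘(ℝ, E) ∞ M)
    {y : E} (hy : y ∈ φ.target ∩ φ.symm ⁻¹' ψ.source) :
    (dChartSymm φ y : E →L[ℝ] E) =
      (dChartSymm ψ (ψ (φ.symm y)) : E →L[ℝ] E).comp (fderiv ℝ (ψ ∘ φ.symm) y) := by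
  have hτ := (hasFDerivAt_transition hφ hψ hy).hasMFDerivAt
  have h1 := (mdifferentiableAt_chart_symm hψ
    (show (ψ ∘ φ.symm) y ∈ ψ.target from ψ.map_source hy.2)).hasMFDerivAt
  have h2 := (h1.comp y hτ).congr_of_eventuallyEq (f₁ := φ.symm) (by
    filter_upwards [(isOpen_transition φ ψ).mem_nhds hy] with z hz
    exact (ψ.left_inv hz.2).symm)
  exact h2.mfderiv

variable [FiniteDimensional ℝ E]

/-- The inner product at a point, on the model space by which the tangent space is represented. -/
def metricAt (g : SmoothMetric E M) (x : M) : E →L[ℝ] E →L[ℝ] ℝ := g.inner x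

/-- The pull-back of the inner product at a point, as a bilinear form on the model space. -/
def modelBilin (g : SmoothMetric E M) (x : M) (L : E →L[ℝ] E) : LinearMap.BilinForm ℝ E :=
  LinearMap.mk₂ ℝ (fun v w => metricAt g x (L v) (L w))
    (by simp) (by simp) (by simp) (by simp)

theorem chartDet_eq (g : SmoothMetric E M) (φ : OpenPartialHomeomorph M E) (y : E) :
    chartDet g φ y = (LinearMap.BilinForm.toMatrix (Module.finBasis ℝ E)
      (modelBilin g (φ.symm y) (dChartSymm φ y))).det := by
  rw [chartDet]
  congr 1
  ext i j
  rw [LinearMap.BilinForm.toMatrix_apply]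
  rfl

/-- A change of chart with differential `T` replaces the Gram matrix `G` by `Tᵗ G T`. -/
theorem chartDet_transition (g : SmoothMetric E M) {φ ψ : OpenPartialHomeomorph M E}
    (hφ : φ ∈ IsManifold.maximalAtlas 𝓘(ℝ, E) ∞ M) (hψ : ψ ∈ IsManifold.maximalAtlas 𝓘(ℝ, E) ∞ M)
    {y : E} (hy : y ∈ φ.target ∩ φ.symm ⁻¹' ψ.source) :
    chartDet g φ y = (fderiv ℝ (ψ ∘ φ.symm) y).det ^ 2 * chartDet g ψ ((ψ ∘ φ.symm) y) := by
  have hpt : ψ.symm ((ψ ∘ φ.symm) y) = φ.symm y := ψ.left_inv hy.2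
  have e : modelBilin g (φ.symm y) (dChartSymm φ y) =
      (modelBilin g (ψ.symm ((ψ ∘ φ.symm) y)) (dChartSymm ψ ((ψ ∘ φ.symm) y))).comp
        (fderiv ℝ (ψ ∘ φ.symm) y : E →ₗ[ℝ] E) (fderiv ℝ (ψ ∘ φ.symm) y : E →ₗ[ℝ] E) := by
    rw [hpt, dChartSymm_eq_comp hφ hψ hy]
    rfl
  rw [chartDet_eq, chartDet_eq, e, LinearMap.BilinForm.toMatrix_comp (Module.finBasis ℝ E),
    Matrix.det_mul, Matrix.det_mul, Matrix.det_transpose, LinearMap.det_toMatrix]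
  rw [ContinuousLinearMap.det]
  ring

variable [MeasurableSpace E] [BorelSpace E]

instance : (lebesgue E).IsAddHaarMeasure := by unfold lebesgue; infer_instance

variable [MeasurableSpace M] [BorelSpace M]

theorem aemeasurable_chart_symm (φ : OpenPartialHomeomorph M E) :
    AEMeasurable φ.symm ((lebesgue E).restrict φ.target) :=
  φ.continuousOn_symm.aemeasurable φ.open_target.measurableSet

theorem chartVolume_apply (g : SmoothMetric E M) (φ : OpenPartialHomeomorph M E) {A : Set M}
    (hA : MeasurableSet A) : chartVolume g φ A =
      ∫⁻ y in φ.target ∩ φ.symm ⁻¹' A, ENNReal.ofReal (Real.sqrt (chartDet g φ y)) ∂(lebesgue E) := by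
  rw [chartVolume, Measure.map_apply_of_aemeasurable
    ((aemeasurable_chart_symm φ).mono_ac (withDensity_absolutelyContinuous _ _)) hA,
    withDensity_apply', Measure.restrict_restrict' φ.open_target.measurableSet, inter_comm]

theorem measurableSet_preimage_chart_symm (φ : OpenPartialHomeomorph M E) {A : Set M}
    (hA : MeasurableSet A) : MeasurableSet (φ.target ∩ φ.symm ⁻¹' A) := by
  have h := φ.continuousOn_symm.domRestrict.measurable hA
  have e : φ.target ∩ φ.symm ⁻¹' A = (↑) '' (φ.target.domRestrict φ.symm ⁻¹' A) := by
    ext y; simp [and_comm]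
  rw [e]
  exact φ.open_target.measurableSet.subtype_image h

/-- The Jacobian in the change of variables formula is the square root of the factor in
`chartDet_transition`. -/
theorem chartVolume_compat (g : SmoothMetric E M) {φ ψ : OpenPartialHomeomorph M E}
    (hφ : φ ∈ IsManifold.maximalAtlas 𝓘(ℝ, E) ∞ M) (hψ : ψ ∈ IsManifold.maximalAtlas 𝓘(ℝ, E) ∞ M)
    {A : Set M} (hA : MeasurableSet A) (hAs : A ⊆ φ.source ∩ ψ.source) :
    chartVolume g φ A = chartVolume g ψ A := by
  rw [chartVolume_apply g φ hA, chartVolume_apply g ψ hA]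
  have hsub : φ.target ∩ φ.symm ⁻¹' A ⊆ φ.target ∩ φ.symm ⁻¹' ψ.source :=
    fun y hy => ⟨hy.1, (hAs hy.2).2⟩
  have himg : ψ.target ∩ ψ.symm ⁻¹' A = (ψ ∘ φ.symm) '' (φ.target ∩ φ.symm ⁻¹' A) := by
    ext z
    constructor
    · rintro ⟨hz, hzA⟩
      refine ⟨φ (ψ.symm z), ⟨φ.map_source (hAs hzA).1, ?_⟩, ?_⟩
      · simpa [φ.left_inv (hAs hzA).1] using hzA
      · simp [φ.left_inv (hAs hzA).1, ψ.right_inv hz]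
    · rintro ⟨y, hy, rfl⟩
      refine ⟨ψ.map_source (hsub hy).2, ?_⟩
      simpa [ψ.left_inv (hsub hy).2] using hy.2
  rw [himg, lintegral_image_eq_lintegral_abs_det_fderiv_mul (lebesgue E)
    (measurableSet_preimage_chart_symm φ hA)
    (fun y hy => (hasFDerivAt_transition hφ hψ (hsub hy)).hasFDerivWithinAt)
    (fun y hy z hz hyz => by
      have := ψ.injOn (hsub hy).2 (hsub hz).2 hyz
      exact φ.symm.injOn hy.1 hz.1 this)]
  refine setLIntegral_congr_fun (measurableSet_preimage_chart_symm φ hA) fun y hy => ?_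
  rw [chartDet_transition g hφ hψ (hsub hy), Real.sqrt_mul (sq_nonneg _), Real.sqrt_sq_eq_abs,
    ENNReal.ofReal_mul (abs_nonneg _)]

/-- The Riemannian volume restricts on the domain of a chart to the volume in the chart. -/
theorem riemannianVolume_apply [SecondCountableTopology M] (g : SmoothMetric E M)
    {φ : OpenPartialHomeomorph M E} (hφ : φ ∈ IsManifold.maximalAtlas 𝓘(ℝ, E) ∞ M) {A : Set M}
    (hA : MeasurableSet A) (hAs : A ⊆ φ.source) : riemannianVolume g A = chartVolume g φ A := by
  rw [riemannianVolume, iSup_subtype']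
  refine iSup_measure_apply_of_compatible
    (fun φ : {φ // φ ∈ IsManifold.maximalAtlas 𝓘(ℝ, E) ∞ M} => chartVolume g φ.1)
    (fun φ => φ.1.source) (fun φ => φ.1.open_source) ?_ ?_ ?_ ⟨φ, hφ⟩ hA hAs
  · refine eq_univ_of_forall fun x => mem_iUnion.2
      ⟨⟨chartAt E x, IsManifold.chart_mem_maximalAtlas x⟩, mem_chart_source E x⟩
  · rintro ⟨ψ, hψ⟩
    simp only
    rw [chartVolume_apply g ψ ψ.open_source.measurableSet.compl]
    have : ψ.target ∩ ψ.symm ⁻¹' ψ.sourceᶜ = ∅ := by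
      ext y; simp only [mem_inter_iff, mem_preimage, mem_compl_iff, mem_empty_iff_false, iff_false]
      exact fun h => h.2 (ψ.map_target h.1)
    rw [this]; simp
  · rintro ⟨φ, hφ⟩ ⟨ψ, hψ⟩ A hA hAs
    exact chartVolume_compat g hφ hψ hA hAs

theorem riemannianVolume_restrict [SecondCountableTopology M] (g : SmoothMetric E M)
    {φ : OpenPartialHomeomorph M E} (hφ : φ ∈ IsManifold.maximalAtlas 𝓘(ℝ, E) ∞ M) :
    (riemannianVolume g).restrict φ.source = chartVolume g φ := by
  ext A hA
  have h0 : chartVolume g φ φ.sourceᶜ = 0 := by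
    rw [chartVolume_apply g φ φ.open_source.measurableSet.compl]
    have : φ.target ∩ φ.symm ⁻¹' φ.sourceᶜ = ∅ := by
      ext y; simp only [mem_inter_iff, mem_preimage, mem_compl_iff, mem_empty_iff_false, iff_false]
      exact fun h => h.2 (φ.map_target h.1)
    rw [this]; simp
  rw [Measure.restrict_apply hA, riemannianVolume_apply g hφ
    (hA.inter φ.open_source.measurableSet) inter_subset_right, measure_inter_conull h0]

/-- A set whose image in a chart is Lebesgue-null is null for the Riemannian volume. -/
theorem riemannianVolume_null [SecondCountableTopology M] (g : SmoothMetric E M)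
    {φ : OpenPartialHomeomorph M E} (hφ : φ ∈ IsManifold.maximalAtlas 𝓘(ℝ, E) ∞ M) {A : Set M}
    (hA : MeasurableSet A) (hAs : A ⊆ φ.source)
    (h0 : lebesgue E (φ.target ∩ φ.symm ⁻¹' A) = 0) : riemannianVolume g A = 0 := by
  rw [riemannianVolume_apply g hφ hA hAs, chartVolume_apply g φ hA]
  exact setLIntegral_measure_zero _ _ h0

end Volume

end

end PoincareType

open scoped ContDiff Manifold Topology
open Bundle MeasureTheory

namespace PoincareType

noncomputable section

/-! ### From local to global oscillation estimates. -/

section Chaining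

open Set Filter
open scoped ENNReal

variable {α : Type*} [MeasurableSpace α]

/-- The double integral of `|v x - v y|²` over `A × B`. -/
def dirichletDiff (μ : Measure α) (v : α → ℝ) (A B : Set α) : ℝ≥0∞ :=
  ∫⁻ x in A, ∫⁻ y in B, ENNReal.ofReal ((v x - v y) ^ 2) ∂μ ∂μ

theorem measurable_ofReal_sub_sq {v : α → ℝ} (hv : Measurable v) :
    Measurable fun q : α × α => ENNReal.ofReal ((v q.1 - v q.2) ^ 2) :=
  (((hv.comp measurable_fst).sub (hv.comp measurable_snd)).pow_const 2).ennreal_ofReal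

theorem dirichletDiff_mono {μ : Measure α} {v : α → ℝ} {A A' B B' : Set α} (hA : A ⊆ A')
    (hB : B ⊆ B') : dirichletDiff μ v A B ≤ dirichletDiff μ v A' B' :=
  (lintegral_mono_set hA).trans (lintegral_mono fun _ => lintegral_mono_set hB)

theorem dirichletDiff_congr {μ : Measure α} {v v' : α → ℝ} (h : v =ᵐ[μ] v') (A B : Set α) :
    dirichletDiff μ v A B = dirichletDiff μ v' A B := by
  refine lintegral_congr_ae ?_
  filter_upwards [ae_restrict_of_ae h] with x hx
  refine lintegral_congr_ae ?_
  filter_upwards [ae_restrict_of_ae h] with y hy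
  rw [hx, hy]

/-- The inequality `(v x - v y)² ≤ 2 (v x - v z)² + 2 (v z - v y)²` is integrated over `x ∈ A`, `y ∈
B` and the intermediate point `z ∈ O`. -/
theorem mul_dirichletDiff_le {μ : Measure α} [SFinite μ] {v : α → ℝ} (hv : Measurable v)
    (A B O : Set α) : μ O * dirichletDiff μ v A B ≤
      2 * μ B * dirichletDiff μ v A O + 2 * μ A * dirichletDiff μ v O B := by
  have hm := measurable_ofReal_sub_sq hv
  have hz : ∀ z, dirichletDiff μ v A B ≤
      2 * μ B * (∫⁻ x in A, ENNReal.ofReal ((v x - v z) ^ 2) ∂μ) +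
      2 * μ A * (∫⁻ y in B, ENNReal.ofReal ((v z - v y) ^ 2) ∂μ) := by
    intro z
    have h1 : Measurable fun x => ENNReal.ofReal ((v x - v z) ^ 2) := by fun_prop
    have h2 : Measurable fun y => ENNReal.ofReal ((v z - v y) ^ 2) := by fun_prop
    calc dirichletDiff μ v A B ≤ ∫⁻ x in A, ∫⁻ y in B, (2 * ENNReal.ofReal ((v x - v z) ^ 2) +
          2 * ENNReal.ofReal ((v z - v y) ^ 2)) ∂μ ∂μ :=
          lintegral_mono fun x => lintegral_mono fun y => ofReal_sub_sq_le _ _ _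
      _ = _ := by
          simp only [lintegral_add_left measurable_const, lintegral_const,
            lintegral_const_mul _ h2, Measure.restrict_apply_univ]
          rw [lintegral_add_right _ measurable_const, lintegral_const, lintegral_mul_const _
            (h1.const_mul 2), lintegral_const_mul _ h1, Measure.restrict_apply_univ]
          ring
  have hswap : ∫⁻ z in O, ∫⁻ x in A, ENNReal.ofReal ((v x - v z) ^ 2) ∂μ ∂μ =
      dirichletDiff μ v A O := by
    rw [lintegral_lintegral_swap]
    · rfl
    · exact (hm.comp measurable_swap).aemeasurable
  calc μ O * dirichletDiff μ v A B = ∫⁻ z in O, dirichletDiff μ v A B ∂μ := by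
        rw [lintegral_const, Measure.restrict_apply_univ, mul_comm]
    _ ≤ _ := lintegral_mono hz
    _ = _ := by
        rw [lintegral_add_left, lintegral_const_mul, lintegral_const_mul, hswap]
        · rfl
        · exact hm.lintegral_prod_right'
        · exact (hm.comp measurable_swap).lintegral_prod_right'
        · exact (hm.comp measurable_swap).lintegral_prod_right'.const_mul _

/-- Chaining local Poincaré inequalities through overlaps of positive measure. -/
theorem exists_dirichletDiff_univ_le {ι : Type*} [Finite ι] {μ : Measure α} [SFinite μ]
    {U : ι → Set α} (hfin : ∀ i, μ (U i) ≠ ⊤)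
    (hcov : μ (⋃ i, U i)ᶜ = 0)
    (hconn : ∀ i j, Relation.ReflTransGen (fun i j => μ (U i ∩ U j) ≠ 0) i j)
    {C₀ : ι → ℝ≥0∞} (hC₀ : ∀ i, C₀ i ≠ ⊤) :
    ∃ C : ℝ≥0∞, C ≠ ⊤ ∧ ∀ (v : α → ℝ) (I : ℝ≥0∞), Measurable v →
      (∀ i, dirichletDiff μ v (U i) (U i) ≤ C₀ i * I) → dirichletDiff μ v univ univ ≤ C * I := by
  have hpair : ∀ i j, ∃ C : ℝ≥0∞, C ≠ ⊤ ∧ ∀ (v : α → ℝ) (I : ℝ≥0∞), Measurable v →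
      (∀ i, dirichletDiff μ v (U i) (U i) ≤ C₀ i * I) →
        dirichletDiff μ v (U i) (U j) ≤ C * I := by
    intro i j
    induction hconn i j with
    | refl => exact ⟨C₀ i, hC₀ i, fun v I _ h => h i⟩
    | @tail j k _ hjk ih =>
      obtain ⟨C, hC, ih⟩ := ih
      -- The intermediate point runs over the overlap `U j ∩ U k`; dividing by its measure is
      -- possible because this link of the chain has nonzero measure.
      refine ⟨(μ (U j ∩ U k))⁻¹ * (2 * μ (U k) * C + 2 * μ (U i) * C₀ k), ?_, fun v I hv h => ?_⟩
      · have := ENNReal.inv_ne_top.2 hjk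
        have := hC₀ k; have := hfin k; have := hfin i
        finiteness
      · have h0 := hjk
        have ht : μ (U j ∩ U k) ≠ ⊤ := ((measure_mono inter_subset_left).trans_lt
          (hfin j).lt_top).ne
        have h1 := mul_dirichletDiff_le (μ := μ) hv (U i) (U k) (U j ∩ U k)
        have h2 : dirichletDiff μ v (U i) (U j ∩ U k) ≤ C * I :=
          (dirichletDiff_mono Subset.rfl inter_subset_left).trans (ih v I hv h)
        have h3 : dirichletDiff μ v (U j ∩ U k) (U k) ≤ C₀ k * I :=
          (dirichletDiff_mono inter_subset_right Subset.rfl).trans (h k)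
        calc dirichletDiff μ v (U i) (U k) = (μ (U j ∩ U k))⁻¹ *
              (μ (U j ∩ U k) * dirichletDiff μ v (U i) (U k)) := by
              rw [← mul_assoc, ENNReal.inv_mul_cancel h0 ht, one_mul]
          _ ≤ (μ (U j ∩ U k))⁻¹ * (2 * μ (U k) * (C * I) + 2 * μ (U i) * (C₀ k * I)) := by
              gcongr
              exact h1.trans (by gcongr)
          _ = _ := by ring
  choose C hC hCb using hpair
  cases nonempty_fintype ι
  refine ⟨∑ i, ∑ j, C i j, by simp [hC], fun v I hv h => ?_⟩
  have hle : ∀ F : α → ℝ≥0∞, ∫⁻ x in univ, F x ∂μ ≤ ∑ i, ∫⁻ x in U i, F x ∂μ := by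
    intro F
    have h1 : μ.restrict (⋃ i, U i) = μ :=
      Measure.restrict_eq_self_of_ae_mem (by rw [ae_iff]; exact hcov)
    rw [Measure.restrict_univ]
    calc ∫⁻ x, F x ∂μ = ∫⁻ x in ⋃ i, U i, F x ∂μ := by rw [h1]
      _ ≤ ∑' i, ∫⁻ x in U i, F x ∂μ := lintegral_iUnion_le _ _
      _ = _ := tsum_fintype _
  calc dirichletDiff μ v univ univ
      ≤ ∑ i, ∫⁻ x in U i, ∫⁻ y in univ, ENNReal.ofReal ((v x - v y) ^ 2) ∂μ ∂μ := hle _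
    _ ≤ ∑ i, ∫⁻ x in U i, ∑ j, ∫⁻ y in U j, ENNReal.ofReal ((v x - v y) ^ 2) ∂μ ∂μ :=
        Finset.sum_le_sum fun i _ => lintegral_mono fun x => hle _
    _ = ∑ i, ∑ j, dirichletDiff μ v (U i) (U j) := by
        refine Finset.sum_congr rfl fun i _ => ?_
        rw [lintegral_finsetSum]
        · rfl
        · exact fun j _ => (measurable_ofReal_sub_sq hv).lintegral_prod_right'
    _ ≤ ∑ i, ∑ j, C i j * I := by
        gcongr with i _ j _
        exact hCb i j v I hv h
    _ = _ := by simp only [Finset.sum_mul]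

/-- For each fixed `x` the cross term integrates to zero, so `∫ (v x - v y)² dy` is `∫ v²` plus a
nonnegative multiple of `v x ^ 2`. Integration in `x` gives the factor `μ univ`. -/
theorem mul_ofReal_integral_sq_le {μ : Measure α} [IsFiniteMeasure μ] {v : α → ℝ}
    (hv : MemLp v 2 μ) (h0 : ∫ x, v x ∂μ = 0) :
    μ univ * ENNReal.ofReal (∫ x, |v x| ^ 2 ∂μ) ≤ dirichletDiff μ v univ univ := by
  have hi : Integrable v μ := hv.integrable (by norm_num)
  have hi2 : Integrable (fun x => v x ^ 2) μ := hv.integrable_sq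
  have key : ∀ x, ENNReal.ofReal (∫ y, |v y| ^ 2 ∂μ) ≤
      ∫⁻ y, ENNReal.ofReal ((v x - v y) ^ 2) ∂μ := by
    intro x
    have e : ∀ y, (v x - v y) ^ 2 = v x ^ 2 - 2 * v x * v y + v y ^ 2 := fun y => by ring
    simp only [e, sq_abs]
    have hi3 : Integrable (fun y => v x ^ 2 - 2 * v x * v y) μ :=
      (integrable_const _).sub (hi.const_mul _)
    rw [← ofReal_integral_eq_lintegral_ofReal]
    · apply ENNReal.ofReal_le_ofReal
      rw [integral_add hi3 hi2, integral_sub (integrable_const _) (hi.const_mul _),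
        integral_const_mul, h0, integral_const]
      have : 0 ≤ μ.real univ • v x ^ 2 := by rw [smul_eq_mul]; positivity
      linarith
    · exact hi3.add hi2
    · refine Eventually.of_forall fun y => ?_
      simp only [Pi.zero_apply]
      rw [← e y]; positivity
  unfold dirichletDiff
  rw [Measure.restrict_univ, mul_comm, ← lintegral_const]
  exact lintegral_mono key

end Chaining

/-! ### Cube charts and the Poincaré inequality they yield. -/

section CubeChart

open Set Filter
open scoped ENNReal

variable {E : Type*} [NormedAddCommGroup E] [NormedSpace ℝ E]
  {M : Type*} [TopologicalSpace M] [ChartedSpace E M] [IsManifold 𝓘(ℝ, E) ∞ M]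

/-- Without boundedness the supremum defining `normSq` would take the default value 0 and bound
nothing. -/
theorem bddAbove_normSq (g : SmoothMetric E M) (α : CovectorField E M) (x : M) :
    BddAbove {r : ℝ | ∃ v : TangentSpace 𝓘(ℝ, E) x, g.inner x v v ≤ 1 ∧ r = (α x v) ^ 2} := by
  have hb := (g.isVonNBounded x).image (α x)
  rw [NormedSpace.isVonNBounded_iff, isBounded_iff_forall_norm_le] at hb
  obtain ⟨R, hR⟩ := hb
  refine ⟨(2 * R) ^ 2, ?_⟩
  rintro r ⟨v, hv, rfl⟩
  -- The bounded set supplied by the metric is the open unit ball, while `v` lies in the closed one;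
  -- halving `v` moves it inside, which doubles the bound.
  have h1 := hR (α x ((1 / 2 : ℝ) • v)) ⟨(1 / 2 : ℝ) • v, by simp; linarith, rfl⟩
  rw [map_smul, norm_smul, Real.norm_eq_abs, Real.norm_eq_abs] at h1
  have h2 : |α x v| ≤ 2 * R := by
    rw [abs_of_pos (by norm_num : (0 : ℝ) < 1 / 2)] at h1; linarith
  rw [← sq_abs]
  gcongr

theorem normSq_nonneg (g : SmoothMetric E M) (α : CovectorField E M) (x : M) :
    0 ≤ normSq g α x := by
  apply Real.sSup_nonneg
  rintro r ⟨v, _, rfl⟩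
  positivity

/-- Normalizing `v` to unit length makes it a competitor in the supremum that defines the dual norm.
-/
theorem sq_apply_le_normSq_mul (g : SmoothMetric E M) (α : CovectorField E M) (x : M)
    (v : TangentSpace 𝓘(ℝ, E) x) : (α x v) ^ 2 ≤ normSq g α x * g.inner x v v := by
  by_cases hv : v = 0
  · simp [hv]
  have hs := g.pos x v hv
  set s := g.inner x v v
  have hsq : Real.sqrt s ^ 2 = s := Real.sq_sqrt hs.le
  have hs' : 0 < Real.sqrt s := Real.sqrt_pos.2 hs
  have h1 : (α x ((Real.sqrt s)⁻¹ • v)) ^ 2 ≤ normSq g α x := by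
    refine le_csSup (bddAbove_normSq g α x) ⟨(Real.sqrt s)⁻¹ • v, ?_, rfl⟩
    simp only [map_smul, smul_apply, smul_eq_mul]
    change (Real.sqrt s)⁻¹ * ((Real.sqrt s)⁻¹ * s) ≤ 1
    rw [← mul_assoc, ← mul_inv, ← sq, hsq, inv_mul_cancel₀ hs.ne']
  rw [map_smul, smul_eq_mul, mul_pow, inv_pow, hsq, inv_mul_le_iff₀ hs] at h1
  linarith

variable [FiniteDimensional ℝ E]

variable (E) in
/-- The open unit cube with respect to the fixed basis of `E`. -/
def basisCube : Set E := {y | ∀ k, (Module.finBasis ℝ E).repr y k ∈ Ioo (0 : ℝ) 1}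

/-- A chart onto the unit cube, in which the Riemannian volume is comparable to Lebesgue measure
and the length of the `k`-th coordinate vector is at most a multiple of `1 / x_k`. -/
structure IsCubeChart (g : SmoothMetric E M) (φ : OpenPartialHomeomorph M E) : Prop where
  mem_maximalAtlas : φ ∈ IsManifold.maximalAtlas 𝓘(ℝ, E) ∞ M
  target_eq : φ.target = basisCube E
  exists_det : ∃ c C : ℝ, 0 < c ∧ ∀ y ∈ φ.target, c ≤ Real.sqrt (chartDet g φ y) ∧
    Real.sqrt (chartDet g φ y) ≤ C
  exists_le : ∃ C : ℝ, ∀ y ∈ φ.target, ∀ k,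
    (Module.finBasis ℝ E).repr y k ^ 2 * metricAt g (φ.symm y)
      (dChartSymm φ y (Module.finBasis ℝ E k)) (dChartSymm φ y (Module.finBasis ℝ E k)) ≤ C

variable [MeasurableSpace E] [BorelSpace E]

variable (E) in
/-- The coordinates given by the fixed basis. -/
def basisCoord : E ≃L[ℝ] (Fin (Module.finrank ℝ E) → ℝ) := (Module.finBasis ℝ E).equivFunL

theorem basisCoord_apply (y : E) (k) : basisCoord E y k = (Module.finBasis ℝ E).repr y k := rfl

theorem basisCoord_symm_single (k) :
    (basisCoord E).symm (Pi.single k 1) = Module.finBasis ℝ E k := by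
  rw [ContinuousLinearEquiv.symm_apply_eq]
  ext i
  rw [basisCoord_apply, Module.Basis.repr_self, Finsupp.single_eq_pi_single]

theorem basisCube_eq : basisCube E = basisCoord E ⁻¹' unitCube _ := by
  ext y; simp [basisCube, unitCube, basisCoord_apply]

theorem measurePreserving_basisCoord : MeasurePreserving (basisCoord E) (lebesgue E) volume := by
  refine ⟨(basisCoord E).continuous.measurable, ?_⟩
  rw [lebesgue, Module.Basis.map_addHaar]
  have : (Module.finBasis ℝ E).map (basisCoord E).toLinearEquiv =
      Pi.basisFun ℝ (Fin (Module.finrank ℝ E)) := by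
    ext i j
    rw [Module.Basis.map_apply, Pi.basisFun_apply]
    have := basisCoord_symm_single (E := E) i
    rw [ContinuousLinearEquiv.symm_apply_eq] at this
    exact (congrFun this j).symm
  rw [this]
  rw [Module.Basis.addHaar_def, Module.Basis.parallelepiped_basisFun,
    addHaarMeasure_eq_volume_pi]

theorem measurePreserving_basisCoord_restrict :
    MeasurePreserving (basisCoord E) ((lebesgue E).restrict (basisCube E))
      (volume.restrict (unitCube _)) := by
  rw [basisCube_eq]
  exact measurePreserving_basisCoord.restrict_preimage (isOpen_unitCube _).measurableSet

theorem lebesgue_basisCube_le : lebesgue E (basisCube E) ≤ 1 := by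
  rw [basisCube_eq, measurePreserving_basisCoord.measure_preimage
    (isOpen_unitCube _).measurableSet.nullMeasurableSet, unitCube, volume_pi_pi]
  simp

/-- A weak differential has, in the coordinates of a cube chart, weak partial derivatives. -/
theorem IsWeakDifferential.isWeakPartial {v : M → ℝ} {α : CovectorField E M}
    (h : IsWeakDifferential v α) {φ : OpenPartialHomeomorph M E}
    (hφ : φ ∈ IsManifold.maximalAtlas 𝓘(ℝ, E) ∞ M) (ht : φ.target = basisCube E) (k) :
    IsWeakPartial (fun x => v (φ.symm ((basisCoord E).symm x))) k
      (fun x => α.inChart φ ((basisCoord E).symm x) (Module.finBasis ℝ E k)) := by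
  obtain ⟨-, h2, h3⟩ := h φ hφ
  have hmp := (measurePreserving_basisCoord (E := E)).symm
    (e := (basisCoord E).toHomeomorph.toMeasurableEquiv)
  have hemb : MeasurableEmbedding (basisCoord E).symm :=
    (basisCoord E).symm.toHomeomorph.measurableEmbedding
  have hint : ∀ F : E → ℝ, ∫ x, F ((basisCoord E).symm x) = ∫ y, F y ∂(lebesgue E) :=
    fun F => hmp.integral_comp hemb F
  constructor
  · rw [locallyIntegrableOn_iff (isOpen_unitCube _).isLocallyClosed]
    intro K hK hKc
    have hK' : IsCompact ((basisCoord E).symm '' K) := hKc.image (basisCoord E).symm.continuous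
    have hsub : (basisCoord E).symm '' K ⊆ φ.target := by
      rw [ht, basisCube_eq]
      rintro _ ⟨x, hx, rfl⟩
      simpa using hK hx
    have h4 := h2.integrableOn_compact_subset hsub hK'
    have h5 : IntegrableOn (fun y => α.inChart φ y (Module.finBasis ℝ E k))
        ((basisCoord E).symm '' K) (lebesgue E) :=
      (ContinuousLinearMap.apply ℝ ℝ (Module.finBasis ℝ E k)).integrable_comp h4
    have h6 := (hmp.integrableOn_comp_preimage hemb).2 h5
    have e : (basisCoord E).toHomeomorph.toMeasurableEquiv.symm ⁻¹' ((basisCoord E).symm '' K) = K :=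
      preimage_image_eq _ (basisCoord E).symm.injective
    rw [e] at h6
    exact h6
  · intro ψ hψ hψc hψs
    have hψ' : ContDiff ℝ ∞ (ψ ∘ basisCoord E) := hψ.comp (basisCoord E).contDiff
    have hts : tsupport (ψ ∘ basisCoord E) ⊆ basisCoord E ⁻¹' tsupport ψ :=
      closure_minimal (fun y hy => subset_tsupport _ (by simpa using hy))
        ((isClosed_tsupport ψ).preimage (basisCoord E).continuous)
    have h4 := h3 (ψ ∘ basisCoord E) hψ' (hψc.comp_homeomorph (basisCoord E).toHomeomorph)
      (hts.trans (by rw [ht, basisCube_eq]; exact preimage_mono hψs)) (Module.finBasis ℝ E k)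
    rw [← hint, ← hint] at h4
    have e : ∀ x, fderiv ℝ (ψ ∘ basisCoord E) ((basisCoord E).symm x) (Module.finBasis ℝ E k) =
        fderiv ℝ ψ x (Pi.single k 1) := by
      intro x
      rw [(basisCoord E).comp_right_fderiv, ← basisCoord_symm_single]
      simp
    simpa [e] using h4

variable [MeasurableSpace M] [BorelSpace M]

theorem IsCubeChart.riemannianVolume_source_ne_top [SecondCountableTopology M]
    {g : SmoothMetric E M} {φ : OpenPartialHomeomorph M E} (hφ : IsCubeChart g φ) :
    riemannianVolume g φ.source ≠ ⊤ := by
  obtain ⟨c, C, hc, hdet⟩ := hφ.exists_det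
  rw [riemannianVolume_apply g hφ.mem_maximalAtlas φ.open_source.measurableSet Subset.rfl,
    chartVolume_apply g φ φ.open_source.measurableSet]
  refine ne_top_of_le_ne_top ?_ ((lintegral_mono_set inter_subset_left).trans
    (setLIntegral_mono' φ.open_target.measurableSet
      fun y hy => ENNReal.ofReal_le_ofReal (hdet y hy).2))
  rw [setLIntegral_const, hφ.target_eq]
  exact ENNReal.mul_ne_top (by simp) (lebesgue_basisCube_le.trans_lt ENNReal.one_lt_top).ne

/-- The local Poincaré inequality in a cube chart. -/
theorem IsCubeChart.exists_dirichletDiff_le [SecondCountableTopology M]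
    {g : SmoothMetric E M} {φ : OpenPartialHomeomorph M E} (hφ : IsCubeChart g φ) :
    ∃ C : ℝ≥0∞, C ≠ ⊤ ∧ ∀ (v : M → ℝ) (α : CovectorField E M), MemH1 g v α →
      dirichletDiff (riemannianVolume g) v φ.source φ.source ≤
        C * ∫⁻ x, ENNReal.ofReal (normSq g α x) ∂(riemannianVolume g) := by
  obtain ⟨K, hK, hcube⟩ := lintegral_lintegral_sub_sq_unitCube (Module.finrank ℝ E)
  obtain ⟨c, Cd, hc, hdet⟩ := hφ.exists_det
  obtain ⟨Cg, hg⟩ := hφ.exists_le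
  set n := Module.finrank ℝ E with hn
  set P : (Fin n → ℝ) → M := fun x => φ.symm ((basisCoord E).symm x) with hP
  set Q : Measure (Fin n → ℝ) := volume.restrict (unitCube n) with hQ
  set μ := riemannianVolume g with hμ
  set κ := chartVolume g φ with hκ
  have hκμ : μ.restrict φ.source = κ := riemannianVolume_restrict g hφ.mem_maximalAtlas
  have hmpr := (measurePreserving_basisCoord_restrict (E := E)).symm
    (e := (basisCoord E).toHomeomorph.toMeasurableEquiv)
  have hPm : AEMeasurable P Q := by
    have h1 := aemeasurable_chart_symm φ
    rw [hφ.target_eq] at h1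
    exact AEMeasurable.comp_quasiMeasurePreserving h1 hmpr.quasiMeasurePreserving
  -- `η` is Lebesgue measure on the cube carried to `M`. The bounds on the determinant make it
  -- comparable, from both sides, with the Riemannian volume on the domain of the chart.
  set η : Measure M := Q.map P with hη
  have hη' : η = ((lebesgue E).restrict φ.target).map φ.symm := by
    have h1 := aemeasurable_chart_symm φ
    rw [hφ.target_eq] at h1 ⊢
    rw [← hmpr.map_eq] at h1 ⊢
    rw [AEMeasurable.map_map_of_aemeasurable h1 hmpr.aemeasurable]
    rfl
  have hTm : MeasurableSet φ.target := φ.open_target.measurableSet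
  have hle1 : κ ≤ ENNReal.ofReal Cd • η := by
    refine Measure.le_iff.2 fun A hA => ?_
    rw [hκ, chartVolume_apply g φ hA, Measure.smul_apply, hη', smul_eq_mul,
      Measure.map_apply_of_aemeasurable (aemeasurable_chart_symm φ) hA,
      Measure.restrict_apply' hTm, inter_comm, ← setLIntegral_const]
    rw [inter_comm]
    exact setLIntegral_mono' (measurableSet_preimage_chart_symm φ hA)
      fun y hy => ENNReal.ofReal_le_ofReal (hdet y hy.1).2
  have hle2 : ENNReal.ofReal c • η ≤ κ := by
    refine Measure.le_iff.2 fun A hA => ?_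
    rw [hκ, chartVolume_apply g φ hA, Measure.smul_apply, hη', smul_eq_mul,
      Measure.map_apply_of_aemeasurable (aemeasurable_chart_symm φ) hA,
      Measure.restrict_apply' hTm, inter_comm, ← setLIntegral_const]
    exact setLIntegral_mono' (measurableSet_preimage_chart_symm φ hA)
      fun y hy => ENNReal.ofReal_le_ofReal (hdet y hy.1).1
  have hc0 : ENNReal.ofReal c ≠ 0 := by simpa using hc
  have hle3 : η ≤ (ENNReal.ofReal c)⁻¹ • κ := by
    have h1 : (ENNReal.ofReal c)⁻¹ • ENNReal.ofReal c • η ≤ (ENNReal.ofReal c)⁻¹ • κ := by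
      gcongr
    rwa [smul_smul, ENNReal.inv_mul_cancel hc0 ENNReal.ofReal_ne_top, one_smul] at h1
  have hκle : κ ≤ μ := by rw [← hκμ]; exact Measure.restrict_le_self
  have hac : η ≪ μ :=
    (Measure.absolutelyContinuous_of_le hle3).trans
      ((Measure.AbsolutelyContinuous.rfl.smul_left _).trans
        (Measure.absolutelyContinuous_of_le hκle))
  refine ⟨ENNReal.ofReal Cd * ENNReal.ofReal Cd * (K * (n * ENNReal.ofReal Cg)) *
    (ENNReal.ofReal c)⁻¹, ?_, fun v α hv => ?_⟩
  · have := ENNReal.inv_ne_top.2 hc0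
    finiteness
  -- a measurable representative
  set v' : M → ℝ := hv.memLp.aestronglyMeasurable.mk v with hv'
  have hv'm : Measurable v' := hv.memLp.aestronglyMeasurable.stronglyMeasurable_mk.measurable
  have hvv' : v =ᵐ[μ] v' := hv.memLp.aestronglyMeasurable.ae_eq_mk
  have hPvv' : ∀ᵐ x ∂Q, v' (P x) = v (P x) :=
    (ae_of_ae_map hPm (hac.ae_le hvv')).mono fun x hx => hx.symm
  have hm := measurable_ofReal_sub_sq hv'm
  -- Square integrability passes to the cube through the comparison of measures, and gives
  -- integrability because the cube has finite measure.
  have hwint : IntegrableOn (fun x => v (P x)) (unitCube n) := by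
    have h1 : MemLp v 2 κ := hκμ ▸ hv.memLp.restrict _
    have h2 : MemLp v 2 η := h1.of_measure_le_smul (ENNReal.inv_ne_top.2 hc0) hle3
    have h3 : MemLp (v ∘ P) 2 Q := h2.comp_of_map hPm
    have : IsFiniteMeasure Q := ⟨by
      rw [hQ, Measure.restrict_apply_univ, unitCube, volume_pi_pi]; simp⟩
    exact h3.integrable (by norm_num)
  have hcubeApp := hcube (fun x => v (P x))
    (fun k x => α.inChart φ ((basisCoord E).symm x) (Module.finBasis ℝ E k)) hwint
    (fun k => hv.isWeakDifferential.isWeakPartial hφ.mem_maximalAtlas hφ.target_eq k)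
  have hN : AEMeasurable (fun x => ENNReal.ofReal (normSq g α x)) μ :=
    hv.integrable_normSq.aemeasurable.ennreal_ofReal
  -- The squared `k`-th component of `α` is at most `|α|²` times the squared length of the
  -- coordinate vector, and the weight `x_k²` compensates the growth of that length.
  have hgrad : ∀ k, ∫⁻ x in unitCube n, ENNReal.ofReal (x k ^ 2 *
      (α.inChart φ ((basisCoord E).symm x) (Module.finBasis ℝ E k)) ^ 2) ≤
      ENNReal.ofReal Cg * ∫⁻ x, ENNReal.ofReal (normSq g α x) ∂η := by
    intro k
    rw [hη, lintegral_map' (hN.mono_ac hac) hPm, ← lintegral_const_mul' _ _ (by simp)]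
    refine setLIntegral_mono' (isOpen_unitCube n).measurableSet fun x hx => ?_
    have hxt : (basisCoord E).symm x ∈ φ.target := by
      rw [hφ.target_eq, basisCube_eq]; simpa using hx
    have h1 := hg _ hxt k
    rw [← basisCoord_apply, ContinuousLinearEquiv.apply_symm_apply] at h1
    have h2 : (α.inChart φ ((basisCoord E).symm x) (Module.finBasis ℝ E k)) ^ 2 ≤
        normSq g α (P x) * metricAt g (P x)
          (dChartSymm φ ((basisCoord E).symm x) (Module.finBasis ℝ E k))
          (dChartSymm φ ((basisCoord E).symm x) (Module.finBasis ℝ E k)) :=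
      sq_apply_le_normSq_mul g α (P x)
        (dChartSymm φ ((basisCoord E).symm x) (Module.finBasis ℝ E k))
    have h0 := normSq_nonneg g α (P x)
    calc ENNReal.ofReal (x k ^ 2 * _) ≤ ENNReal.ofReal (Cg * normSq g α (P x)) := by
          apply ENNReal.ofReal_le_ofReal
          refine (mul_le_mul_of_nonneg_left h2 (sq_nonneg _)).trans ?_
          rw [mul_left_comm, mul_comm Cg]
          exact mul_le_mul_of_nonneg_left h1 h0
      _ = ENNReal.ofReal Cg * ENNReal.ofReal (normSq g α (P x)) := ENNReal.ofReal_mul' h0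
  calc dirichletDiff μ v φ.source φ.source = dirichletDiff μ v' φ.source φ.source :=
        dirichletDiff_congr hvv' _ _
    _ = ∫⁻ x, ∫⁻ y, ENNReal.ofReal ((v' x - v' y) ^ 2) ∂κ ∂κ := by rw [dirichletDiff, hκμ]
    _ ≤ ∫⁻ x, ∫⁻ y, ENNReal.ofReal ((v' x - v' y) ^ 2) ∂(ENNReal.ofReal Cd • η)
          ∂(ENNReal.ofReal Cd • η) :=
        lintegral_mono' hle1 fun x => lintegral_mono' hle1 le_rfl
    _ = ENNReal.ofReal Cd * ENNReal.ofReal Cd *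
          ∫⁻ x, ∫⁻ y, ENNReal.ofReal ((v' x - v' y) ^ 2) ∂η ∂η := by
        simp only [lintegral_smul_measure, smul_eq_mul]
        rw [lintegral_const_mul' _ _ (by simp), mul_assoc]
    _ = ENNReal.ofReal Cd * ENNReal.ofReal Cd *
          ∫⁻ x, ∫⁻ y, ENNReal.ofReal ((v' (P x) - v' (P y)) ^ 2) ∂Q ∂Q := by
        have : SFinite η := by rw [hη]; infer_instance
        congr 1
        rw [hη, lintegral_map' hm.lintegral_prod_right'.aemeasurable hPm]
        refine lintegral_congr fun x => ?_
        exact lintegral_map' (hm.comp (measurable_const.prodMk measurable_id)).aemeasurable hPm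
    _ = ENNReal.ofReal Cd * ENNReal.ofReal Cd *
          ∫⁻ x, ∫⁻ y, ENNReal.ofReal ((v (P x) - v (P y)) ^ 2) ∂Q ∂Q := by
        congr 1
        refine lintegral_congr_ae (hPvv'.mono fun x hx => ?_)
        refine lintegral_congr_ae (hPvv'.mono fun y hy => ?_)
        simp only [hx, hy]
    _ ≤ ENNReal.ofReal Cd * ENNReal.ofReal Cd * (K * ∑ _k : Fin n, ENNReal.ofReal Cg *
          ∫⁻ x, ENNReal.ofReal (normSq g α x) ∂η) := by
        gcongr
        refine hcubeApp.trans ?_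
        gcongr with k
        exact hgrad k
    _ ≤ ENNReal.ofReal Cd * ENNReal.ofReal Cd * (K * (n * (ENNReal.ofReal Cg *
          ((ENNReal.ofReal c)⁻¹ * ∫⁻ x, ENNReal.ofReal (normSq g α x) ∂μ)))) := by
        rw [Finset.sum_const, Finset.card_univ, Fintype.card_fin, nsmul_eq_mul]
        gcongr
        refine (lintegral_mono' hle3 le_rfl).trans ?_
        rw [lintegral_smul_measure, smul_eq_mul]
        gcongr
    _ = _ := by ring

/-- The Poincaré inequality on a manifold that is covered, up to a null set, by finitely many cube
charts, chained through overlaps of positive volume. -/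
theorem poincare_of_cubeCharts [SecondCountableTopology M] (g : SmoothMetric E M) {ι : Type*}
    [Finite ι] (φ : ι → OpenPartialHomeomorph M E) (hφ : ∀ i, IsCubeChart g (φ i))
    (hcov : riemannianVolume g (⋃ i, (φ i).source)ᶜ = 0)
    (hconn : ∀ i j, Relation.ReflTransGen
      (fun i j => riemannianVolume g ((φ i).source ∩ (φ j).source) ≠ 0) i j) :
    ∃ C : ℝ, 0 < C ∧ ∀ (v : M → ℝ) (α : CovectorField E M), MemH1 g v α →
      ∫ x, v x ∂(riemannianVolume g) = 0 →
      ∫ x, |v x| ^ 2 ∂(riemannianVolume g) ≤ C * ∫ x, normSq g α x ∂(riemannianVolume g) := by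
  set μ := riemannianVolume g with hμ
  have hfin : IsFiniteMeasure μ := ⟨by
    cases nonempty_fintype ι
    have h1 : μ univ ≤ ∑ i, μ (φ i).source := by
      rw [← union_compl_self (⋃ i, (φ i).source)]
      refine (measure_union_le _ _).trans ?_
      rw [hcov, add_zero]
      exact measure_iUnion_fintype_le _ _
    refine h1.trans_lt ?_
    rw [ENNReal.sum_lt_top]
    exact fun i _ => (hφ i).riemannianVolume_source_ne_top.lt_top⟩
  choose C₀ hC₀ hloc using fun i => (hφ i).exists_dirichletDiff_le
  obtain ⟨C, hC, hglob⟩ := exists_dirichletDiff_univ_le (μ := μ) (U := fun i => (φ i).source)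
    (fun i => (hφ i).riemannianVolume_source_ne_top)
    hcov hconn hC₀
  -- The constant contains the inverse of the total volume, infinite if the volume vanishes.
  by_cases hμ0 : μ = 0
  · exact ⟨1, one_pos, fun v α _ _ => by simp [hμ0]⟩
  have hu0 : μ univ ≠ 0 := by simpa using hμ0
  refine ⟨((μ univ)⁻¹ * C).toReal + 1, by positivity, fun v α hv h0 => ?_⟩
  set v' : M → ℝ := hv.memLp.aestronglyMeasurable.mk v with hv'
  have hv'm : Measurable v' := hv.memLp.aestronglyMeasurable.stronglyMeasurable_mk.measurable
  have hvv' : v =ᵐ[μ] v' := hv.memLp.aestronglyMeasurable.ae_eq_mk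
  have h1 := hglob v' (∫⁻ x, ENNReal.ofReal (normSq g α x) ∂μ) hv'm (fun i => by
    rw [← dirichletDiff_congr hvv']; exact hloc i v α hv)
  rw [← dirichletDiff_congr hvv'] at h1
  have h2 := (mul_ofReal_integral_sq_le hv.memLp h0).trans h1
  have hI0 : 0 ≤ ∫ x, normSq g α x ∂μ := integral_nonneg fun x => normSq_nonneg g α x
  rw [← ofReal_integral_eq_lintegral_ofReal hv.integrable_normSq
    (Eventually.of_forall fun x => normSq_nonneg g α x)] at h2
  have h3 : ENNReal.ofReal (∫ x, |v x| ^ 2 ∂μ) ≤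
      (μ univ)⁻¹ * C * ENNReal.ofReal (∫ x, normSq g α x ∂μ) := by
    calc _ = (μ univ)⁻¹ * (μ univ * ENNReal.ofReal (∫ x, |v x| ^ 2 ∂μ)) := by
          rw [← mul_assoc, ENNReal.inv_mul_cancel hu0 (measure_ne_top _ _), one_mul]
      _ ≤ (μ univ)⁻¹ * (C * ENNReal.ofReal (∫ x, normSq g α x ∂μ)) := by gcongr
      _ = _ := by ring
  have hfinC : (μ univ)⁻¹ * C ≠ ⊤ := ENNReal.mul_ne_top (ENNReal.inv_ne_top.2 hu0) hC
  rw [← ENNReal.ofReal_toReal hfinC, ← ENNReal.ofReal_mul ENNReal.toReal_nonneg,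
    ENNReal.ofReal_le_ofReal_iff (by positivity)] at h3
  linarith

end CubeChart

end

end PoincareType

open scoped ContDiff Manifold Topology
open Bundle MeasureTheory

namespace PoincareType

noncomputable section

/-! ### The Levi form: naturality and the logarithm. -/

section Levi

open Set Filter

variable {E F : Type*} [NormedAddCommGroup E] [NormedSpace ℂ E] [NormedSpace ℝ E]
  [IsScalarTower ℝ ℂ E] [NormedAddCommGroup F] [NormedSpace ℂ F] [NormedSpace ℝ F]
  [IsScalarTower ℝ ℂ F]

/-- The Levi form of `f` at `z`, as a quadratic form: `(D²f(iV, iV) + D²f(V, V)) / 2`. -/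
def levi (f : E → ℝ) (z : E) (V : E) : ℝ :=
  (fderiv ℝ (fderiv ℝ f) z (Complex.I • V) (Complex.I • V) + fderiv ℝ (fderiv ℝ f) z V V) / 2

theorem differentiableAt_fderiv {f : E → ℝ} {z : E} (hf : ContDiffAt ℝ 2 f z) :
    DifferentiableAt ℝ (fderiv ℝ f) z :=
  (hf.fderiv_right (m := 1) (by norm_num)).differentiableAt (by norm_num)

theorem eventually_differentiableAt {f : E → ℝ} {z : E} (hf : ContDiffAt ℝ 2 f z) :
    ∀ᶠ y in 𝓝 z, DifferentiableAt ℝ f y :=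
  (hf.eventually (by simp)).mono fun _ hy => hy.differentiableAt (by norm_num)

theorem levi_congr {f f' : E → ℝ} {z : E} (h : f =ᶠ[𝓝 z] f') (V : E) :
    levi f z V = levi f' z V := by
  rw [levi, levi, h.fderiv.fderiv_eq]

theorem levi_const (c : ℝ) (z V : E) : levi (fun _ => c) z V = 0 := by
  simp [levi]

theorem levi_clm (ℓ : E →L[ℝ] ℝ) (z V : E) : levi ℓ z V = 0 := by
  have : fderiv ℝ (ℓ : E → ℝ) = fun _ => ℓ := by ext1 y; exact ℓ.fderiv
  simp [levi, this]

theorem levi_sub {f f' : E → ℝ} {z : E} (hf : ContDiffAt ℝ 2 f z) (hf' : ContDiffAt ℝ 2 f' z)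
    (V : E) : levi (fun y => f y - f' y) z V = levi f z V - levi f' z V := by
  have h : fderiv ℝ (fun y => f y - f' y) =ᶠ[𝓝 z] fun y => fderiv ℝ f y - fderiv ℝ f' y := by
    filter_upwards [eventually_differentiableAt hf, eventually_differentiableAt hf'] with y h1 h2
    exact fderiv_fun_sub h1 h2
  rw [levi, h.fderiv_eq, fderiv_fun_sub (differentiableAt_fderiv hf) (differentiableAt_fderiv hf')]
  simp only [levi, sub_apply]
  ring

/-- The Levi form is natural under holomorphic maps. -/
theorem levi_comp {f : F → ℝ} {G : E → F} {z : E} (hG : ContDiffAt ℂ 2 G z)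
    (hf : ContDiffAt ℝ 2 f (G z)) (V : E) :
    levi (f ∘ G) z V = levi f (G z) (fderiv ℝ G z V) := by
  have hGd : ∀ᶠ y in 𝓝 z, DifferentiableAt ℂ G y :=
    (hG.eventually (by simp)).mono fun _ hy => hy.differentiableAt (by norm_num)
  have hfd : ∀ᶠ y in 𝓝 z, DifferentiableAt ℝ f (G y) :=
    hG.continuousAt.eventually (eventually_differentiableAt hf)
  have h1 : fderiv ℝ (f ∘ G) =ᶠ[𝓝 z] fun y =>
      (fderiv ℝ f (G y)).comp ((fderiv ℂ G y).restrictScalars ℝ) := by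
    filter_upwards [hGd, hfd] with y h2 h3
    exact (h3.hasFDerivAt.comp y (h2.hasFDerivAt.restrictScalars ℝ)).fderiv
  have hGz : HasFDerivAt G ((fderiv ℂ G z).restrictScalars ℝ) z :=
    hGd.self_of_nhds.hasFDerivAt.restrictScalars ℝ
  have h2 : HasFDerivAt (fun y => fderiv ℝ f (G y))
      ((fderiv ℝ (fderiv ℝ f) (G z)).comp ((fderiv ℂ G z).restrictScalars ℝ)) z :=
    (differentiableAt_fderiv hf).hasFDerivAt.comp z hGz
  have h3 : HasFDerivAt (fderiv ℂ G) (fderiv ℂ (fderiv ℂ G) z) z :=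
    ((hG.fderiv_right (m := 1) (by norm_num)).differentiableAt (by norm_num)).hasFDerivAt
  have h4 : HasFDerivAt (fun y => (fderiv ℂ G y).restrictScalars ℝ)
      ((ContinuousLinearMap.restrictScalarsL ℂ E F ℝ ℝ).comp
        ((fderiv ℂ (fderiv ℂ G) z).restrictScalars ℝ)) z :=
    (ContinuousLinearMap.restrictScalarsL ℂ E F ℝ ℝ).hasFDerivAt.comp z (h3.restrictScalars ℝ)
  have h5 := h2.clm_comp h4
  rw [levi, h1.fderiv_eq, h5.fderiv]
  have e : fderiv ℝ G z = (fderiv ℂ G z).restrictScalars ℝ := hGz.fderiv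
  have hrs : ∀ L : E →L[ℂ] F, ContinuousLinearMap.restrictScalarsL ℂ E F ℝ ℝ L =
    L.restrictScalars ℝ := fun _ => rfl
  simp only [levi, e, add_apply, ContinuousLinearMap.comp_apply,
    ContinuousLinearMap.compL_apply, ContinuousLinearMap.flip_apply,
    ContinuousLinearMap.coe_restrictScalars', hrs, map_smul, smul_apply]
  -- The second differential of `G` is complex bilinear, so its values at `(iV, iV)` and `(V, V)`
  -- are opposite and the terms that contain it cancel.
  rw [smul_smul, Complex.I_mul_I, neg_one_smul, map_neg]
  ring

/-- The negative gradient term is the source of the cusp: for `τ = λ + ρ_j` it gives minus the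
Poincaré metric up to constants, while `levi τ / τ` stays bounded. -/
theorem levi_log {τ : E → ℝ} {z : E} (hτ : ContDiffAt ℝ 2 τ z) (hz : τ z ≠ 0) (V : E) :
    levi (fun y => Real.log (τ y)) z V = levi τ z V / τ z -
      ((fderiv ℝ τ z V) ^ 2 + (fderiv ℝ τ z (Complex.I • V)) ^ 2) / (2 * τ z ^ 2) := by
  have hd := eventually_differentiableAt hτ
  have h1 : fderiv ℝ (fun y => Real.log (τ y)) =ᶠ[𝓝 z] fun y => (τ y)⁻¹ • fderiv ℝ τ y := by
    filter_upwards [hd, hτ.continuousAt.eventually_ne hz] with y h2 h3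
    exact (h2.hasFDerivAt.log h3).fderiv
  have h2 : HasFDerivAt (fun y => (τ y)⁻¹) (-(τ z ^ 2)⁻¹ • fderiv ℝ τ z) z :=
    (hasDerivAt_inv hz).comp_hasFDerivAt z hd.self_of_nhds.hasFDerivAt
  have h3 := h2.fun_smul (differentiableAt_fderiv hτ).hasFDerivAt
  rw [levi, h1.fderiv_eq, h3.fderiv]
  simp only [levi, add_apply, smul_apply, ContinuousLinearMap.smulRight_apply,
    smul_eq_mul]
  field_simp
  ring

/-- The function `log |w|²` on `ℂ`. -/
def logNormSq (w : ℂ) : ℝ := Real.log (‖w‖ ^ 2)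

theorem contDiffAt_logNormSq {w : ℂ} (hw : w ≠ 0) : ContDiffAt ℝ 2 logNormSq w := by
  unfold logNormSq
  exact ((contDiff_norm_sq ℝ).contDiffAt).log (by simpa using hw)

theorem logNormSq_comp_exp : logNormSq ∘ Complex.exp = (2 • Complex.reCLM : ℂ →L[ℝ] ℝ) := by
  ext ζ
  simp [logNormSq, Complex.norm_exp, Real.log_pow]

theorem fderiv_exp_real (ζ h : ℂ) : fderiv ℝ Complex.exp ζ h = Complex.exp ζ * h := by
  have := ((Complex.hasDerivAt_exp ζ).hasFDerivAt.restrictScalars ℝ).fderiv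
  rw [this]; simp [mul_comm]

/-- `log |w|²` is harmonic: its pull-back by the exponential is the linear function `2 Re ζ`, and
`levi_comp` transports the vanishing of its Levi form. -/
theorem levi_logNormSq {w : ℂ} (hw : w ≠ 0) (h : ℂ) : levi logNormSq w h = 0 := by
  have e := Complex.exp_log hw
  have h1 := levi_comp (f := logNormSq) (G := Complex.exp) (z := Complex.log w)
    Complex.contDiff_exp.contDiffAt (by rw [e]; exact contDiffAt_logNormSq hw) (h / w)
  rw [logNormSq_comp_exp, levi_clm, fderiv_exp_real, e, mul_div_cancel₀ _ hw] at h1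
  exact h1.symm

theorem fderiv_logNormSq {w : ℂ} (hw : w ≠ 0) (h : ℂ) :
    fderiv ℝ logNormSq w h = 2 * (h / w).re := by
  have e := Complex.exp_log hw
  have h0 : HasFDerivAt logNormSq (fderiv ℝ logNormSq w) (Complex.exp (Complex.log w)) := by
    rw [e]; exact ((contDiffAt_logNormSq hw).differentiableAt (by norm_num)).hasFDerivAt
  have h1 := h0.comp (Complex.log w)
    (((Complex.hasDerivAt_exp (Complex.log w)).differentiableAt).restrictScalars ℝ).hasFDerivAt
  rw [logNormSq_comp_exp] at h1
  have h2 := congrArg (fun L : ℂ →L[ℝ] ℝ => L (h / w)) (h1.unique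
    (2 • Complex.reCLM : ℂ →L[ℝ] ℝ).hasFDerivAt)
  simp only [ContinuousLinearMap.comp_apply, fderiv_exp_real, e, mul_div_cancel₀ _ hw] at h2
  rw [h2]; simp

end Levi

end

end PoincareType

open scoped ContDiff Manifold Topology
open Bundle MeasureTheory

namespace PoincareType

noncomputable section

/-! ### Comparison of the potentials with the Poincaré metric. -/

section LeviBounds

open Set Filter

variable {m : ℕ}

theorem exists_levi_bound {E : Type*} [NormedAddCommGroup E] [NormedSpace ℂ E]
    [NormedSpace ℝ E] [IsScalarTower ℝ ℂ E] {f : E → ℝ} {U K : Set E} (hU : IsOpen U) (hK : IsCompact K)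
    (hKU : K ⊆ U) (hf : ContDiffOn ℝ ∞ f U) : ∃ C : ℝ, 0 ≤ C ∧ ∀ z ∈ K, |f z| ≤ C ∧
      (∀ V, |fderiv ℝ f z V| ≤ C * ‖V‖) ∧ ∀ V, |levi f z V| ≤ C * ‖V‖ ^ 2 := by
  have h1 : ContDiffOn ℝ ∞ (fderiv ℝ f) U := hf.fderiv_of_isOpen hU (by simp)
  have h2 : ContDiffOn ℝ ∞ (fderiv ℝ (fderiv ℝ f)) U := h1.fderiv_of_isOpen hU (by simp)
  obtain ⟨C0, hC0⟩ := hK.exists_bound_of_continuousOn (hf.continuousOn.mono hKU).norm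
  obtain ⟨C1, hC1⟩ := hK.exists_bound_of_continuousOn (h1.continuousOn.mono hKU).norm
  have h3 : ContinuousOn (fun z => ‖fderiv ℝ (fderiv ℝ f) z‖) K :=
    (continuous_norm (E := E →L[ℝ] E →L[ℝ] ℝ)).comp_continuousOn (h2.continuousOn.mono hKU)
  obtain ⟨C2, hC2⟩ := hK.exists_bound_of_continuousOn h3
  set C := max (max |C0| |C1|) |C2| with hC
  have e0 : C0 ≤ C := (le_abs_self _).trans ((le_max_left _ _).trans (le_max_left _ _))
  have e1 : C1 ≤ C := (le_abs_self _).trans ((le_max_right _ _).trans (le_max_left _ _))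
  have e2 : C2 ≤ C := (le_abs_self _).trans (le_max_right _ _)
  have hCn : 0 ≤ C := (abs_nonneg _).trans (le_max_right _ _)
  refine ⟨C, hCn, fun z hz => ⟨(norm_norm (f z) ▸ hC0 z hz).trans e0, fun V => ?_, fun V => ?_⟩⟩
  · rw [← Real.norm_eq_abs]
    exact (fderiv ℝ f z).le_of_opNorm_le ((norm_norm (fderiv ℝ f z) ▸ hC1 z hz).trans e1) V
  · have hb : ∀ W : E, |fderiv ℝ (fderiv ℝ f) z W W| ≤ C * ‖W‖ ^ 2 := by
      intro W
      rw [← Real.norm_eq_abs, sq, ← mul_assoc]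
      refine (ContinuousLinearMap.le_opNorm₂ _ _ _).trans ?_
      gcongr
      exact (norm_norm (fderiv ℝ (fderiv ℝ f) z) ▸ hC2 z hz).trans e2
    have hI : ‖Complex.I • V‖ = ‖V‖ := by rw [norm_smul, Complex.norm_I, one_mul]
    have h3 := abs_le.1 (hb V)
    have h4 := abs_le.1 (hb (Complex.I • V))
    rw [hI] at h4
    rw [levi, abs_le]
    constructor <;> linarith [h3.1, h3.2, h4.1, h4.2]

/-- The squared length `|V_i|² / (|z_i|² log²|z_i|)` of the `i`-th component of a vector for the
Poincaré metric of the punctured disc. -/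
def cuspSq (i : Fin m) (z V : Cn m) : ℝ := ‖V i‖ ^ 2 / (‖z i‖ ^ 2 * Real.log ‖z i‖ ^ 2)

theorem cuspSq_nonneg (i : Fin m) (z V : Cn m) : 0 ≤ cuspSq i z V := by
  unfold cuspSq; positivity

set_option maxHeartbeats 800000 in
/-- The Levi form of `log (λ - log |z_i|² - η)` is, up to bounded terms, comparable to minus the
Poincaré metric of the punctured disc. -/
theorem exists_levi_log_bound (i : Fin m) {η : Cn m → ℝ} {U K : Set (Cn m)} (hU : IsOpen U)
    (hK : IsCompact K) (hKU : K ⊆ U) (hη : ContDiffOn ℝ ∞ η U) {lam : ℝ} (hlam : 0 ≤ lam)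
    (hsmall : ∀ z ∈ K, ‖z i‖ ≤ Real.exp (-1))
    (hρ : ∀ z ∈ K, z i ≠ 0 → logNormSq (z i) + η z ≤ -1) :
    ∃ c C : ℝ, 0 < c ∧ 0 ≤ C ∧ ∀ z ∈ K, z i ≠ 0 → ∀ V : Cn m,
      -(C * (cuspSq i z V + ‖V‖ ^ 2)) ≤
        levi (fun y : Cn m => Real.log (lam - (logNormSq (y i) + η y))) z V ∧
      levi (fun y : Cn m => Real.log (lam - (logNormSq (y i) + η y))) z V ≤
        -(c * cuspSq i z V) + C * ‖V‖ ^ 2 := by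
  obtain ⟨C, hC, hbd⟩ := exists_levi_bound hU hK hKU hη
  -- With `ℓ = -log |z_i| ≥ 1`, the argument `τ` of the logarithm satisfies `2ℓ / (C + 1) ≤ τ ≤ (λ +
  -- 2 + C) ℓ`. The upper bound gives `c`, the lower one gives `(C + 1)²`; the terms `C` and `2 C²`
  -- come from the second and first derivatives of `η`.
  refine ⟨1 / (lam + 2 + C) ^ 2, (C + 1) ^ 2 + C + 2 * C ^ 2, by positivity, by positivity,
    fun z hz hzi V => ?_⟩
  obtain ⟨hb0, hb1, hb2⟩ := hbd z hz
  have hηz : ContDiffAt ℝ 2 η z :=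
    contDiffAt_infty.1 (hη.contDiffAt (hU.mem_nhds (hKU hz))) 2
  let pr : Cn m →L[ℂ] ℂ := ContinuousLinearMap.proj i
  have hprd : ∀ V, fderiv ℝ (fun y : Cn m => y i) z V = V i := by
    intro V
    change fderiv ℝ (pr.restrictScalars ℝ) z V = V i
    rw [ContinuousLinearMap.fderiv]
    rfl
  have hlc : ContDiffAt ℝ 2 (fun y : Cn m => logNormSq (y i)) z := by
    change ContDiffAt ℝ 2 (logNormSq ∘ fun y : Cn m => y i) z
    exact ContDiffAt.comp z (contDiffAt_logNormSq hzi)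
      ((pr.restrictScalars ℝ).contDiff.contDiffAt)
  have hll : ∀ V, levi (fun y : Cn m => logNormSq (y i)) z V = 0 := by
    intro V
    rw [show (fun y : Cn m => logNormSq (y i)) = logNormSq ∘ (fun y : Cn m => y i) from rfl,
      levi_comp (G := fun y : Cn m => y i) pr.contDiff.contDiffAt (contDiffAt_logNormSq hzi),
      levi_logNormSq hzi]
  have hld : ∀ V, fderiv ℝ (fun y : Cn m => logNormSq (y i)) z V = 2 * (V i / z i).re := by
    intro V
    have h1 : HasFDerivAt (logNormSq ∘ fun y : Cn m => y i) _ z :=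
      HasFDerivAt.comp z ((contDiffAt_logNormSq hzi).differentiableAt (by norm_num)).hasFDerivAt
        ((pr.restrictScalars ℝ).hasFDerivAt (x := z))
    rw [show (fun y : Cn m => logNormSq (y i)) = logNormSq ∘ (fun y : Cn m => y i) from rfl,
      h1.fderiv]
    exact fderiv_logNormSq hzi _
  set τ : Cn m → ℝ := fun y => lam - (logNormSq (y i) + η y) with hτ
  have hτc : ContDiffAt ℝ 2 τ z := contDiffAt_const.sub (hlc.add hηz)
  have hτ1 : 1 ≤ τ z := by have := hρ z hz hzi; simp only [hτ]; linarith
  -- The singular part of `τ` is pluriharmonic, so only the smooth function `η` contributes.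
  have hτl : levi τ z V = - levi η z V := by
    have e : τ = fun y => (fun y => lam - logNormSq (y i)) y - η y := by ext y; simp only [hτ]; ring
    rw [e, levi_sub (contDiffAt_const.sub hlc) hηz, levi_sub contDiffAt_const hlc, levi_const,
      hll]
    ring
  have hτd : ∀ V, fderiv ℝ τ z V = -(2 * (V i / z i).re) - fderiv ℝ η z V := by
    intro V
    have h1 := ((hlc.differentiableAt (by norm_num)).hasFDerivAt.add
      (hηz.differentiableAt (by norm_num)).hasFDerivAt).const_sub lam
    have h2 : fderiv ℝ τ z = _ := h1.fderiv
    rw [h2, neg_apply, add_apply, hld]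
    ring
  rw [levi_log hτc (by linarith), hτl, hτd, hτd]
  set w : ℂ := V i / z i with hw
  have hwI : (Complex.I • V) i / z i = Complex.I * w := by
    rw [Pi.smul_apply, smul_eq_mul, hw, mul_div_assoc]
  rw [hwI, Complex.mul_re, Complex.I_re, Complex.I_im]
  set p := fderiv ℝ η z V
  set q := fderiv ℝ η z (Complex.I • V)
  set s := ‖V‖ with hs
  have hs0 : 0 ≤ s := norm_nonneg _
  have hp : p ^ 2 ≤ C ^ 2 * s ^ 2 := by
    rw [← mul_pow, ← sq_abs p]; gcongr; exact hb1 V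
  have hq : q ^ 2 ≤ C ^ 2 * s ^ 2 := by
    rw [← mul_pow, ← sq_abs q]; gcongr
    refine (hb1 _).trans_eq ?_
    rw [norm_smul, Complex.norm_I, one_mul]
  have hL := abs_le.1 (hb2 V)
  set Λ := levi η z V
  set T := τ z with hT
  set ℓ := -Real.log ‖z i‖ with hℓ
  have hzn : 0 < ‖z i‖ := norm_pos_iff.2 hzi
  have hℓ1 : 1 ≤ ℓ := by
    have := Real.log_le_log hzn (hsmall z hz)
    rw [Real.log_exp] at this; linarith
  have hTe : T = lam + 2 * ℓ - η z := by
    simp only [hT, hτ, logNormSq, Real.log_pow, hℓ]; push_cast; ring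
  have hη1 := abs_le.1 hb0
  have hTu : T ≤ (lam + 2 + C) * ℓ := by rw [hTe]; nlinarith [hη1.1]
  have hTl : 2 * ℓ ≤ (C + 1) * T := by nlinarith [hη1.2]
  have hww : w.re ^ 2 + w.im ^ 2 = ‖w‖ ^ 2 := by
    rw [Complex.sq_norm, Complex.normSq_apply]; ring
  have ha : cuspSq i z V = ‖w‖ ^ 2 / ℓ ^ 2 := by
    rw [cuspSq, hw, norm_div, hℓ, neg_sq, div_pow, div_div]
  rw [ha]
  have hT0 : 0 < T := by linarith
  have hℓ0 : 0 < ℓ := by linarith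
  have hB0 : 0 < lam + 2 + C := by linarith
  -- comparison of `|w|²/T²` with `|w|²/ℓ²`
  have h1 : 1 / (lam + 2 + C) ^ 2 * (‖w‖ ^ 2 / ℓ ^ 2) ≤ ‖w‖ ^ 2 / T ^ 2 := by
    rw [div_mul_div_comm, one_mul, ← mul_pow]
    gcongr
  have h2 : ‖w‖ ^ 2 / T ^ 2 ≤ (C + 1) ^ 2 / 4 * (‖w‖ ^ 2 / ℓ ^ 2) := by
    rw [div_mul_div_comm, div_le_div_iff₀ (by positivity) (by positivity)]
    have : 4 * ℓ ^ 2 ≤ (C + 1) ^ 2 * T ^ 2 := by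
      rw [← mul_pow, show 4 * ℓ ^ 2 = (2 * ℓ) ^ 2 by ring]; gcongr
    calc ‖w‖ ^ 2 * (4 * ℓ ^ 2) ≤ ‖w‖ ^ 2 * ((C + 1) ^ 2 * T ^ 2) := by gcongr
      _ = _ := by ring
  have hsq : ∀ x : ℝ, 0 ≤ x → x / T ^ 2 ≤ x := fun x hx =>
    div_le_self hx (one_le_pow₀ hτ1)
  have hTinv : |Λ / T| ≤ C * s ^ 2 := by
    rw [abs_div, abs_of_pos hT0]
    exact (div_le_self (abs_nonneg _) hτ1).trans (hb2 V)
  have hTinv' := abs_le.1 hTinv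
  have hupS : (-(2 * w.re) - p) ^ 2 + (-(2 * (0 * w.re - 1 * w.im)) - q) ^ 2 ≤
      8 * ‖w‖ ^ 2 + 4 * (C ^ 2 * s ^ 2) := by
    rw [← hww]
    nlinarith [sq_nonneg (2 * w.re - p), sq_nonneg (2 * w.im + q)]
  have hloS : 2 * ‖w‖ ^ 2 - 2 * (C ^ 2 * s ^ 2) ≤
      (-(2 * w.re) - p) ^ 2 + (-(2 * (0 * w.re - 1 * w.im)) - q) ^ 2 := by
    rw [← hww]
    nlinarith [sq_nonneg (w.re + p), sq_nonneg (w.im - q)]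
  have hCs : C ^ 2 * s ^ 2 / T ^ 2 ≤ C ^ 2 * s ^ 2 := hsq _ (by positivity)
  have hup : ((-(2 * w.re) - p) ^ 2 + (-(2 * (0 * w.re - 1 * w.im)) - q) ^ 2) / (2 * T ^ 2) ≤
      4 * (‖w‖ ^ 2 / T ^ 2) + 2 * (C ^ 2 * s ^ 2) := by
    calc _ ≤ (8 * ‖w‖ ^ 2 + 4 * (C ^ 2 * s ^ 2)) / (2 * T ^ 2) := by gcongr
      _ = 4 * (‖w‖ ^ 2 / T ^ 2) + 2 * (C ^ 2 * s ^ 2 / T ^ 2) := by field_simp; ring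
      _ ≤ _ := by gcongr
  have hlo : ‖w‖ ^ 2 / T ^ 2 - C ^ 2 * s ^ 2 ≤
      ((-(2 * w.re) - p) ^ 2 + (-(2 * (0 * w.re - 1 * w.im)) - q) ^ 2) / (2 * T ^ 2) := by
    calc _ ≤ ‖w‖ ^ 2 / T ^ 2 - C ^ 2 * s ^ 2 / T ^ 2 := by gcongr
      _ = (2 * ‖w‖ ^ 2 - 2 * (C ^ 2 * s ^ 2)) / (2 * T ^ 2) := by field_simp
      _ ≤ _ := by gcongr
  have hneg : -Λ / T = -(Λ / T) := neg_div _ _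
  rw [hneg]
  have ha0 : 0 ≤ ‖w‖ ^ 2 / ℓ ^ 2 := by positivity
  have hCs0 : 0 ≤ C * s ^ 2 := by positivity
  have hCs1 : 0 ≤ C ^ 2 * s ^ 2 := by positivity
  constructor
  · have e1 : 0 ≤ (C + 2 * C ^ 2) * (‖w‖ ^ 2 / ℓ ^ 2) := by positivity
    have e2 : 0 ≤ (C + 1) ^ 2 * s ^ 2 := by positivity
    have e3 : ((C + 1) ^ 2 + C + 2 * C ^ 2) * (‖w‖ ^ 2 / ℓ ^ 2 + s ^ 2) =
      (C + 1) ^ 2 * (‖w‖ ^ 2 / ℓ ^ 2) + (C + 2 * C ^ 2) * (‖w‖ ^ 2 / ℓ ^ 2) +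
        (C + 1) ^ 2 * s ^ 2 + C * s ^ 2 + 2 * (C ^ 2 * s ^ 2) := by ring
    linarith [hTinv'.2]
  · have e2 : 0 ≤ (C + 1) ^ 2 * s ^ 2 := by positivity
    have e3 : ((C + 1) ^ 2 + C + 2 * C ^ 2) * s ^ 2 =
      (C + 1) ^ 2 * s ^ 2 + C * s ^ 2 + 2 * (C ^ 2 * s ^ 2) := by ring
    linarith [hTinv'.1]

/-- Comparison of `q - ∑ A_j L_j` with `s + ∑ a_j`, from two-sided bounds of `q` and `L_j`. -/
theorem exists_comparison {ι S : Type*} [Fintype ι] {q s : S → ℝ} {L a : ι → S → ℝ} {A : ι → ℝ}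
    (hA : ∀ j, 0 < A j) (hs : ∀ x, 0 ≤ s x) (ha : ∀ j x, 0 ≤ a j x)
    (hq : ∃ c C : ℝ, 0 < c ∧ ∀ x, c * s x ≤ q x ∧ q x ≤ C * s x)
    (hL : ∀ j, ∃ c C : ℝ, 0 < c ∧ 0 ≤ C ∧ ∀ x, -(C * (a j x + s x)) ≤ L j x ∧
      L j x ≤ -(c * a j x) + C * s x)
    {ε : ℝ} (hε : 0 < ε) (hpos : ∀ x, ε * q x ≤ q x - ∑ j, A j * L j x) :
    ∃ c C : ℝ, 0 < c ∧ 0 < C ∧ ∀ x, c * (s x + ∑ j, a j x) ≤ q x - ∑ j, A j * L j x ∧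
      q x - ∑ j, A j * L j x ≤ C * (s x + ∑ j, a j x) := by
  obtain ⟨c0, C0, hc0, hq⟩ := hq
  choose c C hc hC hL using hL
  set B := ∑ j, A j * C j with hB
  have hB0 : 0 ≤ B := Finset.sum_nonneg fun j _ => mul_nonneg (hA j).le (hC j)
  have hBj : ∀ j, A j * C j ≤ B := fun j =>
    Finset.single_le_sum (f := fun j => A j * C j) (fun j _ => mul_nonneg (hA j).le (hC j))
      (Finset.mem_univ j)
  -- A single lower bound for the finitely many products `A j * c j`; the maximum with 1 keeps it
  -- positive when there is no index.
  obtain ⟨κ, hκ, hκj⟩ : ∃ κ : ℝ, 0 < κ ∧ ∀ j, κ ≤ A j * c j := by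
    obtain ⟨κ, hκ⟩ := Finite.exists_le (fun j => (A j * c j)⁻¹)
    refine ⟨(max κ 1)⁻¹, by positivity, fun j => ?_⟩
    rw [inv_le_comm₀ (by positivity) (mul_pos (hA j) (hc j))]
    exact (hκ j).trans (le_max_left _ _)
  have hD : 0 < 1 + (B + κ) / (ε * c0) := by positivity
  refine ⟨κ / (1 + (B + κ) / (ε * c0)), |C0| + B + 1, by positivity, by positivity,
    fun x => ?_⟩
  have hsum0 : 0 ≤ ∑ j, a j x := Finset.sum_nonneg fun j _ => ha j x
  constructor
  · set G := q x - ∑ j, A j * L j x with hG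
    -- Two lower bounds are combined. Positivity gives `G ≥ ε c0 s`, and the estimates of the `L j`
    -- give `G ≥ κ ∑ a_j - B s`. Adding `(B + κ) / (ε c0)` times the first to the second yields `κ
    -- (s + ∑ a_j)`, however large `B` is.
    have h1 : ε * c0 * s x ≤ G := by
      refine le_trans ?_ (hpos x)
      rw [mul_assoc]; gcongr; exact (hq x).1
    have h2 : κ * ∑ j, a j x - B * s x ≤ G := by
      have h3 : ∑ j, A j * L j x ≤ B * s x - κ * ∑ j, a j x := by
        rw [hB, Finset.sum_mul, Finset.mul_sum, ← Finset.sum_sub_distrib]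
        refine Finset.sum_le_sum fun j _ => ?_
        calc A j * L j x ≤ A j * (-(c j * a j x) + C j * s x) :=
              mul_le_mul_of_nonneg_left (hL j x).2 (hA j).le
          _ = A j * C j * s x - A j * c j * a j x := by ring
          _ ≤ A j * C j * s x - κ * a j x := by
              have := mul_le_mul_of_nonneg_right (hκj j) (ha j x)
              linarith
      have h4 : 0 ≤ q x := (mul_nonneg hc0.le (hs x)).trans (hq x).1
      rw [hG]; linarith
    rw [div_mul_eq_mul_div, div_le_iff₀ hD]
    have h5 : (B + κ) * s x ≤ G * ((B + κ) / (ε * c0)) := by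
      rw [mul_div_assoc', le_div_iff₀ (by positivity)]
      calc (B + κ) * s x * (ε * c0) = (ε * c0 * s x) * (B + κ) := by ring
        _ ≤ _ := by gcongr
    linarith
  · have h1 : -∑ j, A j * L j x ≤ B * (s x + ∑ j, a j x) := by
      rw [← Finset.sum_neg_distrib, hB, Finset.sum_mul]
      refine Finset.sum_le_sum fun j _ => ?_
      have h2 : a j x ≤ ∑ j, a j x :=
        Finset.single_le_sum (f := fun j => a j x) (fun j _ => ha j x) (Finset.mem_univ j)
      calc -(A j * L j x) = A j * -L j x := by ring
        _ ≤ A j * (C j * (a j x + s x)) :=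
            mul_le_mul_of_nonneg_left (by linarith [(hL j x).1]) (hA j).le
        _ = A j * C j * (a j x + s x) := by ring
        _ ≤ A j * C j * (s x + ∑ j, a j x) :=
            mul_le_mul_of_nonneg_left (by linarith) (mul_nonneg (hA j).le (hC j))
    have h3 : q x ≤ |C0| * s x := (hq x).2.trans
      (mul_le_mul_of_nonneg_right (le_abs_self _) (hs x))
    have h4 : 0 ≤ |C0| * ∑ j, a j x := by positivity
    have := hs x
    nlinarith

end LeviBounds

end

end PoincareType

open scoped ContDiff Manifold Topology
open Bundle MeasureTheory

namespace PoincareType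

noncomputable section

/-! ### Holomorphic charts adapted to the divisor. -/

section AdaptedChart

open Set Filter

variable {m : ℕ}

/-- Linearly independent functionals on `ℂᵐ` are components of a linear isomorphism. -/
theorem exists_continuousLinearEquiv_apply_eq {κ : Type*} [Finite κ] (ℓ : κ → Cn m →L[ℂ] ℂ)
    (hℓ : LinearIndependent ℂ ℓ) :
    ∃ (ι : κ → Fin m) (A : Cn m ≃L[ℂ] Cn m), Function.Injective ι ∧
      ∀ v j, A v (ι j) = ℓ j v := by
  classical
  set ℓ' : κ → Module.Dual ℂ (Cn m) := fun j => (ℓ j : Cn m →ₗ[ℂ] ℂ) with hℓ'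
  have hli : LinearIndependent ℂ ℓ' :=
    hℓ.map' (LinearMap.toContinuousLinearMap (𝕜 := ℂ) (E := Cn m) (F' := ℂ)).symm.toLinearMap
      (LinearEquiv.ker _)
  -- The functionals are completed to a basis of the dual space. The members of this basis are the
  -- components of a map whose kernel is annihilated by every functional, hence trivial.
  set b := Module.Basis.sumExtend hli with hb
  have : Finite (κ ⊕ (Module.Basis.sumExtendIndex hli)) := Module.Finite.finite_basis b
  have := Fintype.ofFinite (κ ⊕ (Module.Basis.sumExtendIndex hli))
  have hcard : Fintype.card (κ ⊕ (Module.Basis.sumExtendIndex hli)) = Fintype.card (Fin m) := by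
    rw [← Module.finrank_eq_card_basis b, Subspace.dual_finrank_eq]
    simp
  set e := Fintype.equivOfCardEq hcard
  let A₀ : Cn m →ₗ[ℂ] Cn m := LinearMap.pi fun i => b (e.symm i)
  have hinj : Function.Injective A₀ := by
    rw [injective_iff_map_eq_zero]
    intro v hv
    have h0 : ∀ k, b k v = 0 := fun k => by
      have := congrFun hv (e k)
      simpa [A₀] using this
    have h1 : ∀ f : Module.Dual ℂ (Cn m), f v = 0 := by
      intro f
      have h2 : Module.Dual.eval ℂ (Cn m) v = 0 := b.ext fun k => by simpa using h0 k
      have := LinearMap.congr_fun h2 f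
      simpa using this
    funext i
    exact h1 (LinearMap.proj i)
  refine ⟨fun j => e (Sum.inl j), (LinearEquiv.ofInjectiveEndo A₀ hinj).toContinuousLinearEquiv,
    fun i j hij => by simpa using hij, fun v j => ?_⟩
  have hbj : b (Sum.inl j) = ℓ' j := by
    simp only [hb, Module.Basis.sumExtend, Module.Basis.reindex_apply, Module.Basis.extend_apply_self]
    rfl
  change A₀ v (e (Sum.inl j)) = ℓ j v
  simp [A₀, hbj, hℓ']

variable {X : Type*} [TopologicalSpace X] [ChartedSpace (Cn m) X]
  [IsManifold 𝓘(ℂ, Cn m) ω X]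

/-- A holomorphic map with invertible differential is a chart near the given point. -/
theorem exists_mem_maximalAtlas_eq_comp (p : X) {W : Set X} (hW : W ∈ 𝓝 p) (F : Cn m → Cn m)
    (hF : ContDiffAt ℂ ω F (chartAt (Cn m) p p)) (A : Cn m ≃L[ℂ] Cn m)
    (hA : HasFDerivAt F (A : Cn m →L[ℂ] Cn m) (chartAt (Cn m) p p)) :
    ∃ Z : OpenPartialHomeomorph X (Cn m), p ∈ Z.source ∧ Z.source ⊆ W ∧
      Z ∈ IsManifold.maximalAtlas 𝓘(ℂ, Cn m) ω X ∧
      Z.source ⊆ (chartAt (Cn m) p).source ∧ ∀ x ∈ Z.source, Z x = F (chartAt (Cn m) p x) := by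
  set c := chartAt (Cn m) p with hc
  have hω : (ω : WithTop ℕ∞) ≠ 0 := by simp
  have hU1 : ∀ᶠ y in 𝓝 (c p), ContDiffAt ℂ ω F y := hF.eventually (by simp)
  have hcont : ContinuousAt (fderiv ℂ F) (c p) := hF.continuousAt_fderiv hω
  have hU2 : ∀ᶠ y in 𝓝 (c p), fderiv ℂ F y ∈ range ((↑) : (Cn m ≃L[ℂ] Cn m) → Cn m →L[ℂ] Cn m) :=
    hcont.eventually (ContinuousLinearEquiv.isOpen.mem_nhds (by rw [hA.fderiv]; exact ⟨A, rfl⟩))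
  -- Invertibility at the single point would give regularity of the inverse only there. Invertible
  -- operators form an open set, so on `U` the map is analytic with invertible differential
  -- everywhere, which puts the restricted homeomorphism in the maximal atlas.
  obtain ⟨U, hU, hUo, hpU⟩ := mem_nhds_iff.1 (hU1.and hU2)
  set f := hF.toOpenPartialHomeomorph F hA hω with hf
  have hfF : (f : Cn m → Cn m) = F := rfl
  set f' := f.restrOpen U hUo with hf'
  have hf's : f'.source = f.source ∩ U := f.restrOpen_source U hUo
  have hf'F : (f' : Cn m → Cn m) = F := rfl
  have hcs : IsOpen (c.source) := c.open_source
  set Z := (c ≫ₕ f').restr (interior W) with hZ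
  have hZs : Z.source = (c.source ∩ c ⁻¹' (f.source ∩ U)) ∩ interior W := by
    rw [hZ, OpenPartialHomeomorph.restr_source, OpenPartialHomeomorph.trans_source, hf's,
      interior_interior]
  have hZF : ∀ x, Z x = F (c x) := fun x => rfl
  have hf1 : ContDiffOn ℂ ω f' f'.source := fun y hy => by
    rw [hf's] at hy
    exact (hU hy.2).1.contDiffWithinAt
  have hf2 : ContDiffOn ℂ ω f'.symm f'.target := fun y hy => by
    have hy' : f'.symm y ∈ f.source ∩ U := by rw [← hf's]; exact f'.map_target hy
    obtain ⟨h1, B, hB⟩ := hU hy'.2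
    refine (f'.contDiffAt_symm hy (f₀' := B) ?_ ?_).contDiffWithinAt
    · rw [hf'F, hB]; exact (h1.differentiableAt hω).hasFDerivAt
    · rw [hf'F]; exact h1
  have hcm : c ∈ IsManifold.maximalAtlas 𝓘(ℂ, Cn m) ω X := IsManifold.chart_mem_maximalAtlas p
  have hmem : c ≫ₕ f' ∈ IsManifold.maximalAtlas 𝓘(ℂ, Cn m) ω X := by
    refine OpenPartialHomeomorph.mem_maximalAtlas_of_contMDiffOn (I := 𝓘(ℂ, Cn m)) (n := ω) _ ?_ ?_
    · rw [OpenPartialHomeomorph.coe_trans, OpenPartialHomeomorph.trans_source]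
      exact (contMDiffOn_iff_contDiffOn.2 hf1).comp ((contMDiffOn_of_mem_maximalAtlas hcm).mono inter_subset_left)
        inter_subset_right
    · rw [OpenPartialHomeomorph.coe_trans_symm, OpenPartialHomeomorph.trans_target]
      exact (contMDiffOn_symm_of_mem_maximalAtlas hcm).comp
        ((contMDiffOn_iff_contDiffOn.2 hf2).mono inter_subset_left) inter_subset_right
  refine ⟨Z, ?_, ?_, ?_, ?_, fun x _ => hZF x⟩
  · rw [hZs]
    exact ⟨⟨mem_chart_source _ p, hF.mem_toOpenPartialHomeomorph_source hA hω, hpU⟩,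
      mem_interior_iff_mem_nhds.2 hW⟩
  · rw [hZs]; exact inter_subset_right.trans interior_subset
  · exact restr_mem_maximalAtlas _ hmem isOpen_interior
  · rw [hZs]; exact fun x hx => hx.1.1

section Sections

variable {K : X → Type*} [∀ x, AddCommGroup (K x)] [∀ x, Module ℂ (K x)]
  [∀ x, TopologicalSpace (K x)] [TopologicalSpace (TotalSpace ℂ K)] [FiberBundle ℂ K]
  [VectorBundle ℂ ℂ K]

/-- The function representing a section in the local trivialization around `p`. -/
def localRep (s : Cₛ^ω⟮𝓘(ℂ, Cn m); ℂ, K⟯) (p x : X) : ℂ := (trivializationAt ℂ K p ⟨x, s x⟩).2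

theorem localRep_eq_zero_iff (s : Cₛ^ω⟮𝓘(ℂ, Cn m); ℂ, K⟯) {p x : X}
    (hx : x ∈ (trivializationAt ℂ K p).baseSet) : localRep s p x = 0 ↔ s x = 0 :=
  ((trivializationAt ℂ K p).continuousLinearEquivAt ℂ x hx).map_eq_zero_iff (x := s x)

theorem contMDiffOn_localRep [ContMDiffVectorBundle ω ℂ K 𝓘(ℂ, Cn m)]
    (s : Cₛ^ω⟮𝓘(ℂ, Cn m); ℂ, K⟯) (p : X) :
    ContMDiffOn 𝓘(ℂ, Cn m) 𝓘(ℂ, ℂ) ω (localRep s p) (trivializationAt ℂ K p).baseSet :=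
  (Bundle.Trivialization.contMDiffOn_section_baseSet_iff (trivializationAt ℂ K p)).1
    s.contMDiff.contMDiffOn

/-- The squared norm of the local frame around `p`. -/
def HermitianMetric.frameNormSq (h : HermitianMetric m K) (p x : X) : ℝ :=
  h.normSq x ((trivializationAt ℂ K p).symm x 1)

theorem HermitianMetric.frameNormSq_pos (h : HermitianMetric m K) {p x : X}
    (hx : x ∈ (trivializationAt ℂ K p).baseSet) : 0 < h.frameNormSq p x := by
  refine h.normSq_pos x _ fun h0 => ?_
  have h1 := ((trivializationAt ℂ K p).continuousLinearEquivAt ℂ x hx).symm.map_eq_zero_iff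
    (x := (1 : ℂ))
  exact one_ne_zero (h1.1 h0)

theorem HermitianMetric.normSq_section (h : HermitianMetric m K)
    (s : Cₛ^ω⟮𝓘(ℂ, Cn m); ℂ, K⟯) {p x : X} (hx : x ∈ (trivializationAt ℂ K p).baseSet) :
    h.normSq x (s x) = ‖localRep s p x‖ ^ 2 * h.frameNormSq p x := by
  rw [HermitianMetric.frameNormSq, ← h.normSq_smul]
  congr 1
  have e := ((trivializationAt ℂ K p).continuousLinearEquivAt ℂ x hx)
  have h1 : ((trivializationAt ℂ K p).continuousLinearEquivAt ℂ x hx).symm (localRep s p x) =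
      localRep s p x • ((trivializationAt ℂ K p).continuousLinearEquivAt ℂ x hx).symm 1 := by
    rw [← map_smul, smul_eq_mul, mul_one]
  have h2 : ((trivializationAt ℂ K p).continuousLinearEquivAt ℂ x hx).symm (localRep s p x) = s x :=
    ((trivializationAt ℂ K p).continuousLinearEquivAt ℂ x hx).symm_apply_apply (s x)
  exact h2.symm.trans h1

/-- The local differential of a section is the derivative of its local representation. -/
theorem hasFDerivAt_localRep [ContMDiffVectorBundle ω ℂ K 𝓘(ℂ, Cn m)]
    (s : Cₛ^ω⟮𝓘(ℂ, Cn m); ℂ, K⟯) (p : X) :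
    ContDiffAt ℂ ω (localRep s p ∘ (chartAt (Cn m) p).symm) (chartAt (Cn m) p p) ∧
    HasFDerivAt (localRep s p ∘ (chartAt (Cn m) p).symm)
      (localDifferential s p : Cn m →L[ℂ] ℂ) (chartAt (Cn m) p p) := by
  have h1 : ContMDiffAt 𝓘(ℂ, Cn m) 𝓘(ℂ, ℂ) ω (localRep s p) p :=
    (contMDiffOn_localRep s p).contMDiffAt ((trivializationAt ℂ K p).open_baseSet.mem_nhds
      (FiberBundle.mem_baseSet_trivializationAt' p))
  constructor
  · have h2 := contMDiffAt_iff.1 h1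
    simpa [contDiffWithinAt_univ, chartAt_self_eq] using h2.2
  · have h2 := (h1.mdifferentiableAt (by simp)).hasMFDerivAt.2
    simp only [writtenInExtChartAt, extChartAt, mfld_simps,
      chartAt_self_eq] at h2
    exact hasFDerivWithinAt_univ.1 h2

end Sections

variable {N : ℕ} {L : Fin N → X → Type*} [∀ j x, AddCommGroup (L j x)] [∀ j x, Module ℂ (L j x)]
  [∀ j x, TopologicalSpace (L j x)] [∀ j, TopologicalSpace (TotalSpace ℂ (L j))]
  [∀ j, FiberBundle ℂ (L j)] [∀ j, VectorBundle ℂ ℂ (L j)]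

/-- A holomorphic chart `Z` centred at `p`, some of whose coordinates represent the sections
vanishing at `p`. -/
structure IsAdapted (σ : ∀ j, Cₛ^ω⟮𝓘(ℂ, Cn m); ℂ, L j⟯) (p : X)
    (Z : OpenPartialHomeomorph X (Cn m)) (ι : {j // σ j p = 0} → Fin m) : Prop where
  mem_source : p ∈ Z.source
  apply_self : Z p = 0
  mem_maximalAtlas : Z ∈ IsManifold.maximalAtlas 𝓘(ℂ, Cn m) ω X
  injective : Function.Injective ι
  subset_baseSet : ∀ j, Z.source ⊆ (trivializationAt ℂ (L j) p).baseSet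
  apply_eq : ∀ j, ∀ x ∈ Z.source, Z x (ι j) = localRep (σ j) p x
  ne_zero : ∀ j, σ j p ≠ 0 → ∀ x ∈ Z.source, σ j x ≠ 0

/-- Normal crossings say that the differentials of the sections vanishing at `p` are independent;
completed to linear coordinates, they form an invertible differential, and the inverse function
theorem turns the sections themselves into coordinates. -/
theorem IsSNCDivisor.exists_isAdapted [∀ j, ContMDiffVectorBundle ω ℂ (L j) 𝓘(ℂ, Cn m)]
    {σ : ∀ j, Cₛ^ω⟮𝓘(ℂ, Cn m); ℂ, L j⟯} (hσ : IsSNCDivisor σ) (p : X) {W : Set X}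
    (hW : W ∈ 𝓝 p) : ∃ Z ι, IsAdapted σ p Z ι ∧ Z.source ⊆ W := by
  classical
  set c := chartAt (Cn m) p with hc
  obtain ⟨ι, A, hι, hA⟩ := exists_continuousLinearEquiv_apply_eq (m := m)
    (fun j : {j // σ j p = 0} => (localDifferential (σ j.1) p : Cn m →L[ℂ] ℂ)) (hσ.transversal p)
  -- The coordinates indexed by `ι` are the local representatives of the vanishing sections. The
  -- remaining ones are linear about `c p`, chosen so that `A` is the differential of `F` at `c p`.
  set F : Cn m → Cn m := fun y => Function.extend ι
    (fun j => localRep (σ j.1) p (c.symm y)) (fun i => A (y - c p) i) with hF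
  have hFι : ∀ y j, F y (ι j) = localRep (σ j.1) p (c.symm y) := fun y j =>
    hι.extend_apply _ _ _
  have hFn : ∀ y i, (¬ ∃ j, ι j = i) → F y i = A (y - c p) i := fun y i hi =>
    Function.extend_apply' _ _ _ hi
  have hcase : ∀ i, (∃ j, (fun y => F y i) = localRep (σ j.1) p ∘ c.symm ∧ ι j = i) ∨
      (fun y => F y i) = fun y => A (y - c p) i := by
    intro i
    by_cases hi : ∃ j, ι j = i
    · obtain ⟨j, rfl⟩ := hi
      exact Or.inl ⟨j, funext fun y => hFι y j, rfl⟩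
    · exact Or.inr (funext fun y => hFn y i hi)
  have hFc : ContDiffAt ℂ ω F (c p) := by
    refine contDiffAt_pi.2 fun i => ?_
    rcases hcase i with ⟨j, hj, -⟩ | hj
    · rw [hj]; exact (hasFDerivAt_localRep (σ j.1) p).1
    · rw [hj]
      exact contDiffAt_pi.1 (A.contDiff.contDiffAt.comp _ (contDiffAt_id.sub contDiffAt_const)) i
  have hFd : HasFDerivAt F (A : Cn m →L[ℂ] Cn m) (c p) := by
    refine hasFDerivAt_pi'.2 fun i => ?_
    rcases hcase i with ⟨j, hj, hji⟩ | hj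
    · rw [hj]
      have e : (ContinuousLinearMap.proj i).comp (A : Cn m →L[ℂ] Cn m) =
          (localDifferential (σ j.1) p : Cn m →L[ℂ] ℂ) := by
        ext1 v
        rw [← hji]
        exact hA v j
      rw [e]
      exact (hasFDerivAt_localRep (σ j.1) p).2
    · rw [hj]
      have h1 : HasFDerivAt (fun y => A (y - c p)) (A : Cn m →L[ℂ] Cn m) (c p) := by
        have h2 : HasFDerivAt (fun y => y - c p) (ContinuousLinearMap.id ℂ (Cn m)) (c p) :=
          (hasFDerivAt_id (𝕜 := ℂ) (c p)).sub_const (c p)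
        exact (A : Cn m →L[ℂ] Cn m).hasFDerivAt.comp (c p) h2
      exact hasFDerivAt_pi'.1 h1 i
  set W' : Set X := W ∩ ((⋂ j, (trivializationAt ℂ (L j) p).baseSet) ∩
    ⋂ j, {x | σ j p ≠ 0 → σ j x ≠ 0}) with hW'
  have hW'p : W' ∈ 𝓝 p := by
    refine inter_mem hW (inter_mem (iInter_mem.2 fun j =>
      (trivializationAt ℂ (L j) p).open_baseSet.mem_nhds
        (FiberBundle.mem_baseSet_trivializationAt' p)) (iInter_mem.2 fun j => ?_))
    by_cases hj : σ j p = 0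
    · simp [hj]
    · filter_upwards [(isOpen_ne_zero (σ j)).mem_nhds hj] with x hx _ using hx
  obtain ⟨Z, hpZ, hZW, hZm, hZc, hZF⟩ := exists_mem_maximalAtlas_eq_comp p hW'p F hFc A hFd
  refine ⟨Z, ι, ⟨hpZ, ?_, hZm, hι, fun j x hx => mem_iInter.1 (hZW hx).2.1 j, fun j x hx => ?_,
    fun j hj x hx => mem_iInter.1 (hZW hx).2.2 j hj⟩, fun x hx => (hZW hx).1⟩
  · rw [hZF p hpZ]
    funext i
    rcases hcase i with ⟨j, hj, -⟩ | hj
    · rw [← hc, congrFun hj (c p)]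
      simp only [Function.comp, hc, (chartAt (Cn m) p).left_inv (mem_chart_source _ p)]
      exact (localRep_eq_zero_iff (σ j.1) (FiberBundle.mem_baseSet_trivializationAt' p)).2 j.2
    · rw [← hc, congrFun hj (c p)]; simp
  · rw [hZF x hx, hFι, hc, (chartAt (Cn m) p).left_inv (hZc hx)]

end AdaptedChart

end

end PoincareType

open scoped ContDiff Manifold Topology
open Bundle MeasureTheory

namespace PoincareType

noncomputable section

/-! ### Tangent vectors and forms in holomorphic charts. -/

section HolomorphicCharts

open Set Filter

/-- The tangent space at a point is identified with the model space by the preferred chart there, so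
the differential of `φ⁻¹` is the ordinary derivative of the transition to that chart. -/
theorem dChartSymm_eq_fderiv {E : Type*} [NormedAddCommGroup E] [NormedSpace ℝ E]
    {M : Type*} [TopologicalSpace M] [ChartedSpace E M] [IsManifold 𝓘(ℝ, E) ∞ M]
    {φ : OpenPartialHomeomorph M E} (hφ : φ ∈ IsManifold.maximalAtlas 𝓘(ℝ, E) ∞ M) {y : E}
    (hy : y ∈ φ.target) :
    (dChartSymm φ y : E →L[ℝ] E) = fderiv ℝ (chartAt E (φ.symm y) ∘ φ.symm) y := by
  have h := (mdifferentiableAt_chart_symm hφ hy).hasMFDerivAt.2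
  simp only [writtenInExtChartAt, extChartAt, mfld_simps, chartAt_self_eq] at h
  have key : ∀ D : E →L[ℝ] E,
      HasFDerivWithinAt (chartAt E (φ.symm y) ∘ φ.symm) D univ y →
        D = fderiv ℝ (chartAt E (φ.symm y) ∘ φ.symm) y :=
    fun D hD => (hasFDerivWithinAt_univ.1 hD).fderiv.symm
  exact key _ h

/-- By the chain rule, the reverse transition map provides a left inverse. -/
theorem dChartSymm_injective {E : Type*} [NormedAddCommGroup E] [NormedSpace ℝ E]
    {M : Type*} [TopologicalSpace M] [ChartedSpace E M] [IsManifold 𝓘(ℝ, E) ∞ M]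
    {φ : OpenPartialHomeomorph M E} (hφ : φ ∈ IsManifold.maximalAtlas 𝓘(ℝ, E) ∞ M) {y : E}
    (hy : y ∈ φ.target) : Function.Injective (dChartSymm φ y : E →L[ℝ] E) := by
  rw [dChartSymm_eq_fderiv hφ hy]
  set c := chartAt E (φ.symm y) with hc
  have hcm : c ∈ IsManifold.maximalAtlas 𝓘(ℝ, E) ∞ M := IsManifold.chart_mem_maximalAtlas _
  have hys : φ.symm y ∈ c.source := mem_chart_source E _
  have h1 := hasFDerivAt_transition hφ hcm ⟨hy, hys⟩
  have hq : (c ∘ φ.symm) y ∈ c.target ∩ c.symm ⁻¹' φ.source := by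
    refine ⟨c.map_source hys, ?_⟩
    simp only [Function.comp, mem_preimage, c.left_inv hys]
    exact φ.map_target hy
  have h2 := (hasFDerivAt_transition hcm hφ hq).comp y h1
  have h3 : (φ ∘ c.symm) ∘ (c ∘ φ.symm) =ᶠ[𝓝 y] id := by
    filter_upwards [(isOpen_transition φ c).mem_nhds ⟨hy, hys⟩] with z hz
    simp [c.left_inv hz.2, φ.right_inv hz.1]
  have h4 := (h2.congr_of_eventuallyEq h3.symm).unique (hasFDerivAt_id y)
  intro v w hvw
  have h5 : ∀ u, u = fderiv ℝ (φ ∘ c.symm) ((c ∘ φ.symm) y) (fderiv ℝ (c ∘ φ.symm) y u) :=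
    fun u => (congrArg (fun T : E →L[ℝ] E => T u) h4).symm
  rw [h5 v, h5 w]
  exact congrArg _ hvw

variable {m : ℕ} {X : Type*} [TopologicalSpace X] [ChartedSpace (Cn m) X]
  [IsManifold 𝓘(ℂ, Cn m) ω X]

theorem real_mem_maximalAtlas {φ : OpenPartialHomeomorph X (Cn m)}
    (hφ : φ ∈ IsManifold.maximalAtlas 𝓘(ℂ, Cn m) ω X) :
    φ ∈ IsManifold.maximalAtlas 𝓘(ℝ, Cn m) ∞ X := by
  have hle : contDiffGroupoid ω 𝓘(ℂ, Cn m) ≤ contDiffGroupoid ∞ 𝓘(ℝ, Cn m) := by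
    intro e he
    have h1 := (contDiffGroupoid_le (I := 𝓘(ℂ, Cn m)) (le_top : (∞ : WithTop ℕ∞) ≤ ω)) he
    have h2 := mem_groupoid_of_pregroupoid.1 h1
    exact mem_groupoid_of_pregroupoid.2
      ⟨ContDiffOn.restrict_scalars ℝ h2.1, ContDiffOn.restrict_scalars ℝ h2.2⟩
  exact StructureGroupoid.maximalAtlas_mono hle hφ

theorem contDiffAt_holomorphic_transition {φ ψ : OpenPartialHomeomorph X (Cn m)}
    (hφ : φ ∈ IsManifold.maximalAtlas 𝓘(ℂ, Cn m) ω X)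
    (hψ : ψ ∈ IsManifold.maximalAtlas 𝓘(ℂ, Cn m) ω X) {y : Cn m} (hy : y ∈ φ.target)
    (hy' : φ.symm y ∈ ψ.source) : ContDiffAt ℂ ω (ψ ∘ φ.symm) y := by
  rw [← contMDiffAt_iff_contDiffAt]
  exact (contMDiffAt_of_mem_maximalAtlas hψ hy').comp y (contMDiffAt_symm_of_mem_maximalAtlas hφ hy)

/-- The transition maps are holomorphic, so their real derivatives commute with multiplication by
`i`. -/
theorem dChartSymm_I_smul {φ : OpenPartialHomeomorph X (Cn m)}
    (hφ : φ ∈ IsManifold.maximalAtlas 𝓘(ℂ, Cn m) ω X) {y : Cn m} (hy : y ∈ φ.target) (V : Cn m) :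
    dChartSymm φ y (Complex.I • V) = J (φ.symm y) (dChartSymm φ y V) := by
  have h1 := contDiffAt_holomorphic_transition hφ
    (IsManifold.chart_mem_maximalAtlas (I := 𝓘(ℂ, Cn m)) (n := ω) (φ.symm y)) hy
    (mem_chart_source _ _)
  have h2 : (dChartSymm φ y : Cn m →L[ℝ] Cn m) =
      (fderiv ℂ (chartAt (Cn m) (φ.symm y) ∘ φ.symm) y).restrictScalars ℝ := by
    rw [dChartSymm_eq_fderiv (real_mem_maximalAtlas hφ) hy]
    exact ((h1.differentiableAt (by simp)).hasFDerivAt.restrictScalars ℝ).fderiv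
  have h3 : ∀ (D : Cn m →L[ℝ] Cn m) (D' : Cn m →L[ℂ] Cn m), D = D'.restrictScalars ℝ →
      D (Complex.I • V) = Complex.I • D V := by
    rintro _ D' rfl
    exact map_smul D' Complex.I V
  exact h3 _ _ h2

theorem J_J (x : X) (v : TangentSpace 𝓘(ℝ, Cn m) x) : J x (J x v) = -v := by
  have h : ∀ u : Cn m, Complex.I • Complex.I • u = -u := fun u => by
    rw [smul_smul, Complex.I_mul_I, neg_one_smul]
  exact h v

/-- As `J² = -1`, the two Hessian terms combine into the Levi quadratic form. -/
theorem iddbar_J_self (f : X → ℝ) (x : X) (v : TangentSpace 𝓘(ℝ, Cn m) x) :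
    iddbar f x v (J x v) = levi (f ∘ (chartAt (Cn m) x).symm) (chartAt (Cn m) x x) (v : Cn m) := by
  have key : ∀ (H : Cn m →L[ℝ] Cn m →L[ℝ] ℝ) (u : Cn m),
      (H (Complex.I • u) (Complex.I • u) - H u (-u)) / 2 =
        (H (Complex.I • u) (Complex.I • u) + H u u) / 2 := fun H u => by simp
  rw [iddbar, J_J]
  exact key _ v

/-- The form `i∂∂̄ f` on a holomorphic chart. -/
theorem iddbar_dChartSymm {φ : OpenPartialHomeomorph X (Cn m)}
    (hφ : φ ∈ IsManifold.maximalAtlas 𝓘(ℂ, Cn m) ω X) {y : Cn m} (hy : y ∈ φ.target) {f : X → ℝ}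
    (hf : ContMDiffAt 𝓘(ℝ, Cn m) 𝓘(ℝ, ℝ) ∞ f (φ.symm y)) (V : Cn m) :
    iddbar f (φ.symm y) (dChartSymm φ y V) (J (φ.symm y) (dChartSymm φ y V)) =
      levi (f ∘ φ.symm) y V := by
  rw [iddbar_J_self]
  set c := chartAt (Cn m) (φ.symm y) with hc
  have hcs : φ.symm y ∈ c.source := mem_chart_source _ _
  have hcm : c ∈ IsManifold.maximalAtlas 𝓘(ℂ, Cn m) ω X := IsManifold.chart_mem_maximalAtlas _
  have h1 : f ∘ φ.symm =ᶠ[𝓝 y] (f ∘ c.symm) ∘ (c ∘ φ.symm) := by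
    filter_upwards [(isOpen_transition φ c).mem_nhds ⟨hy, hcs⟩] with z hz
    simp [c.left_inv hz.2]
  have h2 : ContDiffAt ℝ 2 (f ∘ c.symm) ((c ∘ φ.symm) y) := by
    have h3 : ContMDiffAt 𝓘(ℝ, Cn m) 𝓘(ℝ, Cn m) ∞ c.symm (c (φ.symm y)) :=
      contMDiffAt_symm_of_mem_maximalAtlas (real_mem_maximalAtlas hcm) (c.map_source hcs)
    have h4 : ContMDiffAt 𝓘(ℝ, Cn m) 𝓘(ℝ, ℝ) ∞ f (c.symm (c (φ.symm y))) := by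
      rwa [c.left_inv hcs]
    exact contDiffAt_infty.1 (contMDiffAt_iff_contDiffAt.1 (h4.comp _ h3)) 2
  rw [levi_congr h1, levi_comp
    ((contDiffAt_holomorphic_transition hφ hcm hy hcs).of_le (by simp)) h2,
    ← dChartSymm_eq_fderiv (real_mem_maximalAtlas hφ) hy]
  rfl

/-- The value of a `2`-form at a pair of vectors of the model space. -/
def KahlerForm.formAt (Ω : KahlerForm m X) (x : X) (v w : Cn m) : ℝ := Ω.toForm x ![v, w]

theorem twoFormInChart_apply (Ω : KahlerForm m X) (Z : OpenPartialHomeomorph X (Cn m)) (z V W : Cn m) :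
    twoFormInChart Ω.toForm Z z ![V, W] =
      Ω.formAt (Z.symm z) (dChartSymm Z z V) (dChartSymm Z z W) := by
  rw [twoFormInChart, ContinuousAlternatingMap.compContinuousLinearMap_apply]
  change _ = Ω.toForm _ _
  congr 1
  funext i
  fin_cases i <;> rfl

/-- Near `z` the inclusion composed with `φ⁻¹` is `Z⁻¹`; the chain rule identifies the two
pull-backs. -/
theorem KahlerForm.restrict_dChartSymm (Ω : KahlerForm m X) {U : TopologicalSpace.Opens X}
    {Z : OpenPartialHomeomorph X (Cn m)} {φ : OpenPartialHomeomorph U (Cn m)}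
    (hφ : φ ∈ IsManifold.maximalAtlas 𝓘(ℂ, Cn m) ω U)
    (hφZ : ∀ z ∈ φ.target, (φ.symm z : X) = Z.symm z) {z : Cn m} (hz : z ∈ φ.target)
    (V W : Cn m) :
    Ω.restrict U (φ.symm z) (dChartSymm φ z V) (dChartSymm φ z W) =
      twoFormInChart Ω.toForm Z z ![V, W] := by
  rw [twoFormInChart_apply]
  have h1 : MDifferentiableAt 𝓘(ℝ, Cn m) 𝓘(ℝ, Cn m) (Subtype.val : U → X) (φ.symm z) :=
    (contMDiff_subtype_val (I := 𝓘(ℝ, Cn m)) (n := ∞)).contMDiffAt.mdifferentiableAt (by simp)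
  have h2 := mdifferentiableAt_chart_symm (real_mem_maximalAtlas hφ) hz
  have h3 := mfderiv_comp z h1 h2
  have h4 : Z.symm =ᶠ[𝓝 z] Subtype.val ∘ φ.symm := by
    filter_upwards [φ.open_target.mem_nhds hz] with y hy using (hφZ y hy).symm
  have h5 : (dChartSymm Z z : Cn m →L[ℝ] Cn m) =
      ((mfderiv 𝓘(ℝ, Cn m) 𝓘(ℝ, Cn m) (Subtype.val : U → X) (φ.symm z)).comp
        (dChartSymm φ z) : Cn m →L[ℝ] Cn m) := by
    rw [dChartSymm, h4.mfderiv_eq]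
    exact h3
  rw [h5, ← hφZ z hz]
  rfl

end HolomorphicCharts

end

end PoincareType

open scoped ContDiff Manifold Topology
open Bundle MeasureTheory

namespace PoincareType

noncomputable section

/-! ### The metric `g` in an adapted chart. -/

section ModelMetric

open Set Filter

variable {m : ℕ} {X : Type*} [TopologicalSpace X] [ChartedSpace (Cn m) X]
  [IsManifold 𝓘(ℂ, Cn m) ω X]

/-- The quadratic form is continuous and positive on the compact product of `K` with the unit
sphere; homogeneity of degree two extends the bounds to all vectors. -/
theorem KahlerForm.exists_bound (Ω : KahlerForm m X) {Z : OpenPartialHomeomorph X (Cn m)}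
    (hZ : Z ∈ IsManifold.maximalAtlas 𝓘(ℂ, Cn m) ω X) {K : Set (Cn m)} (hK : IsCompact K)
    (hKZ : K ⊆ Z.target) : ∃ c C : ℝ, 0 < c ∧ ∀ z ∈ K, ∀ V : Cn m,
      c * ‖V‖ ^ 2 ≤ twoFormInChart Ω.toForm Z z ![V, Complex.I • V] ∧
      twoFormInChart Ω.toForm Z z ![V, Complex.I • V] ≤ C * ‖V‖ ^ 2 := by
  set q : Cn m × Cn m → ℝ := fun y => twoFormInChart Ω.toForm Z y.1 ![y.2, Complex.I • y.2] with hq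
  have hsm := (Ω.smooth Z (real_mem_maximalAtlas hZ)).continuousOn.mono hKZ
  have hKS : IsCompact (K ×ˢ Metric.sphere (0 : Cn m) 1) := hK.prod (isCompact_sphere _ _)
  have hcont : ContinuousOn q (K ×ˢ Metric.sphere (0 : Cn m) 1) := by
    have h1 : ContinuousOn (fun y : Cn m × Cn m =>
        (twoFormInChart Ω.toForm Z y.1).toContinuousMultilinearMap)
        (K ×ˢ Metric.sphere (0 : Cn m) 1) :=
      (ContinuousAlternatingMap.toContinuousMultilinearMapCLM ℝ).continuous.comp_continuousOn
        (hsm.comp continuousOn_fst fun y hy => hy.1)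
    have h2 : Continuous (fun y : Cn m × Cn m => (![y.2, Complex.I • y.2] : Fin 2 → Cn m)) := by
      refine continuous_pi fun i => ?_
      fin_cases i
      · exact continuous_snd
      · exact continuous_snd.const_smul Complex.I
    exact h1.eval h2.continuousOn
  have hposq : ∀ y ∈ K ×ˢ Metric.sphere (0 : Cn m) 1, 0 < q y := by
    rintro ⟨z, V⟩ ⟨hz, hV⟩
    simp only [hq, twoFormInChart_apply, dChartSymm_I_smul hZ (hKZ hz)]
    refine Ω.pos (Z.symm z) (dChartSymm Z z V) fun h0 => ?_
    have h1 := dChartSymm_injective (real_mem_maximalAtlas hZ) (hKZ hz)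
      (h0.trans (map_zero (dChartSymm Z z)).symm)
    rw [h1] at hV
    simp at hV
  obtain ⟨c, hc, hcle⟩ := hKS.exists_forall_le' hcont hposq
  obtain ⟨C, hC⟩ := hKS.exists_bound_of_continuousOn hcont
  have hhom : ∀ z V, q (z, V) = ‖V‖ ^ 2 * q (z, ‖V‖⁻¹ • V) := by
    intro z V
    rcases eq_or_ne V 0 with rfl | hV
    · have h0 : (![(0 : Cn m), Complex.I • (0 : Cn m)] : Fin 2 → Cn m) 0 = 0 := rfl
      simp only [hq, norm_zero]
      rw [ContinuousAlternatingMap.map_coord_zero _ 0 h0]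
      simp
    · have h1 : (![V, Complex.I • V] : Fin 2 → Cn m) =
          fun i => ‖V‖ • (![‖V‖⁻¹ • V, Complex.I • ‖V‖⁻¹ • V] : Fin 2 → Cn m) i := by
        have h2 : ‖V‖ • ‖V‖⁻¹ • V = V := by
          rw [smul_smul, mul_inv_cancel₀ (norm_ne_zero_iff.2 hV), one_smul]
        funext i
        fin_cases i
        · exact h2.symm
        · change Complex.I • V = ‖V‖ • Complex.I • ‖V‖⁻¹ • V
          rw [smul_comm, h2]
      simp only [hq]
      rw [h1, ContinuousAlternatingMap.map_smul_univ]
      simp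
  refine ⟨c, C, hc, fun z hz V => ?_⟩
  change c * ‖V‖ ^ 2 ≤ q (z, V) ∧ q (z, V) ≤ C * ‖V‖ ^ 2
  rcases eq_or_ne V 0 with rfl | hV
  · rw [hhom]; simp
  have hm : (z, ‖V‖⁻¹ • V) ∈ K ×ˢ Metric.sphere (0 : Cn m) 1 := by
    refine ⟨hz, ?_⟩
    simp [norm_smul, norm_ne_zero_iff.2 hV]
  have hV2 : 0 ≤ ‖V‖ ^ 2 := by positivity
  rw [hhom z V, mul_comm c, mul_comm C]
  exact ⟨mul_le_mul_of_nonneg_left (hcle _ hm) hV2,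
    mul_le_mul_of_nonneg_left ((le_abs_self _).trans (hC _ hm)) hV2⟩

theorem contMDiffAt_real {F : Type*} [NormedAddCommGroup F] [NormedSpace ℂ F] {f : X → F} {x : X}
    (hf : ContMDiffAt 𝓘(ℂ, Cn m) 𝓘(ℂ, F) ω f x) : ContMDiffAt 𝓘(ℝ, Cn m) 𝓘(ℝ, F) ∞ f x := by
  rw [contMDiffAt_iff] at hf ⊢
  refine ⟨hf.1, ?_⟩
  have h := hf.2
  simp only [extChartAt, mfld_simps, chartAt_self_eq, contDiffWithinAt_univ] at h ⊢
  exact (h.of_le le_top).restrict_scalars ℝ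

section Sections

variable {K : X → Type*} [∀ x, AddCommGroup (K x)] [∀ x, Module ℂ (K x)]
  [∀ x, TopologicalSpace (K x)] [TopologicalSpace (TotalSpace ℂ K)] [FiberBundle ℂ K]
  [VectorBundle ℂ ℂ K]

theorem HermitianMetric.contMDiffOn_frameNormSq (h : HermitianMetric m K) (p : X) :
    ContMDiffOn 𝓘(ℝ, Cn m) 𝓘(ℝ, ℝ) ∞ (h.frameNormSq p) (trivializationAt ℂ K p).baseSet :=
  h.smooth p

theorem HermitianMetric.contMDiff_normSq [ContMDiffVectorBundle ω ℂ K 𝓘(ℂ, Cn m)]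
    (h : HermitianMetric m K) (s : Cₛ^ω⟮𝓘(ℂ, Cn m); ℂ, K⟯) :
    ContMDiff 𝓘(ℝ, Cn m) 𝓘(ℝ, ℝ) ∞ (fun x => h.normSq x (s x)) := by
  intro p
  have hb : (trivializationAt ℂ K p).baseSet ∈ 𝓝 p :=
    (trivializationAt ℂ K p).open_baseSet.mem_nhds (FiberBundle.mem_baseSet_trivializationAt' p)
  have h1 : ContMDiffAt 𝓘(ℝ, Cn m) 𝓘(ℝ, ℂ) ∞ (localRep s p) p :=
    contMDiffAt_real ((contMDiffOn_localRep s p).contMDiffAt hb)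
  have h2 : ContMDiffAt 𝓘(ℝ, Cn m) 𝓘(ℝ, ℝ) ∞ (fun x => ‖localRep s p x‖ ^ 2) p := by
    have h3 : ContDiff ℝ ∞ (fun w : ℂ => ‖w‖ ^ 2) := contDiff_norm_sq ℝ
    exact h3.contMDiff.contMDiffAt.comp p h1
  have h4 : ContMDiffAt 𝓘(ℝ, Cn m) 𝓘(ℝ, ℝ) ∞ (fun x => ‖localRep s p x‖ ^ 2 * h.frameNormSq p x) p :=
    h2.mul ((h.contMDiffOn_frameNormSq p).contMDiffAt hb)
  refine h4.congr_of_eventuallyEq ?_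
  filter_upwards [hb] with x hx using h.normSq_section s hx

end Sections

theorem contDiffOn_comp_chart_symm {f : X → ℝ} {s : Set X} {Z : OpenPartialHomeomorph X (Cn m)}
    (hf : ContMDiffOn 𝓘(ℝ, Cn m) 𝓘(ℝ, ℝ) ∞ f s)
    (hZ : Z ∈ IsManifold.maximalAtlas 𝓘(ℂ, Cn m) ω X) (hs : Z.source ⊆ s) :
    ContDiffOn ℝ ∞ (f ∘ Z.symm) Z.target := by
  rw [← contMDiffOn_iff_contDiffOn]
  exact hf.comp (contMDiffOn_symm_of_mem_maximalAtlas (real_mem_maximalAtlas hZ))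
    fun y hy => hs (Z.map_target hy)

open Classical in
/-- The Poincaré metric of the punctured disc in the coordinates in `S`, the Euclidean metric in
the other ones. -/
def coordSq (S : Set (Fin m)) (i : Fin m) (z V : Cn m) : ℝ :=
  if i ∈ S then cuspSq i z V else ‖V i‖ ^ 2

theorem coordSq_of_mem {S : Set (Fin m)} {i : Fin m} (hi : i ∈ S) {z V : Cn m} :
    coordSq S i z V = cuspSq i z V := if_pos hi

theorem coordSq_of_notMem {S : Set (Fin m)} {i : Fin m} (hi : i ∉ S) {z V : Cn m} :
    coordSq S i z V = ‖V i‖ ^ 2 := if_neg hi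

theorem coordSq_nonneg (S : Set (Fin m)) (i : Fin m) (z V : Cn m) : 0 ≤ coordSq S i z V := by
  unfold coordSq
  split_ifs
  · exact cuspSq_nonneg _ _ _
  · positivity

/-- Since `|t log t| < 1` for `0 < t < 1`, the Poincaré metric dominates the Euclidean one on the
punctured disc. -/
theorem sq_le_four_mul_cusp {i : Fin m} {z : Cn m} (hz : z i ≠ 0) (h1 : ‖z i‖ ≤ Real.exp (-1))
    (V : Cn m) : ‖V i‖ ^ 2 ≤ 4 * cuspSq i z V := by
  have h0 : 0 < ‖z i‖ := norm_pos_iff.2 hz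
  have h1' : ‖z i‖ < 1 := h1.trans_lt (by rw [Real.exp_lt_one_iff]; norm_num)
  have h2 := Real.abs_log_mul_self_lt _ h0 h1'.le
  have hlog : Real.log ‖z i‖ < 0 := Real.log_neg h0 h1'
  have h3 : (Real.log ‖z i‖ * ‖z i‖) ^ 2 ≤ 1 := by
    rw [← sq_abs]
    exact pow_le_one₀ (abs_nonneg _) h2.le
  have h4 : 0 < ‖z i‖ ^ 2 * Real.log ‖z i‖ ^ 2 := by
    have := sq_pos_of_neg hlog
    positivity
  rw [cuspSq, ← mul_div_assoc, le_div_iff₀ h4]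
  nlinarith [sq_nonneg ‖V i‖, sq_nonneg (Real.log ‖z i‖ * ‖z i‖)]

variable {N : ℕ} {L : Fin N → X → Type*} [∀ j x, AddCommGroup (L j x)] [∀ j x, Module ℂ (L j x)]
  [∀ j x, TopologicalSpace (L j x)] [∀ j, TopologicalSpace (TotalSpace ℂ (L j))]
  [∀ j, FiberBundle ℂ (L j)] [∀ j, VectorBundle ℂ ℂ (L j)]
  [∀ j, ContMDiffVectorBundle ω ℂ (L j) 𝓘(ℂ, Cn m)]
  {σ : ∀ j, Cₛ^ω⟮𝓘(ℂ, Cn m); ℂ, L j⟯}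

theorem normSq_pos_of_mem_complement (h : ∀ j, HermitianMetric m (L j)) (j : Fin N)
    (x : complement σ) : 0 < (h j).normSq x.1 (σ j x.1) :=
  (h j).normSq_pos _ _ (x.2 j)

theorem one_le_sub_log {lam t : ℝ} (hlam : 0 ≤ lam) (ht : 0 < t) (h1 : t ≤ Real.exp (-1)) :
    1 ≤ lam - Real.log t := by
  have := (Real.log_le_log ht h1)
  rw [Real.log_exp] at this
  linarith

/-- Smoothness is what allows `i∂∂̄ u_j`, defined through the preferred charts, to be computed in
any holomorphic chart. The argument of the outer logarithm is at least 1 by the bound on `ρ_j`. -/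
theorem contMDiff_potential (h : ∀ j, HermitianMetric m (L j))
    (hρ : ∀ j x, (h j).normSq x (σ j x) ≤ Real.exp (-1)) {lam : ℝ} (hlam : 0 ≤ lam) (j : Fin N) :
    ContMDiff 𝓘(ℝ, Cn m) 𝓘(ℝ, ℝ) ∞ (potential σ h lam j) := by
  intro x
  have h1 : ContMDiffAt 𝓘(ℝ, Cn m) 𝓘(ℝ, ℝ) ∞
      (fun x : complement σ => (h j).normSq x.1 (σ j x.1)) x :=
    ((h j).contMDiff_normSq (σ j)).contMDiffAt.comp x contMDiff_subtype_val.contMDiffAt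
  have hx := normSq_pos_of_mem_complement h j x
  have h2 : ContDiffAt ℝ ∞ (fun t : ℝ => Real.log (lam - Real.log t))
      ((h j).normSq x.1 (σ j x.1)) := by
    refine ContDiffAt.log (contDiffAt_const.sub (contDiffAt_id.log hx.ne')) ?_
    have := one_le_sub_log hlam hx (hρ j x.1)
    exact (one_pos.trans_le this).ne'
  exact ContMDiffAt.comp (g := fun t : ℝ => Real.log (lam - Real.log t)) x h2.contMDiffAt h1

open Classical in
/-- The Poincaré metric in the coordinate attached to the index `j`, if there is one. -/
def cuspTerm {p : X} (ι : {j // σ j p = 0} → Fin m) (j : Fin N) (z V : Cn m) : ℝ :=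
  if hj : σ j p = 0 then cuspSq (ι ⟨j, hj⟩) z V else 0

theorem cuspTerm_of_eq_zero {p : X} (ι : {j // σ j p = 0} → Fin m) {j : Fin N} (hj : σ j p = 0)
    (z V : Cn m) : cuspTerm ι j z V = cuspSq (ι ⟨j, hj⟩) z V := dif_pos hj

theorem cuspTerm_of_ne_zero {p : X} (ι : {j // σ j p = 0} → Fin m) {j : Fin N} (hj : σ j p ≠ 0)
    (z V : Cn m) : cuspTerm ι j z V = 0 := dif_neg hj

theorem cuspTerm_nonneg {p : X} (ι : {j // σ j p = 0} → Fin m) (j : Fin N) (z V : Cn m) :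
    0 ≤ cuspTerm ι j z V := by
  unfold cuspTerm
  split_ifs
  · exact cuspSq_nonneg _ _ _
  · exact le_rfl

theorem sum_cuspTerm {p : X} {ι : {j // σ j p = 0} → Fin m} (hι : Function.Injective ι)
    (z V : Cn m) : ∑ j, cuspTerm ι j z V = ∑ i, (range ι).indicator (fun i => cuspSq i z V) i := by
  classical
  rw [← Fintype.sum_subtype_add_sum_subtype (fun j => σ j p = 0) fun j => cuspTerm ι j z V,
    Finset.sum_eq_zero (s := (Finset.univ : Finset {j // ¬ σ j p = 0}))
      fun j _ => cuspTerm_of_ne_zero ι j.2 z V, add_zero,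
    Finset.sum_indicator_eq_sum_filter]
  have e : Finset.univ.filter (fun i => i ∈ range ι) = Finset.univ.image ι := by ext; simp
  rw [e, Finset.sum_image fun a _ b _ hab => hι hab]
  exact Finset.sum_congr rfl fun j _ => cuspTerm_of_eq_zero ι j.2 z V

/-- The product of the Poincaré metrics in the coordinates in `S` and the Euclidean metrics in the
other ones is comparable to the sum of the Euclidean metric and these Poincaré metrics. -/
theorem sum_coordSq_comparison {p : X} {ι : {j // σ j p = 0} → Fin m} (hι : Function.Injective ι)
    {z : Cn m} (hz : ∀ j, z (ι j) ≠ 0) (h1 : ‖z‖ ≤ Real.exp (-1)) (V : Cn m) :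
    ∑ i, coordSq (range ι) i z V ≤ (m + 1) * (‖V‖ ^ 2 + ∑ j, cuspTerm ι j z V) ∧
    ‖V‖ ^ 2 + ∑ j, cuspTerm ι j z V ≤ 5 * ∑ i, coordSq (range ι) i z V := by
  rw [sum_cuspTerm hι]
  have hc0 : ∀ i, 0 ≤ coordSq (range ι) i z V := fun i => coordSq_nonneg _ _ _ _
  have hi0 : ∀ i, 0 ≤ (range ι).indicator (fun i => cuspSq i z V) i := fun i =>
    indicator_nonneg (fun i _ => cuspSq_nonneg i z V) i
  -- The Euclidean part of `V` in each coordinate is controlled by the corresponding summand of the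
  -- product metric. Together with the cusp terms themselves this gives the constant `5 = 4 + 1`.
  have hVi : ∀ i, ‖V i‖ ^ 2 ≤ 4 * coordSq (range ι) i z V := by
    intro i
    by_cases hi : i ∈ range ι
    · rw [coordSq_of_mem hi]
      obtain ⟨j, rfl⟩ := hi
      exact sq_le_four_mul_cusp (hz j) ((norm_le_pi_norm z _).trans h1) V
    · rw [coordSq_of_notMem hi]
      nlinarith [sq_nonneg ‖V i‖]
  constructor
  · have h2 : ∀ i, coordSq (range ι) i z V ≤
        ‖V‖ ^ 2 + (range ι).indicator (fun i => cuspSq i z V) i := by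
      intro i
      by_cases hi : i ∈ range ι
      · rw [coordSq_of_mem hi, indicator_of_mem hi]
        nlinarith [sq_nonneg ‖V‖]
      · rw [coordSq_of_notMem hi, indicator_of_notMem hi, add_zero]
        exact pow_le_pow_left₀ (norm_nonneg _) (norm_le_pi_norm V i) 2
    refine (Finset.sum_le_sum fun i _ => h2 i).trans ?_
    rw [Finset.sum_add_distrib, Finset.sum_const, Finset.card_univ, Fintype.card_fin, nsmul_eq_mul]
    have := Finset.sum_nonneg fun i (_ : i ∈ Finset.univ) => hi0 i
    nlinarith [sq_nonneg ‖V‖, mul_nonneg (Nat.cast_nonneg (α := ℝ) m) this]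
  · have h2 : ‖V‖ ^ 2 ≤ ∑ i, ‖V i‖ ^ 2 := by
      have h3 : ‖V‖ ≤ Real.sqrt (∑ i, ‖V i‖ ^ 2) :=
        (pi_norm_le_iff_of_nonneg (Real.sqrt_nonneg _)).2 fun i => Real.le_sqrt_of_sq_le
          (Finset.single_le_sum (f := fun i => ‖V i‖ ^ 2) (fun _ _ => by positivity)
            (Finset.mem_univ i))
      calc ‖V‖ ^ 2 ≤ Real.sqrt (∑ i, ‖V i‖ ^ 2) ^ 2 := pow_le_pow_left₀ (norm_nonneg _) h3 2
        _ = _ := Real.sq_sqrt (Finset.sum_nonneg fun _ _ => by positivity)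
    have h4 : ∑ i, ‖V i‖ ^ 2 ≤ 4 * ∑ i, coordSq (range ι) i z V := by
      rw [Finset.mul_sum]
      exact Finset.sum_le_sum fun i _ => hVi i
    have h5 : ∑ i, (range ι).indicator (fun i => cuspSq i z V) i ≤
        ∑ i, coordSq (range ι) i z V := by
      refine Finset.sum_le_sum fun i _ => ?_
      by_cases hi : i ∈ range ι
      · rw [coordSq_of_mem hi, indicator_of_mem hi]
      · rw [indicator_of_notMem hi]; exact hc0 i
    linarith

/-- In an adapted chart, the Levi form of a potential is comparable, up to bounded terms, to minus
the Poincaré metric in the corresponding coordinate, if there is one. -/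
theorem exists_levi_potential_bound (h : ∀ j, HermitianMetric m (L j))
    (hρ : ∀ j x, (h j).normSq x (σ j x) ≤ Real.exp (-1)) {lam : ℝ} (hlam : 0 ≤ lam) {p : X}
    {Z : OpenPartialHomeomorph X (Cn m)} {ι : {j // σ j p = 0} → Fin m} (hZ : IsAdapted σ p Z ι)
    {K : Set (Cn m)} (hK : IsCompact K) (hKZ : K ⊆ Z.target)
    (hK1 : ∀ z ∈ K, ‖z‖ ≤ Real.exp (-1)) (j : Fin N) :
    ∃ c C : ℝ, 0 < c ∧ 0 ≤ C ∧ ∀ z ∈ K, σ j (Z.symm z) ≠ 0 → ∀ V : Cn m,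
      -(C * (cuspTerm ι j z V + ‖V‖ ^ 2)) ≤
        levi (fun y => Real.log (lam - Real.log ((h j).normSq (Z.symm y) (σ j (Z.symm y))))) z V ∧
      levi (fun y => Real.log (lam - Real.log ((h j).normSq (Z.symm y) (σ j (Z.symm y))))) z V ≤
        -(c * cuspTerm ι j z V) + C * ‖V‖ ^ 2 := by
  by_cases hj : σ j p = 0
  · simp only [cuspTerm_of_eq_zero ι hj]
    set i := ι ⟨j, hj⟩ with hi
    -- In the chart `log |σ_j|² = log |z_i|² + η`, with `η` the logarithm of the squared norm of the
    -- local frame. It is smooth across the divisor, so its derivatives are bounded on `K`.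
    set η : Cn m → ℝ := fun y => Real.log ((h j).frameNormSq p (Z.symm y)) with hη
    have hfpos : ∀ y ∈ Z.target, 0 < (h j).frameNormSq p (Z.symm y) := fun y hy =>
      (h j).frameNormSq_pos (hZ.subset_baseSet j (Z.map_target hy))
    have hηs : ContDiffOn ℝ ∞ η Z.target :=
      (contDiffOn_comp_chart_symm ((h j).contMDiffOn_frameNormSq p) hZ.mem_maximalAtlas
        (hZ.subset_baseSet j)).log fun y hy => (hfpos y hy).ne'
    have hrep : ∀ y ∈ Z.target, localRep (σ j) p (Z.symm y) = y i := fun y hy => by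
      rw [← hZ.apply_eq ⟨j, hj⟩ _ (Z.map_target hy), Z.right_inv hy]
    have hlog : ∀ y ∈ Z.target, y i ≠ 0 →
        Real.log ((h j).normSq (Z.symm y) (σ j (Z.symm y))) = logNormSq (y i) + η y := by
      intro y hy hyi
      rw [(h j).normSq_section (σ j) (hZ.subset_baseSet j (Z.map_target hy)), hrep y hy,
        Real.log_mul (by positivity) (hfpos y hy).ne']
      rfl
    have hne : ∀ y ∈ Z.target, (y i ≠ 0 ↔ σ j (Z.symm y) ≠ 0) := fun y hy => by
      rw [← hrep y hy]
      exact not_congr (localRep_eq_zero_iff (σ j) (hZ.subset_baseSet j (Z.map_target hy)))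
    obtain ⟨c, C, hc, hC, hb⟩ := exists_levi_log_bound i Z.open_target hK hKZ hηs hlam
      (fun z hz => (norm_le_pi_norm z i).trans (hK1 z hz)) (fun z hz hzi => by
        rw [← hlog z (hKZ hz) hzi, ← Real.log_exp (-1)]
        exact Real.log_le_log ((h j).normSq_pos _ _ ((hne z (hKZ hz)).1 hzi)) (hρ j _))
    refine ⟨c, C, hc, hC, fun z hz hσz V => ?_⟩
    have hzi := (hne z (hKZ hz)).2 hσz
    have hev : (fun y => Real.log (lam - Real.log ((h j).normSq (Z.symm y) (σ j (Z.symm y))))) =ᶠ[𝓝 z]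
        fun y => Real.log (lam - (logNormSq (y i) + η y)) := by
      filter_upwards [Z.open_target.mem_nhds (hKZ hz),
        (continuous_apply i).continuousAt.eventually_ne hzi] with y hy hyi
      rw [hlog y hy hyi]
    rw [levi_congr hev]
    exact hb z hz hzi V
  · simp only [cuspTerm_of_ne_zero ι hj]
    -- A component that avoids the chart has a potential smooth on the whole target, hence with
    -- bounded Levi form on `K`.
    have hs : ContDiffOn ℝ ∞
        (fun y => Real.log (lam - Real.log ((h j).normSq (Z.symm y) (σ j (Z.symm y))))) Z.target := by
      have h1 : ContDiffOn ℝ ∞ (fun y => (h j).normSq (Z.symm y) (σ j (Z.symm y))) Z.target :=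
        contDiffOn_comp_chart_symm ((h j).contMDiff_normSq (σ j)).contMDiffOn hZ.mem_maximalAtlas
          (subset_univ _)
      have h2 : ∀ y ∈ Z.target, 0 < (h j).normSq (Z.symm y) (σ j (Z.symm y)) := fun y hy =>
        (h j).normSq_pos _ _ (hZ.ne_zero j hj _ (Z.map_target hy))
      refine (contDiffOn_const.sub (h1.log fun y hy => (h2 y hy).ne')).log fun y hy => ?_
      have := one_le_sub_log hlam (h2 y hy) (hρ j _)
      linarith
    obtain ⟨C, hC, hb⟩ := exists_levi_bound Z.open_target hK hKZ hs
    refine ⟨1, C, one_pos, hC, fun z hz _ V => ?_⟩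
    have := abs_le.1 ((hb z hz).2.2 V)
    simpa using this

/-- A metric quasi-isometric to the model form is, in an adapted chart, comparable to a product of
Euclidean and Poincaré metrics. -/
theorem exists_metricAt_bound (Ω : KahlerForm m X) (h : ∀ j, HermitianMetric m (L j))
    (hρ : ∀ j x, (h j).normSq x (σ j x) ≤ Real.exp (-1)) {A : Fin N → ℝ} (hA : ∀ j, 0 < A j)
    {lam : ℝ} (hlam : 0 ≤ lam)
    (hpos : ∃ ε : ℝ, 0 < ε ∧ ∀ (x : complement σ) (v : TangentSpace 𝓘(ℝ, Cn m) x),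
      ε * Ω.restrict (complement σ) x v (J x v) ≤ modelForm Ω σ h A lam x v (J x v))
    (g : SmoothMetric (Cn m) (complement σ)) (hg : IsQuasiIsometric Ω σ h A lam g) {p : X}
    {Z : OpenPartialHomeomorph X (Cn m)} {ι : {j // σ j p = 0} → Fin m} (hZ : IsAdapted σ p Z ι)
    {K : Set (Cn m)} (hK : IsCompact K) (hKZ : K ⊆ Z.target)
    (hK1 : ∀ z ∈ K, ‖z‖ ≤ Real.exp (-1)) {φ : OpenPartialHomeomorph (complement σ) (Cn m)}
    (hφ : φ ∈ IsManifold.maximalAtlas 𝓘(ℂ, Cn m) ω (complement σ))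
    (hφZ : ∀ z ∈ φ.target, (φ.symm z : X) = Z.symm z) :
    ∃ c C : ℝ, 0 < c ∧ 0 < C ∧ ∀ z ∈ φ.target, z ∈ K → ∀ V : Cn m,
      c * ∑ i, coordSq (range ι) i z V ≤
        metricAt g (φ.symm z) (dChartSymm φ z V) (dChartSymm φ z V) ∧
      metricAt g (φ.symm z) (dChartSymm φ z V) (dChartSymm φ z V) ≤
        C * ∑ i, coordSq (range ι) i z V := by
  obtain ⟨ε, hε, hpos⟩ := hpos
  obtain ⟨cg, hcg, hg⟩ := hg
  obtain ⟨c0, C0, hc0, hΩ⟩ := Ω.exists_bound hZ.mem_maximalAtlas hK hKZ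
  -- The comparison is carried out over pairs of a point and a vector, so that its constants are
  -- uniform in both.
  set S := {y : Cn m × Cn m // y.1 ∈ φ.target ∧ y.1 ∈ K} with hS
  set q : S → ℝ := fun y => twoFormInChart Ω.toForm Z y.1.1 ![y.1.2, Complex.I • y.1.2] with hq
  set Lv : Fin N → S → ℝ := fun j y => levi (fun y => Real.log (lam -
    Real.log ((h j).normSq (Z.symm y) (σ j (Z.symm y))))) y.1.1 y.1.2 with hLv
  set a : Fin N → S → ℝ := fun j y => cuspTerm ι j y.1.1 y.1.2 with ha
  have ha0 : ∀ j y, 0 ≤ a j y := fun j y => cuspTerm_nonneg _ _ _ _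
  have hrestr : ∀ y : S, Ω.restrict (complement σ) (φ.symm y.1.1) (dChartSymm φ y.1.1 y.1.2)
      (J _ (dChartSymm φ y.1.1 y.1.2)) = q y := fun y => by
    rw [← dChartSymm_I_smul hφ y.2.1, Ω.restrict_dChartSymm hφ hφZ y.2.1]
  have hmodel : ∀ y : S, modelForm Ω σ h A lam (φ.symm y.1.1) (dChartSymm φ y.1.1 y.1.2)
      (J _ (dChartSymm φ y.1.1 y.1.2)) = q y - ∑ j, A j * Lv j y := fun y => by
    rw [modelForm, hrestr]
    congr 1
    refine Finset.sum_congr rfl fun j _ => ?_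
    rw [iddbar_dChartSymm hφ y.2.1 (contMDiff_potential h hρ hlam j).contMDiffAt]
    congr 1
    refine levi_congr ?_ _
    filter_upwards [φ.open_target.mem_nhds y.2.1] with w hw
    exact congrArg (fun x => Real.log (lam - Real.log ((h j).normSq x (σ j x)))) (hφZ w hw)
  have hσz : ∀ z ∈ φ.target, ∀ j, σ j (Z.symm z) ≠ 0 := fun z hz j => by
    rw [← hφZ z hz]; exact (φ.symm z).2 j
  have hzι : ∀ z ∈ φ.target, z ∈ K → ∀ j, z (ι j) ≠ 0 := fun z hz hzK j => by
    have h1 := Z.map_target (hKZ hzK)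
    rw [← Z.right_inv (hKZ hzK), hZ.apply_eq j _ h1]
    exact fun h0 => hσz z hz j ((localRep_eq_zero_iff (σ j) (hZ.subset_baseSet j h1)).1 h0)
  obtain ⟨c, C, hc, hC, hcmp⟩ := exists_comparison (S := S) (q := q)
    (s := fun y => ‖y.1.2‖ ^ 2) (L := Lv) (a := a) hA (fun y => by positivity) ha0
    ⟨c0, C0, hc0, fun y => hΩ _ y.2.2 _⟩ (fun j => by
      obtain ⟨c, C, hc, hC, hb⟩ := exists_levi_potential_bound h hρ hlam hZ hK hKZ hK1 j
      exact ⟨c, C, hc, hC, fun y => hb _ y.2.2 (hσz _ y.2.1 j) _⟩) hε (fun y => by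
      rw [← hmodel, ← hrestr]; exact hpos _ _)
  refine ⟨cg * (c * (m + 1 : ℝ)⁻¹), cg⁻¹ * (C * 5), by positivity, by positivity,
    fun z hz hzK V => ?_⟩
  have h1 := hcmp ⟨(z, V), hz, hzK⟩
  have h2 := hg (φ.symm z) (dChartSymm φ z V)
  have h3 := sum_coordSq_comparison hZ.injective (hzι z hz hzK) (hK1 z hzK) V
  rw [hmodel ⟨(z, V), hz, hzK⟩] at h2
  rw [mul_assoc, mul_assoc, mul_assoc, mul_assoc]
  have h4 : (m + 1 : ℝ)⁻¹ * ∑ i, coordSq (range ι) i z V ≤ ‖V‖ ^ 2 + ∑ j, cuspTerm ι j z V := by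
    rw [inv_mul_le_iff₀ (by positivity)]
    exact h3.1
  exact ⟨(mul_le_mul_of_nonneg_left ((mul_le_mul_of_nonneg_left h4 hc.le).trans h1.1)
    hcg.le).trans h2.1, h2.2.trans (mul_le_mul_of_nonneg_left (h1.2.trans
      (mul_le_mul_of_nonneg_left h3.2 hC.le)) (by positivity))⟩

end ModelMetric

end

end PoincareType

open scoped ContDiff Manifold Topology
open Bundle MeasureTheory

namespace PoincareType

noncomputable section

/-! ### Parametrizing the slit punctured disc and the square. -/

section PlanarCharts

open Set Filter

/-- The open unit square. -/
def unitSquare : Set (Fin 2 → ℝ) := {u | ∀ s, 0 < u s ∧ u s < 1}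

theorem isOpen_unitSquare : IsOpen unitSquare := by
  have h : unitSquare = Set.pi univ fun _ => Ioo (0 : ℝ) 1 := by
    ext u; simp [unitSquare]
  rw [h]
  exact isOpen_set_pi finite_univ fun _ _ => isOpen_Ioo

theorem slitPlane_log_im_mem {z : ℂ} (hz : z ∈ Complex.slitPlane) :
    -Real.pi < (Complex.log z).im ∧ (Complex.log z).im < Real.pi := by
  rw [Complex.log_im]
  exact ⟨Complex.neg_pi_lt_arg z,
    lt_of_le_of_ne (Complex.arg_le_pi z) (Complex.mem_slitPlane_iff_arg.1 hz).1⟩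

/-- The parametrization `exp (-l / x + i (2πy - π))` of a slit punctured disc by the unit square. -/
def cuspParam (l : ℝ) (u : Fin 2 → ℝ) : ℂ :=
  Complex.exp (((-l / u 0 : ℝ) : ℂ) + ((2 * Real.pi * u 1 - Real.pi : ℝ) : ℂ) * Complex.I)

/-- The inverse of `cuspParam`. -/
def cuspCoord (l : ℝ) (z : ℂ) : Fin 2 → ℝ :=
  ![-l / (Complex.log z).re, ((Complex.log z).im + Real.pi) / (2 * Real.pi)]

theorem norm_cuspParam (l : ℝ) (u : Fin 2 → ℝ) : ‖cuspParam l u‖ = Real.exp (-l / u 0) := by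
  simp [cuspParam, Complex.norm_exp]

theorem log_cuspParam (l : ℝ) {u : Fin 2 → ℝ} (hu : u ∈ unitSquare) :
    Complex.log (cuspParam l u) =
      ((-l / u 0 : ℝ) : ℂ) + ((2 * Real.pi * u 1 - Real.pi : ℝ) : ℂ) * Complex.I := by
  have h1 := hu 1
  have hpi := Real.pi_pos
  refine Complex.log_exp ?_ ?_
  · simp only [Complex.add_im, Complex.ofReal_im, Complex.im_ofReal_mul, Complex.I_im]
    nlinarith [h1.1]
  · simp only [Complex.add_im, Complex.ofReal_im, Complex.im_ofReal_mul, Complex.I_im]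
    nlinarith [h1.2]

/-- The principal logarithm is smooth off the slit, and its real part is below `-l < 0`, so the
division is harmless. -/
theorem contDiffOn_cuspCoord {l : ℝ} (hl : 0 < l) :
    ContDiffOn ℝ ∞ (cuspCoord l) {z | z ∈ Complex.slitPlane ∧ ‖z‖ < Real.exp (-l)} := by
  rintro z ⟨hz, hzl⟩
  refine ContDiffAt.contDiffWithinAt ?_
  have hz0 : 0 < ‖z‖ := norm_pos_iff.2 (Complex.slitPlane_ne_zero hz)
  have h1 : (Complex.log z).re < -l := by
    rw [Complex.log_re, ← Real.log_exp (-l)]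
    exact Real.log_lt_log hz0 hzl
  have hlog : ContDiffAt ℝ ∞ Complex.log z := (Complex.contDiffAt_log hz).restrict_scalars ℝ
  have hre : ContDiffAt ℝ ∞ (fun z => (Complex.log z).re) z :=
    Complex.reCLM.contDiff.contDiffAt.comp z hlog
  have him : ContDiffAt ℝ ∞ (fun z => (Complex.log z).im) z :=
    Complex.imCLM.contDiff.contDiffAt.comp z hlog
  refine contDiffAt_pi.2 fun s => ?_
  fin_cases s
  · exact contDiffAt_const.div hre (by linarith : (Complex.log z).re ≠ 0)
  · exact (him.add contDiffAt_const).div_const _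

theorem contDiffOn_cuspParam (l : ℝ) : ContDiffOn ℝ ∞ (cuspParam l) unitSquare := by
  intro u hu
  refine ContDiffAt.contDiffWithinAt ?_
  have h0 : ContDiffAt ℝ ∞ (fun u : Fin 2 → ℝ => -l / u 0) u :=
    contDiffAt_const.div (contDiff_apply ℝ ℝ 0).contDiffAt (hu 0).1.ne'
  have h1 : ContDiffAt ℝ ∞ (fun u : Fin 2 → ℝ => 2 * Real.pi * u 1 - Real.pi) u :=
    ((contDiff_const.mul (contDiff_apply ℝ ℝ 1)).sub contDiff_const).contDiffAt
  exact ((Complex.ofRealCLM.contDiff.contDiffAt.comp u h0).add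
    ((Complex.ofRealCLM.contDiff.contDiffAt.comp u h1).mul contDiffAt_const)).cexp

theorem contDiff_squareParam (r : ℝ) :
    ContDiff ℝ ∞ (fun u : Fin 2 → ℝ => (⟨r * (2 * u 0 - 1), r * (2 * u 1 - 1)⟩ : ℂ)) := by
  have hf : (fun u : Fin 2 → ℝ => (⟨r * (2 * u 0 - 1), r * (2 * u 1 - 1)⟩ : ℂ)) = fun u =>
      ((r * (2 * u 0 - 1) : ℝ) : ℂ) + ((r * (2 * u 1 - 1) : ℝ) : ℂ) * Complex.I :=
    funext fun u => Complex.mk_eq_add_mul_I _ _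
  rw [hf]
  have h : ∀ s : Fin 2, ContDiff ℝ ∞ (fun u : Fin 2 → ℝ => r * (2 * u s - 1)) := fun s =>
    contDiff_const.mul ((contDiff_const.mul (contDiff_apply ℝ ℝ s)).sub contDiff_const)
  exact (Complex.ofRealCLM.contDiff.comp (h 0)).add
    ((Complex.ofRealCLM.contDiff.comp (h 1)).mul contDiff_const)

/-- The slit punctured disc of radius `exp (-l)`, parametrized by the unit square. -/
def cuspChart {l : ℝ} (hl : 0 < l) : OpenPartialHomeomorph ℂ (Fin 2 → ℝ) where
  toFun := cuspCoord l
  invFun := cuspParam l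
  source := {z | z ∈ Complex.slitPlane ∧ ‖z‖ < Real.exp (-l)}
  target := unitSquare
  map_source' := by
    rintro z ⟨hz, hzl⟩
    have hpi := Real.pi_pos
    have hz0 : 0 < ‖z‖ := norm_pos_iff.2 (Complex.slitPlane_ne_zero hz)
    have h1 : (Complex.log z).re < -l := by
      rw [Complex.log_re, ← Real.log_exp (-l)]
      exact Real.log_lt_log hz0 hzl
    have h2 := slitPlane_log_im_mem hz
    intro s
    fin_cases s
    · change 0 < -l / (Complex.log z).re ∧ -l / (Complex.log z).re < 1
      refine ⟨div_pos_of_neg_of_neg (by linarith) (by linarith), ?_⟩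
      rw [div_lt_one_of_neg (by linarith)]
      exact h1
    · change 0 < ((Complex.log z).im + Real.pi) / (2 * Real.pi) ∧
        ((Complex.log z).im + Real.pi) / (2 * Real.pi) < 1
      refine ⟨div_pos (by linarith) (by linarith), ?_⟩
      rw [div_lt_one (by linarith)]
      linarith
  map_target' := by
    intro u hu
    have h0 := hu 0
    have h1 := hu 1
    have hpi := Real.pi_pos
    refine ⟨?_, ?_⟩
    · rw [Complex.mem_slitPlane_iff_arg]
      refine ⟨?_, Complex.exp_ne_zero _⟩
      rw [← Complex.log_im, log_cuspParam l hu]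
      simp only [Complex.add_im, Complex.ofReal_im, Complex.im_ofReal_mul, Complex.I_im]
      nlinarith [h1.2]
    · rw [norm_cuspParam, Real.exp_lt_exp, neg_div, neg_lt_neg_iff, lt_div_iff₀ h0.1]
      nlinarith [h0.2]
  left_inv' := by
    rintro z ⟨hz, hzl⟩
    have hpi := Real.pi_pos
    have hz0 : 0 < ‖z‖ := norm_pos_iff.2 (Complex.slitPlane_ne_zero hz)
    have h1 : (Complex.log z).re < -l := by
      rw [Complex.log_re, ← Real.log_exp (-l)]
      exact Real.log_lt_log hz0 hzl
    have e1 : -l / cuspCoord l z 0 = (Complex.log z).re := by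
      have : (Complex.log z).re ≠ 0 := by linarith
      simp only [cuspCoord, Matrix.cons_val_zero]
      field_simp
    have e2 : 2 * Real.pi * cuspCoord l z 1 - Real.pi = (Complex.log z).im := by
      change 2 * Real.pi * (((Complex.log z).im + Real.pi) / (2 * Real.pi)) - Real.pi = _
      field_simp
      ring
    rw [cuspParam, e1, e2, Complex.re_add_im, Complex.exp_log (Complex.slitPlane_ne_zero hz)]
  right_inv' := by
    intro u hu
    have h0 := hu 0
    have hpi := Real.pi_pos
    have e1 : (Complex.log (cuspParam l u)).re = -l / u 0 := by
      rw [log_cuspParam l hu]; simp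
    have e2 : (Complex.log (cuspParam l u)).im = 2 * Real.pi * u 1 - Real.pi := by
      rw [log_cuspParam l hu]; simp
    funext s
    fin_cases s
    · change -l / (Complex.log (cuspParam l u)).re = u 0
      rw [e1]
      have := h0.1.ne'
      field_simp
    · change ((Complex.log (cuspParam l u)).im + Real.pi) / (2 * Real.pi) = u 1
      rw [e2]
      field_simp
      ring
  open_source := Complex.isOpen_slitPlane.inter (isOpen_lt continuous_norm continuous_const)
  open_target := isOpen_unitSquare
  continuousOn_toFun := (contDiffOn_cuspCoord hl).continuousOn
  continuousOn_invFun := (contDiffOn_cuspParam l).continuousOn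

/-- The square of side `2r`, parametrized by the unit square. -/
def squareChart {r : ℝ} (hr : 0 < r) : OpenPartialHomeomorph ℂ (Fin 2 → ℝ) where
  toFun z := ![(z.re / r + 1) / 2, (z.im / r + 1) / 2]
  invFun u := ⟨r * (2 * u 0 - 1), r * (2 * u 1 - 1)⟩
  source := {z | (-r < z.re ∧ z.re < r) ∧ -r < z.im ∧ z.im < r}
  target := unitSquare
  map_source' := by
    rintro z ⟨⟨h1, h2⟩, h3, h4⟩
    have key : ∀ t : ℝ, -r < t → t < r → 0 < (t / r + 1) / 2 ∧ (t / r + 1) / 2 < 1 := by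
      intro t ht ht'
      have e1 : -1 < t / r := by rw [lt_div_iff₀ hr]; linarith
      have e2 : t / r < 1 := by rw [div_lt_one hr]; exact ht'
      constructor <;> linarith
    intro s
    fin_cases s
    · exact key _ h1 h2
    · exact key _ h3 h4
  map_target' := by
    intro u hu
    have h0 := hu 0
    have h1 := hu 1
    refine ⟨⟨?_, ?_⟩, ?_, ?_⟩ <;> simp only <;> nlinarith
  left_inv' := by
    rintro z -
    apply Complex.ext
    · change r * (2 * ((z.re / r + 1) / 2) - 1) = z.re
      field_simp; ring
    · change r * (2 * ((z.im / r + 1) / 2) - 1) = z.im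
      field_simp; ring
  right_inv' := by
    rintro u -
    funext s
    fin_cases s
    · change (r * (2 * u 0 - 1) / r + 1) / 2 = u 0
      field_simp; ring
    · change (r * (2 * u 1 - 1) / r + 1) / 2 = u 1
      field_simp; ring
  open_source := ((isOpen_lt continuous_const Complex.continuous_re).inter
    (isOpen_lt Complex.continuous_re continuous_const)).inter
    ((isOpen_lt continuous_const Complex.continuous_im).inter
    (isOpen_lt Complex.continuous_im continuous_const))
  open_target := isOpen_unitSquare
  continuousOn_toFun := by
    refine continuousOn_pi.2 fun s => ?_
    fin_cases s
    · exact (((Complex.continuous_re.div_const r).add continuous_const).div_const 2).continuousOn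
    · exact (((Complex.continuous_im.div_const r).add continuous_const).div_const 2).continuousOn
  continuousOn_invFun := (contDiff_squareParam r).continuous.continuousOn

theorem contDiffOn_cuspChart {l : ℝ} (hl : 0 < l) :
    ContDiffOn ℝ ∞ (cuspChart hl) (cuspChart hl).source := contDiffOn_cuspCoord hl

theorem contDiffOn_cuspChart_symm {l : ℝ} (hl : 0 < l) :
    ContDiffOn ℝ ∞ (cuspChart hl).symm (cuspChart hl).target := contDiffOn_cuspParam l

theorem contDiffOn_squareChart {r : ℝ} (hr : 0 < r) :
    ContDiffOn ℝ ∞ (squareChart hr) (squareChart hr).source := by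
  refine contDiffOn_pi.2 fun s => ?_
  fin_cases s
  · exact (((Complex.reCLM.contDiff.div_const r).add contDiff_const).div_const 2).contDiffOn
  · exact (((Complex.imCLM.contDiff.div_const r).add contDiff_const).div_const 2).contDiffOn

theorem contDiffOn_squareChart_symm {r : ℝ} (hr : 0 < r) :
    ContDiffOn ℝ ∞ (squareChart hr).symm (squareChart hr).target :=
  (contDiff_squareParam r).contDiffOn

theorem fderiv_apply_eq_deriv {E F : Type*} [NormedAddCommGroup E] [NormedSpace ℝ E]
    [NormedAddCommGroup F] [NormedSpace ℝ F] {f : E → F} {u : E} (hf : DifferentiableAt ℝ f u)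
    (e : E) {d : F} (hd : HasDerivAt (fun t : ℝ => f (u + t • e)) d 0) : fderiv ℝ f u e = d := by
  have h1 : HasDerivAt (fun t : ℝ => u + t • e) e 0 := by
    simpa using ((hasDerivAt_id (0 : ℝ)).smul_const e).const_add u
  have hf' : HasFDerivAt f (fderiv ℝ f u) (u + (0 : ℝ) • e) := by simpa using hf.hasFDerivAt
  exact (hf'.comp_hasDerivAt 0 h1).unique hd

theorem fderiv_cuspParam (l : ℝ) {u : Fin 2 → ℝ} (hu : u ∈ unitSquare) (e : Fin 2 → ℝ) :
    fderiv ℝ (cuspParam l) u e = cuspParam l u *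
      (((l / u 0 ^ 2 * e 0 : ℝ) : ℂ) + ((2 * Real.pi * e 1 : ℝ) : ℂ) * Complex.I) := by
  have h0 := (hu 0).1.ne'
  refine fderiv_apply_eq_deriv (((contDiffOn_cuspParam l).contDiffAt
    (isOpen_unitSquare.mem_nhds hu)).differentiableAt (by simp)) e ?_
  have hl : ∀ s, HasDerivAt (fun t : ℝ => u s + t * e s) (e s) 0 := fun s => by
    simpa using ((hasDerivAt_id (0 : ℝ)).mul_const (e s)).const_add (u s)
  have h1 : HasDerivAt (fun t : ℝ => -l / (u 0 + t * e 0)) (l / u 0 ^ 2 * e 0) 0 := by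
    have := (hasDerivAt_const (0 : ℝ) (-l)).div (hl 0) (by simpa using h0)
    refine this.congr_deriv ?_
    simp only [zero_mul, add_zero]
    ring
  have h2 : HasDerivAt (fun t : ℝ => 2 * Real.pi * (u 1 + t * e 1) - Real.pi)
      (2 * Real.pi * e 1) 0 := ((hl 1).const_mul _).sub_const _
  have h3 := (h1.ofReal_comp.add (h2.ofReal_comp.mul_const Complex.I)).cexp
  refine h3.congr_deriv ?_
  simp only [cuspParam, Pi.add_apply, zero_mul, add_zero]

theorem fderiv_squareParam {r : ℝ} (hr : 0 < r) (u : Fin 2 → ℝ) (e : Fin 2 → ℝ) :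
    fderiv ℝ (squareChart hr).symm u e =
      ((2 * r * e 0 : ℝ) : ℂ) + ((2 * r * e 1 : ℝ) : ℂ) * Complex.I := by
  have hf : ((squareChart hr).symm : (Fin 2 → ℝ) → ℂ) = fun u =>
      ((r * (2 * u 0 - 1) : ℝ) : ℂ) + ((r * (2 * u 1 - 1) : ℝ) : ℂ) * Complex.I :=
    funext fun u => Complex.mk_eq_add_mul_I _ _
  have hd : DifferentiableAt ℝ (squareChart hr).symm u :=
    (contDiff_squareParam r).differentiable (by simp) u
  rw [hf] at hd ⊢
  refine fderiv_apply_eq_deriv hd e ?_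
  have hl : ∀ s, HasDerivAt (fun t : ℝ => r * (2 * (u s + t * e s) - 1)) (2 * r * e s) 0 :=
    fun s => by
      have h1 : HasDerivAt (fun t : ℝ => u s + t * e s) (e s) 0 := by
        simpa using ((hasDerivAt_id (0 : ℝ)).mul_const (e s)).const_add (u s)
      exact (((h1.const_mul 2).sub_const 1).const_mul r).congr_deriv (by ring)
  exact (hl 0).ofReal_comp.add ((hl 1).ofReal_comp.mul_const Complex.I)

/-- In the coordinates of `cuspChart`, the Poincaré metric of the punctured disc. -/
theorem cuspMetric_bound {l : ℝ} (hl : 0 < l) {u : Fin 2 → ℝ} (hu : u ∈ unitSquare)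
    (e : Fin 2 → ℝ) :
    ‖fderiv ℝ (cuspChart hl).symm u e‖ ^ 2 /
        (‖(cuspChart hl).symm u‖ ^ 2 * Real.log ‖(cuspChart hl).symm u‖ ^ 2) =
      (u 0)⁻¹ ^ 2 * e 0 ^ 2 + (2 * Real.pi / l) ^ 2 * (u 0 ^ 2 * e 1 ^ 2) := by
  have h0 := (hu 0).1.ne'
  change ‖fderiv ℝ (cuspParam l) u e‖ ^ 2 / (‖cuspParam l u‖ ^ 2 *
    Real.log ‖cuspParam l u‖ ^ 2) = _
  -- The factor `‖cuspParam l u‖²` cancels: the Poincaré metric sees only the logarithmic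
  -- derivative, here `l / x²` and `2π` in the two directions, divided by `log |z| = -l / x`.
  have h1 : ‖cuspParam l u‖ ≠ 0 := by rw [norm_cuspParam]; positivity
  rw [fderiv_cuspParam l hu, norm_mul, mul_pow, mul_div_mul_left _ _ (pow_ne_zero 2 h1),
    norm_cuspParam, Real.log_exp, Complex.sq_norm, Complex.normSq_add_mul_I]
  field_simp

theorem squareMetric_eq {r : ℝ} (hr : 0 < r) (u e : Fin 2 → ℝ) :
    ‖fderiv ℝ (squareChart hr).symm u e‖ ^ 2 = (2 * r) ^ 2 * (e 0 ^ 2 + e 1 ^ 2) := by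
  rw [fderiv_squareParam, Complex.sq_norm, Complex.normSq_add_mul_I]
  ring

end PlanarCharts

end

end PoincareType

open scoped ContDiff Manifold Topology
open Bundle MeasureTheory

namespace PoincareType

noncomputable section

/-! ### Determinant bounds from quadratic form bounds. -/

section Determinant

open Matrix

/-- A symmetric matrix comparable to the square of a diagonal matrix of determinant one has
determinant bounded above and below. -/
theorem det_mem_of_bounds {n : ℕ} {G : Matrix (Fin n) (Fin n) ℝ} (hG : G.IsHermitian)
    {d : Fin n → ℝ} (hd : ∀ k, 0 < d k) (hprod : ∏ k, d k = 1) {c C : ℝ} (hc : 0 < c)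
    (h : ∀ v : Fin n → ℝ, c * ∑ k, (d k * v k) ^ 2 ≤ v ⬝ᵥ G *ᵥ v ∧
      v ⬝ᵥ G *ᵥ v ≤ C * ∑ k, (d k * v k) ^ 2) : c ^ n ≤ G.det ∧ G.det ≤ C ^ n := by
  -- Conjugation by the inverse of the diagonal matrix keeps the determinant, since `∏ d k = 1`, and
  -- turns the hypothesis into bounds of the quadratic form by `c` and `C` times the Euclidean one,
  -- hence into bounds of the eigenvalues.
  set D : Matrix (Fin n) (Fin n) ℝ := Matrix.diagonal fun k => (d k)⁻¹ with hD
  have hDt : Dᴴ = D := by simp [hD]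
  have hH : (D * G * D).IsHermitian := by
    rw [Matrix.IsHermitian, Matrix.conjTranspose_mul, Matrix.conjTranspose_mul, hDt, hG.eq,
      Matrix.mul_assoc]
  have hdet : (D * G * D).det = G.det := by
    have : D.det = 1 := by rw [hD, Matrix.det_diagonal, Finset.prod_inv_distrib, hprod, inv_one]
    rw [Matrix.det_mul, Matrix.det_mul, this]; ring
  have hev : ∀ i, c ≤ hH.eigenvalues i ∧ hH.eigenvalues i ≤ C := by
    intro i
    set v : Fin n → ℝ := ⇑(hH.eigenvectorBasis i) with hv
    have h1 : ∑ k, v k ^ 2 = 1 := by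
      have := hH.eigenvectorBasis.norm_eq_one i
      rw [EuclideanSpace.norm_eq, Real.sqrt_eq_one] at this
      simpa using this
    have h2 : v ⬝ᵥ (D * G * D) *ᵥ v = hH.eigenvalues i := by
      rw [hv, hH.mulVec_eigenvectorBasis, dotProduct_smul, ← hv]
      have : v ⬝ᵥ v = 1 := by rw [← h1]; exact Finset.sum_congr rfl fun k _ => (sq _).symm
      rw [this]; simp
    have h3 : v ⬝ᵥ (D * G * D) *ᵥ v = (D *ᵥ v) ⬝ᵥ G *ᵥ (D *ᵥ v) := by
      rw [← Matrix.mulVec_mulVec, ← Matrix.mulVec_mulVec, Matrix.dotProduct_mulVec]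
      congr 1
      funext k
      simp [hD, Matrix.vecMul_diagonal, Matrix.mulVec_diagonal, mul_comm]
    have h4 : ∑ k, (d k * (D *ᵥ v) k) ^ 2 = 1 := by
      rw [← h1]
      refine Finset.sum_congr rfl fun k _ => ?_
      rw [hD, Matrix.mulVec_diagonal, ← mul_assoc, mul_inv_cancel₀ (hd k).ne', one_mul]
    have h5 := h (D *ᵥ v)
    rw [h4, ← h3, h2, mul_one, mul_one] at h5
    exact h5
  have hpr : G.det = ∏ i, hH.eigenvalues i := by
    rw [← hdet, hH.det_eq_prod_eigenvalues]; rfl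
  rw [hpr]
  constructor
  · calc c ^ n = ∏ _i : Fin n, c := by simp
      _ ≤ _ := Finset.prod_le_prod (fun _ _ => hc.le) fun i _ => (hev i).1
  · calc _ ≤ ∏ _i : Fin n, C :=
          Finset.prod_le_prod (fun i _ => hc.le.trans (hev i).1) fun i _ => (hev i).2
      _ = _ := by simp

end Determinant

/-! ### Cube charts from product coordinates. -/

section CubeCharts

open Set Filter

/-- The weights `d` having product one, the volume density is bounded above and below although the
individual weights may degenerate. The condition `x_k d_k ≤ 1` is the bound by `1 / x_k` on the
coordinate vectors. -/
theorem isCubeChart_of_bounds {E : Type*} [NormedAddCommGroup E] [NormedSpace ℝ E]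
    {M : Type*} [TopologicalSpace M] [ChartedSpace E M] [IsManifold 𝓘(ℝ, E) ∞ M]
    [FiniteDimensional ℝ E] {g : SmoothMetric E M} {φ : OpenPartialHomeomorph M E}
    (hφ : φ ∈ IsManifold.maximalAtlas 𝓘(ℝ, E) ∞ M) (ht : φ.target = basisCube E)
    {d : E → Fin (Module.finrank ℝ E) → ℝ} (hd : ∀ y ∈ φ.target, ∀ k, 0 < d y k)
    (hprod : ∀ y ∈ φ.target, ∏ k, d y k = 1)
    (hle : ∀ y ∈ φ.target, ∀ k, (Module.finBasis ℝ E).repr y k * d y k ≤ 1)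
    {c C : ℝ} (hc : 0 < c) (hC : 0 < C) (h : ∀ y ∈ φ.target, ∀ e : E,
      c * ∑ k, (d y k * (Module.finBasis ℝ E).repr e k) ^ 2 ≤
        metricAt g (φ.symm y) (dChartSymm φ y e) (dChartSymm φ y e) ∧
      metricAt g (φ.symm y) (dChartSymm φ y e) (dChartSymm φ y e) ≤
        C * ∑ k, (d y k * (Module.finBasis ℝ E).repr e k) ^ 2) : IsCubeChart g φ := by
  set b := Module.finBasis ℝ E with hb
  refine ⟨hφ, ht, ⟨Real.sqrt (c ^ Module.finrank ℝ E), Real.sqrt (C ^ Module.finrank ℝ E),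
    by positivity, fun y hy => ?_⟩, ⟨C, fun y hy k => ?_⟩⟩
  · set B := modelBilin g (φ.symm y) (dChartSymm φ y) with hB
    have hsymm : (LinearMap.BilinForm.toMatrix b B).IsHermitian := by
      ext i j
      rw [Matrix.conjTranspose_apply, LinearMap.BilinForm.toMatrix_apply,
        LinearMap.BilinForm.toMatrix_apply]
      exact g.symm _ _ _
    have hdet := det_mem_of_bounds hsymm (hd y hy) (hprod y hy) hc (C := C) (fun v => by
      have h1 := h y hy (b.equivFun.symm v)
      have h2 := LinearMap.BilinForm.dotProduct_toMatrix_mulVec b B v v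
      rw [h2]
      have h3 : ∀ k, b.repr (b.equivFun.symm v) k = v k := fun k => by
        rw [← b.equivFun_apply, LinearEquiv.apply_symm_apply]
      simp only [h3] at h1
      exact h1)
    rw [chartDet_eq]
    exact ⟨Real.sqrt_le_sqrt hdet.1, Real.sqrt_le_sqrt hdet.2⟩
  · have hy' : ∀ k, 0 < b.repr y k ∧ b.repr y k < 1 := by
      rw [ht] at hy; exact hy
    have h1 := (h y hy (b k)).2
    have h2 : ∑ k', (d y k' * b.repr (b k) k') ^ 2 = d y k ^ 2 := by
      rw [Finset.sum_eq_single k]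
      · simp
      · intro k' _ hk'
        simp [Module.Basis.repr_self, hk'.symm]
      · simp
    rw [h2] at h1
    have h3 : (b.repr y k * d y k) ^ 2 ≤ 1 :=
      pow_le_one₀ (mul_nonneg (hy' k).1.le (hd y hy k).le) (hle y hy k)
    calc _ ≤ b.repr y k ^ 2 * (C * d y k ^ 2) := mul_le_mul_of_nonneg_left h1 (sq_nonneg _)
      _ = C * (b.repr y k * d y k) ^ 2 := by ring
      _ ≤ C := by nlinarith

variable {m : ℕ}

theorem finrank_real_Cn (m : ℕ) : Module.finrank ℝ (Cn m) = m * 2 := by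
  simp [Module.finrank_pi_fintype, Complex.finrank_real_complex]

variable (m) in
/-- A bijection of the fixed real basis of `ℂᵐ` with pairs of indices. -/
def pairIndex : Fin (Module.finrank ℝ (Cn m)) ≃ Fin m × Fin 2 :=
  Fintype.equivOfCardEq (by
    rw [Fintype.card_fin, Fintype.card_prod, Fintype.card_fin, Fintype.card_fin, finrank_real_Cn])

variable (m) in
/-- The coordinates in the fixed real basis of `ℂᵐ`, grouped in pairs. -/
def pairCoord : Cn m ≃L[ℝ] (Fin m → Fin 2 → ℝ) :=
  (((Module.finBasis ℝ (Cn m)).reindex (pairIndex m)).equivFun.trans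
    (LinearEquiv.curry ℝ ℝ (Fin m) (Fin 2))).toContinuousLinearEquiv

theorem pairCoord_apply (e : Cn m) (i : Fin m) (s : Fin 2) :
    pairCoord m e i s = (Module.finBasis ℝ (Cn m)).repr e ((pairIndex m).symm (i, s)) := by
  change ((Module.finBasis ℝ (Cn m)).reindex (pairIndex m)).equivFun e (i, s) = _
  rw [Module.Basis.equivFun_apply, Module.Basis.repr_reindex_apply]

theorem repr_eq_pairCoord (e : Cn m) (k) : (Module.finBasis ℝ (Cn m)).repr e k =
    pairCoord m e (pairIndex m k).1 (pairIndex m k).2 := by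
  rw [pairCoord_apply]; simp

theorem mem_basisCube_iff {y : Cn m} : y ∈ basisCube (Cn m) ↔ ∀ i, pairCoord m y i ∈ unitSquare := by
  constructor
  · intro h i s
    rw [pairCoord_apply]
    exact h _
  · intro h k
    rw [repr_eq_pairCoord]
    exact h _ _

theorem sum_finrank_eq (f : Fin m → Fin 2 → ℝ) :
    ∑ k, f (pairIndex m k).1 (pairIndex m k).2 = ∑ i, (f i 0 + f i 1) := by
  rw [Equiv.sum_comp (pairIndex m) (fun q => f q.1 q.2), Fintype.sum_prod_type]
  exact Finset.sum_congr rfl fun i _ => Fin.sum_univ_two _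

theorem prod_finrank_eq (f : Fin m → Fin 2 → ℝ) :
    ∏ k, f (pairIndex m k).1 (pairIndex m k).2 = ∏ i, (f i 0 * f i 1) := by
  rw [Equiv.prod_comp (pairIndex m) (fun q => f q.1 q.2), Fintype.prod_prod_type]
  exact Finset.prod_congr rfl fun i _ => Fin.prod_univ_two _

variable (S : Set (Fin m)) {l r : ℝ} (hl : 0 < l) (hr : 0 < r)

open Classical in
/-- The planar chart in the `i`-th coordinate. -/
def coordChart (i : Fin m) : OpenPartialHomeomorph ℂ (Fin 2 → ℝ) :=
  if i ∈ S then cuspChart hl else squareChart hr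

theorem coordChart_target (i : Fin m) : (coordChart S hl hr i).target = unitSquare := by
  unfold coordChart
  split_ifs <;> rfl

theorem contDiffOn_coordChart (i : Fin m) :
    ContDiffOn ℝ ∞ (coordChart S hl hr i) (coordChart S hl hr i).source := by
  unfold coordChart
  split_ifs
  · exact contDiffOn_cuspChart hl
  · exact contDiffOn_squareChart hr

theorem contDiffOn_coordChart_symm (i : Fin m) :
    ContDiffOn ℝ ∞ (coordChart S hl hr i).symm (coordChart S hl hr i).target := by
  unfold coordChart
  split_ifs
  · exact contDiffOn_cuspChart_symm hl
  · exact contDiffOn_squareChart_symm hr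

/-- The product of slit punctured discs in the coordinates in `S` and squares in the other ones,
mapped to the unit cube. -/
def boxChart : OpenPartialHomeomorph (Cn m) (Cn m) :=
  (OpenPartialHomeomorph.pi (coordChart S hl hr)).transHomeomorph (pairCoord m).symm.toHomeomorph

theorem mem_boxChart_source {z : Cn m} :
    z ∈ (boxChart S hl hr).source ↔ ∀ i, z i ∈ (coordChart S hl hr i).source := by
  simp [boxChart]

theorem boxChart_target : (boxChart S hl hr).target = basisCube (Cn m) := by
  ext y
  rw [mem_basisCube_iff]
  simp [boxChart, coordChart_target]

theorem boxChart_symm_apply (y : Cn m) (i : Fin m) :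
    (boxChart S hl hr).symm y i = (coordChart S hl hr i).symm (pairCoord m y i) := rfl

theorem contDiffOn_boxChart : ContDiffOn ℝ ∞ (boxChart S hl hr) (boxChart S hl hr).source := by
  change ContDiffOn ℝ ∞ ((pairCoord m).symm ∘ fun (z : Cn m) i => coordChart S hl hr i (z i)) _
  refine (pairCoord m).symm.contDiff.comp_contDiffOn (contDiffOn_pi.2 fun i => ?_)
  exact (contDiffOn_coordChart S hl hr i).comp (contDiff_apply ℝ ℂ i).contDiffOn
    fun z hz => (mem_boxChart_source S hl hr).1 hz i

theorem pairCoord_mem_target {y : Cn m} (hy : y ∈ (boxChart S hl hr).target) (i : Fin m) :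
    pairCoord m y i ∈ (coordChart S hl hr i).target := by
  rw [boxChart_target] at hy
  rw [coordChart_target]
  exact mem_basisCube_iff.1 hy i

theorem contDiffOn_boxChart_symm :
    ContDiffOn ℝ ∞ (boxChart S hl hr).symm (boxChart S hl hr).target := by
  refine contDiffOn_pi.2 fun i => ?_
  exact (contDiffOn_coordChart_symm S hl hr i).comp
    ((contDiff_apply ℝ (Fin 2 → ℝ) i).comp (pairCoord m).contDiff).contDiffOn
    fun y hy => pairCoord_mem_target S hl hr hy i

theorem fderiv_boxChart_symm {y : Cn m} (hy : y ∈ (boxChart S hl hr).target) (e : Cn m) (i : Fin m) :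
    fderiv ℝ (boxChart S hl hr).symm y e i =
      fderiv ℝ (coordChart S hl hr i).symm (pairCoord m y i) (pairCoord m e i) := by
  have h1 : DifferentiableAt ℝ (boxChart S hl hr).symm y :=
    ((contDiffOn_boxChart_symm S hl hr).contDiffAt
      ((boxChart S hl hr).open_target.mem_nhds hy)).differentiableAt (by simp)
  have h2 : HasFDerivAt (coordChart S hl hr i).symm
      (fderiv ℝ (coordChart S hl hr i).symm (pairCoord m y i)) (pairCoord m y i) :=
    (((contDiffOn_coordChart_symm S hl hr i).contDiffAt
      ((coordChart S hl hr i).open_target.mem_nhds (pairCoord_mem_target S hl hr hy i))).differentiableAt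
        (by simp)).hasFDerivAt
  have h3 : HasFDerivAt (fun y : Cn m => pairCoord m y i)
      ((ContinuousLinearMap.proj i).comp (pairCoord m : Cn m →L[ℝ] (Fin m → Fin 2 → ℝ))) y :=
    ((ContinuousLinearMap.proj (R := ℝ) (φ := fun _ : Fin m => Fin 2 → ℝ) i).comp
      (pairCoord m : Cn m →L[ℝ] (Fin m → Fin 2 → ℝ))).hasFDerivAt
  have h4 := hasFDerivAt_pi'.1 h1.hasFDerivAt i
  exact congrArg (fun T : Cn m →L[ℝ] ℂ => T e) (h4.unique (h2.comp y h3))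

open Classical in
/-- The factors by which the model metric differs from the Euclidean one in the unit cube. -/
def boxWeight (y : Cn m) (i : Fin m) (s : Fin 2) : ℝ :=
  if i ∈ S then ![(pairCoord m y i 0)⁻¹, pairCoord m y i 0] s else 1

/-- The model metric in the coordinates of the unit cube. -/
theorem sum_coordSq_boxChart : ∃ c C : ℝ, 0 < c ∧ 0 < C ∧ ∀ y ∈ (boxChart S hl hr).target,
    ∀ e : Cn m,
      c * ∑ i, ∑ s, (boxWeight S y i s * pairCoord m e i s) ^ 2 ≤
        ∑ i, coordSq S i ((boxChart S hl hr).symm y) (fderiv ℝ (boxChart S hl hr).symm y e) ∧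
      ∑ i, coordSq S i ((boxChart S hl hr).symm y) (fderiv ℝ (boxChart S hl hr).symm y e) ≤
        C * ∑ i, ∑ s, (boxWeight S y i s * pairCoord m e i s) ^ 2 := by
  -- The model metric has coefficients 1 (radial direction) and `α` (angular direction) in a cusp,
  -- and `β` in a square, relative to the weights; `c` and `C` are their extremes.
  set α := (2 * Real.pi / l) ^ 2 with hα
  set β := (2 * r) ^ 2 with hβ
  have hα0 : 0 < α := by positivity
  have hβ0 : 0 < β := by positivity
  set c := min (min 1 α) β with hcdef
  set C := max (max 1 α) β with hCdef
  have c1 : c ≤ 1 := (min_le_left _ _).trans (min_le_left _ _)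
  have cα : c ≤ α := (min_le_left _ _).trans (min_le_right _ _)
  have cβ : c ≤ β := min_le_right _ _
  have C1 : 1 ≤ C := (le_max_left _ _).trans (le_max_left _ _)
  have Cα : α ≤ C := (le_max_right _ _).trans (le_max_left _ _)
  have Cβ : β ≤ C := le_max_right _ _
  have key : ∀ y ∈ (boxChart S hl hr).target, ∀ (e : Cn m) (i : Fin m),
      c * ∑ s, (boxWeight S y i s * pairCoord m e i s) ^ 2 ≤
        coordSq S i ((boxChart S hl hr).symm y) (fderiv ℝ (boxChart S hl hr).symm y e) ∧
      coordSq S i ((boxChart S hl hr).symm y) (fderiv ℝ (boxChart S hl hr).symm y e) ≤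
        C * ∑ s, (boxWeight S y i s * pairCoord m e i s) ^ 2 := by
    intro y hy e i
    have hu : pairCoord m y i ∈ unitSquare := by
      rw [← coordChart_target S hl hr i]; exact pairCoord_mem_target S hl hr hy i
    rw [Fin.sum_univ_two]
    by_cases hi : i ∈ S
    · have h1 : coordChart S hl hr i = cuspChart hl := if_pos hi
      have h2 := cuspMetric_bound hl hu (pairCoord m e i)
      have w0 : boxWeight S y i 0 = (pairCoord m y i 0)⁻¹ := by simp [boxWeight, hi]
      have w1 : boxWeight S y i 1 = pairCoord m y i 0 := by simp [boxWeight, hi]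
      rw [coordSq_of_mem hi, cuspSq, fderiv_boxChart_symm S hl hr hy, boxChart_symm_apply, h1, h2,
        w0, w1, mul_pow, mul_pow]
      have n0 : 0 ≤ (pairCoord m y i 0)⁻¹ ^ 2 * pairCoord m e i 0 ^ 2 := by positivity
      have n1 : 0 ≤ pairCoord m y i 0 ^ 2 * pairCoord m e i 1 ^ 2 := by positivity
      constructor
      · nlinarith [mul_le_mul_of_nonneg_right c1 n0, mul_le_mul_of_nonneg_right cα n1]
      · nlinarith [mul_le_mul_of_nonneg_right C1 n0, mul_le_mul_of_nonneg_right Cα n1]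
    · have h1 : coordChart S hl hr i = squareChart hr := if_neg hi
      have h2 := squareMetric_eq hr (pairCoord m y i) (pairCoord m e i)
      have w : ∀ s, boxWeight S y i s = 1 := fun s => if_neg hi
      rw [coordSq_of_notMem hi, fderiv_boxChart_symm S hl hr hy, h1, h2, w, w, one_mul, one_mul]
      have n0 : 0 ≤ pairCoord m e i 0 ^ 2 + pairCoord m e i 1 ^ 2 := by positivity
      exact ⟨mul_le_mul_of_nonneg_right cβ n0, mul_le_mul_of_nonneg_right Cβ n0⟩
  refine ⟨c, C, lt_min (lt_min one_pos hα0) hβ0, one_pos.trans_le C1, fun y hy e => ?_⟩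
  rw [Finset.mul_sum, Finset.mul_sum]
  exact ⟨Finset.sum_le_sum fun i _ => (key y hy e i).1,
    Finset.sum_le_sum fun i _ => (key y hy e i).2⟩

/-- A chart in which the metric is comparable to the model metric gives a cube chart. -/
theorem isCubeChart_trans_boxChart {M : Type*} [TopologicalSpace M] [ChartedSpace (Cn m) M]
    [IsManifold 𝓘(ℝ, Cn m) ∞ M] (g : SmoothMetric (Cn m) M) {ψ : OpenPartialHomeomorph M (Cn m)}
    (hψ : ψ ∈ IsManifold.maximalAtlas 𝓘(ℝ, Cn m) ∞ M) (hsub : (boxChart S hl hr).source ⊆ ψ.target)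
    (hb : ∃ c C : ℝ, 0 < c ∧ 0 < C ∧ ∀ z ∈ (boxChart S hl hr).source, ∀ V : Cn m,
      c * ∑ i, coordSq S i z V ≤ metricAt g (ψ.symm z) (dChartSymm ψ z V) (dChartSymm ψ z V) ∧
      metricAt g (ψ.symm z) (dChartSymm ψ z V) (dChartSymm ψ z V) ≤ C * ∑ i, coordSq S i z V) :
    IsCubeChart g (ψ ≫ₕ boxChart S hl hr) := by
  obtain ⟨c, C, hc, hC, hb⟩ := hb
  obtain ⟨c', C', hc', hC', hbox⟩ := sum_coordSq_boxChart S hl hr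
  set R := boxChart S hl hr with hR
  have hmem : ψ ≫ₕ R ∈ IsManifold.maximalAtlas 𝓘(ℝ, Cn m) ∞ M := by
    refine OpenPartialHomeomorph.mem_maximalAtlas_of_contMDiffOn (I := 𝓘(ℝ, Cn m)) (n := ∞) _ ?_ ?_
    · rw [OpenPartialHomeomorph.coe_trans, OpenPartialHomeomorph.trans_source]
      exact (contMDiffOn_iff_contDiffOn.2 (contDiffOn_boxChart S hl hr)).comp
        ((contMDiffOn_of_mem_maximalAtlas hψ).mono inter_subset_left) inter_subset_right
    · rw [OpenPartialHomeomorph.coe_trans_symm, OpenPartialHomeomorph.trans_target]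
      exact (contMDiffOn_symm_of_mem_maximalAtlas hψ).comp
        ((contMDiffOn_iff_contDiffOn.2 (contDiffOn_boxChart_symm S hl hr)).mono inter_subset_left)
        inter_subset_right
  have htR : (ψ ≫ₕ R).target = R.target := by
    rw [OpenPartialHomeomorph.trans_target]
    exact inter_eq_left.2 fun y hy => hsub (R.map_target hy)
  have ht : (ψ ≫ₕ R).target = basisCube (Cn m) := htR.trans (boxChart_target S hl hr)
  have hpos : ∀ y ∈ (ψ ≫ₕ R).target, ∀ i, pairCoord m y i ∈ unitSquare := fun y hy => by
    rw [ht] at hy; exact mem_basisCube_iff.1 hy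
  have hdφ : ∀ y ∈ R.target, ∀ e, (dChartSymm (ψ ≫ₕ R) y : Cn m →L[ℝ] Cn m) e =
      (dChartSymm ψ (R.symm y) : Cn m →L[ℝ] Cn m) (fderiv ℝ R.symm y e) := by
    intro y hy e
    have h1 := (mdifferentiableAt_chart_symm hψ (hsub (R.map_target hy))).hasMFDerivAt
    have h2 : HasFDerivAt R.symm (fderiv ℝ R.symm y) y :=
      (((contDiffOn_boxChart_symm S hl hr).contDiffAt
        (R.open_target.mem_nhds hy)).differentiableAt (by simp)).hasFDerivAt
    have h3 := (h1.comp y h2.hasMFDerivAt).mfderiv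
    exact congrArg (fun T : Cn m →L[ℝ] Cn m => T e) h3
  have hsum : ∀ (y e : Cn m), ∑ k, (boxWeight S y (pairIndex m k).1 (pairIndex m k).2 *
      (Module.finBasis ℝ (Cn m)).repr e k) ^ 2 =
        ∑ i, ∑ s, (boxWeight S y i s * pairCoord m e i s) ^ 2 := by
    intro y e
    simp only [repr_eq_pairCoord]
    rw [sum_finrank_eq fun i s => (boxWeight S y i s * pairCoord m e i s) ^ 2]
    simp only [Fin.sum_univ_two]
  -- In a cusp with square coordinates `(x, y)` the weights are `1/x` and `x`: their product is 1,
  -- `x * (1/x) = 1` and `y * x ≤ 1`. Elsewhere they are 1.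
  refine isCubeChart_of_bounds (d := fun y k => boxWeight S y (pairIndex m k).1 (pairIndex m k).2)
    (c := c * c') (C := C * C') hmem ht (fun y hy k => ?_) (fun y hy => ?_) (fun y hy k => ?_)
    (by positivity) (by positivity) fun y hy e => ?_
  · have h0 := (hpos y hy (pairIndex m k).1 0).1
    simp only [boxWeight]
    split_ifs
    · generalize (pairIndex m k).2 = s
      fin_cases s
      · exact inv_pos.2 h0
      · exact h0
    · exact one_pos
  · rw [prod_finrank_eq fun i s => boxWeight S y i s]
    refine Finset.prod_eq_one fun i _ => ?_
    have h0 := (hpos y hy i 0).1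
    by_cases hi : i ∈ S
    · simp [boxWeight, hi, h0.ne']
    · simp [boxWeight, hi]
  · rw [repr_eq_pairCoord]
    set i := (pairIndex m k).1
    have h0 := hpos y hy i
    by_cases hi : i ∈ S
    · simp only [boxWeight, hi, if_true]
      generalize (pairIndex m k).2 = s
      fin_cases s
      · exact (mul_inv_cancel₀ (h0 0).1.ne').le
      · exact mul_le_one₀ (h0 1).2.le (h0 0).1.le (h0 0).2.le
    · simp only [boxWeight, hi, if_false, mul_one]
      exact (h0 _).2.le
  · rw [htR] at hy
    have h1 := hb (R.symm y) (R.map_target hy) (fderiv ℝ R.symm y e)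
    have h2 := hbox y hy e
    have h3 : metricAt g ((ψ ≫ₕ R).symm y) (dChartSymm (ψ ≫ₕ R) y e) (dChartSymm (ψ ≫ₕ R) y e) =
        metricAt g (ψ.symm (R.symm y)) (dChartSymm ψ (R.symm y) (fderiv ℝ R.symm y e))
          (dChartSymm ψ (R.symm y) (fderiv ℝ R.symm y e)) :=
      congrArg (fun w : Cn m => metricAt g (ψ.symm (R.symm y)) w w) (hdφ y hy e)
    rw [h3, hsum, mul_assoc, mul_assoc]
    exact ⟨(mul_le_mul_of_nonneg_left h2.1 hc.le).trans h1.1,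
      h1.2.trans (mul_le_mul_of_nonneg_left h2.2 hC.le)⟩

end CubeCharts

end

end PoincareType

open scoped ContDiff Manifold Topology
open Bundle MeasureTheory

namespace PoincareType

noncomputable section

/-! ### Covering neighbourhoods of points of `X` by cube charts. -/

section Gluing

open Set Filter

theorem lebesgue_basisCube_ne_zero {E : Type*} [NormedAddCommGroup E] [NormedSpace ℝ E]
    [FiniteDimensional ℝ E] [MeasurableSpace E] [BorelSpace E] : lebesgue E (basisCube E) ≠ 0 := by
  rw [basisCube_eq, measurePreserving_basisCoord.measure_preimage
    (isOpen_unitCube _).measurableSet.nullMeasurableSet, unitCube, volume_pi_pi]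
  simp

/-- Serves to show that overlaps in the chaining argument have positive volume. -/
theorem IsCubeChart.riemannianVolume_source_ne_zero {E : Type*} [NormedAddCommGroup E]
    [NormedSpace ℝ E] {M : Type*} [TopologicalSpace M] [ChartedSpace E M]
    [IsManifold 𝓘(ℝ, E) ∞ M] [FiniteDimensional ℝ E] [MeasurableSpace E] [BorelSpace E]
    [MeasurableSpace M] [BorelSpace M] [SecondCountableTopology M] {g : SmoothMetric E M}
    {φ : OpenPartialHomeomorph M E} (hφ : IsCubeChart g φ) :
    riemannianVolume g φ.source ≠ 0 := by
  obtain ⟨c, C, hc, hdet⟩ := hφ.exists_det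
  rw [riemannianVolume_apply g hφ.mem_maximalAtlas φ.open_source.measurableSet Subset.rfl,
    chartVolume_apply g φ φ.open_source.measurableSet]
  have h1 : φ.target ∩ φ.symm ⁻¹' φ.source = φ.target :=
    inter_eq_left.2 fun y hy => φ.map_target hy
  rw [h1]
  have h2 : ∫⁻ _ in φ.target, ENNReal.ofReal c ∂(lebesgue E) ≤
      ∫⁻ y in φ.target, ENNReal.ofReal (Real.sqrt (chartDet g φ y)) ∂(lebesgue E) :=
    setLIntegral_mono' φ.open_target.measurableSet
      fun y hy => ENNReal.ofReal_le_ofReal (hdet y hy).1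
  rw [setLIntegral_const, hφ.target_eq] at h2
  rw [hφ.target_eq]
  intro h0
  rw [h0, nonpos_iff_eq_zero, mul_eq_zero] at h2
  rcases h2 with h2 | h2
  · exact (ENNReal.ofReal_pos.2 hc).ne' h2
  · exact lebesgue_basisCube_ne_zero h2

/-- The restriction to an open subset of a chart in the maximal atlas. -/
theorem subtypeRestr_mem_maximalAtlas {H M : Type*} [TopologicalSpace H] [TopologicalSpace M]
    [ChartedSpace H M] (G : StructureGroupoid H) [HasGroupoid M G] [ClosedUnderRestriction G]
    {e : OpenPartialHomeomorph M H} (he : e ∈ G.maximalAtlas M) {s : TopologicalSpace.Opens M}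
    (hs : Nonempty s) : e.subtypeRestr hs ∈ G.maximalAtlas s := by
  have key : ∀ f ∈ G.maximalAtlas M, ∀ f' ∈ G.maximalAtlas M,
      (f.subtypeRestr hs).symm ≫ₕ f'.subtypeRestr hs ∈ G := fun f hf f' hf' =>
    G.mem_of_eqOnSource (closedUnderRestriction' (G.compatible_of_mem_maximalAtlas hf hf')
      (f.isOpen_inter_preimage_symm s.2)) (f.subtypeRestr_symm_trans_subtypeRestr hs f')
  intro e' he'
  obtain ⟨x, rfl⟩ := TopologicalSpace.Opens.chart_eq hs he'
  exact ⟨key _ he _ (G.chart_mem_maximalAtlas _), key _ (G.chart_mem_maximalAtlas _) _ he⟩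

variable {m : ℕ} {X : Type*} [TopologicalSpace X] [ChartedSpace (Cn m) X]
  [IsManifold 𝓘(ℂ, Cn m) ω X]

/-- Proper real subspaces are null. These contain the slits along the negative real axes as well as
the divisor `z_i = 0`. -/
theorem lebesgue_iUnion_im_eq_zero (m : ℕ) :
    lebesgue (Cn m) (⋃ i, {z : Cn m | (z i).im = 0}) = 0 := by
  refine measure_iUnion_null fun i => ?_
  let ℓ : Cn m →ₗ[ℝ] ℝ := Complex.imLm.comp (LinearMap.proj i)
  have h1 : {z : Cn m | (z i).im = 0} = (LinearMap.ker ℓ : Set (Cn m)) := by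
    ext z; simp [ℓ]
  rw [h1]
  refine Measure.addHaar_submodule _ _ fun htop => ?_
  have h2 : (Pi.single i Complex.I : Cn m) ∈ LinearMap.ker ℓ := by rw [htop]; trivial
  simp [ℓ] at h2

theorem norm_lt_of_mem_square {r : ℝ} {w : ℂ} (h : (-r < w.re ∧ w.re < r) ∧ -r < w.im ∧ w.im < r) :
    ‖w‖ < 2 * r := by
  have h1 := Complex.norm_le_abs_re_add_abs_im w
  have h2 := abs_lt.2 h.1
  have h3 := abs_lt.2 h.2
  linarith

variable {N : ℕ} {L : Fin N → X → Type*} [∀ j x, AddCommGroup (L j x)] [∀ j x, Module ℂ (L j x)]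
  [∀ j x, TopologicalSpace (L j x)] [∀ j, TopologicalSpace (TotalSpace ℂ (L j))]
  [∀ j, FiberBundle ℂ (L j)] [∀ j, VectorBundle ℂ ℂ (L j)]
  [∀ j, ContMDiffVectorBundle ω ℂ (L j) 𝓘(ℂ, Cn m)]
  {σ : ∀ j, Cₛ^ω⟮𝓘(ℂ, Cn m); ℂ, L j⟯}

theorem IsAdapted.mem_complement {p : X} {Z : OpenPartialHomeomorph X (Cn m)}
    {ι : {j // σ j p = 0} → Fin m} (hZ : IsAdapted σ p Z ι) {z : Cn m} (hz : z ∈ Z.target)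
    (hne : ∀ j, z (ι j) ≠ 0) : Z.symm z ∈ complement σ := by
  intro j
  have h1 := Z.map_target hz
  by_cases hj : σ j p = 0
  · intro h0
    refine hne ⟨j, hj⟩ ?_
    rw [← Z.right_inv hz, hZ.apply_eq ⟨j, hj⟩ _ h1]
    exact (localRep_eq_zero_iff (σ j) (hZ.subset_baseSet j h1)).2 h0
  · exact hZ.ne_zero j hj _ h1

/-- Around each point of `X`, a punctured neighbourhood is covered, up to a null set, by a single
cube chart. -/
theorem exists_isCubeChart [MeasurableSpace X] [BorelSpace X] [SecondCountableTopology X]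
    [hne : Nonempty (complement σ)] (Ω : KahlerForm m X) (hσ : IsSNCDivisor σ)
    (h : ∀ j, HermitianMetric m (L j))
    (hρ : ∀ j x, (h j).normSq x (σ j x) ≤ Real.exp (-1)) {A : Fin N → ℝ} (hA : ∀ j, 0 < A j)
    {lam : ℝ} (hlam : 0 ≤ lam)
    (hpos : ∃ ε : ℝ, 0 < ε ∧ ∀ (x : complement σ) (v : TangentSpace 𝓘(ℝ, Cn m) x),
      ε * Ω.restrict (complement σ) x v (J x v) ≤ modelForm Ω σ h A lam x v (J x v))
    (g : SmoothMetric (Cn m) (complement σ)) (hg : IsQuasiIsometric Ω σ h A lam g) (p : X)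
    {W₀ : Set X} (hW₀ : W₀ ∈ 𝓝 p) :
    ∃ W : Set X, IsOpen W ∧ p ∈ W ∧ W ⊆ W₀ ∧
      ∃ φ : OpenPartialHomeomorph (complement σ) (Cn m), IsCubeChart g φ ∧
        (∀ x ∈ φ.source, x.1 ∈ W) ∧ riemannianVolume g {x | x.1 ∈ W ∧ x ∉ φ.source} = 0 := by
  classical
  obtain ⟨Z, ι, hZ, hZW⟩ := hσ.exists_isAdapted p hW₀
  have h0 : (0 : Cn m) ∈ Z.target := by
    rw [← hZ.apply_self]; exact Z.map_source hZ.mem_source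
  obtain ⟨δ₀, hδ₀, hball⟩ := Metric.nhds_basis_closedBall.mem_iff.1 (Z.open_target.mem_nhds h0)
  -- The bound by `exp (-1)` keeps `-log |z_i| ≥ 1`, away from the unit circle where the Poincaré
  -- metric is singular.
  set δ := min δ₀ (Real.exp (-1)) with hδ
  have hδpos : 0 < δ := lt_min hδ₀ (Real.exp_pos _)
  have hδ1 : δ < 1 := (min_le_right _ _).trans_lt (by rw [Real.exp_lt_one_iff]; norm_num)
  set K : Set (Cn m) := Metric.closedBall 0 δ with hKdef
  have hK : IsCompact K := isCompact_closedBall _ _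
  have hKZ : K ⊆ Z.target := (Metric.closedBall_subset_closedBall (min_le_left _ _)).trans hball
  have hK1 : ∀ z ∈ K, ‖z‖ ≤ Real.exp (-1) := fun z hz =>
    (mem_closedBall_zero_iff.1 hz).trans (min_le_right _ _)
  -- The square of side `2r` lies in the disc of radius `2r = δ`, and `l = -log r` gives the slit
  -- discs the radius `exp (-l) = r`.
  set r := δ / 2 with hr
  have hr0 : 0 < r := by positivity
  have hl : 0 < -Real.log r := neg_pos.2 (Real.log_neg hr0 (by linarith))
  have hexp : Real.exp (-(-Real.log r)) = r := by rw [neg_neg, Real.exp_log hr0]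
  set S := range ι with hS
  set R := boxChart S hl hr0 with hR
  -- `O` is the box with slits and divisor filled in, hence a full neighbourhood of 0; by `hOR` it
  -- exceeds the domain of the box chart only by points with some `Im z_i = 0`.
  set O : Set (Cn m) := ⋂ i, (fun z : Cn m => z i) ⁻¹'
    (if i ∈ S then Metric.ball 0 r else (squareChart hr0).source) with hO
  have hOo : IsOpen O := isOpen_iInter_of_finite fun i => by
    refine IsOpen.preimage (continuous_apply i) ?_
    split_ifs
    · exact Metric.isOpen_ball
    · exact (squareChart hr0).open_source
  have hmemO : ∀ z : Cn m, z ∈ O ↔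
      ∀ i, z i ∈ (if i ∈ S then Metric.ball 0 r else (squareChart hr0).source) := fun z => by
    simp [hO]
  have h0O : (0 : Cn m) ∈ O := by
    rw [hmemO]
    intro i
    split_ifs
    · exact Metric.mem_ball_self hr0
    · change (-r < (0 : ℂ).re ∧ (0 : ℂ).re < r) ∧ -r < (0 : ℂ).im ∧ (0 : ℂ).im < r
      simp [hr0]
  have hOK : O ⊆ K := by
    intro z hz
    rw [hmemO] at hz
    refine mem_closedBall_zero_iff.2 ((pi_norm_le_iff_of_nonneg hδpos.le).2 fun i => ?_)
    have hi := hz i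
    split_ifs at hi
    · have := mem_ball_zero_iff.1 hi
      linarith
    · have := norm_lt_of_mem_square hi
      linarith
  have hRcusp : ∀ z ∈ R.source, ∀ i ∈ S, z i ∈ Complex.slitPlane ∧ ‖z i‖ < r := by
    intro z hz i hi
    have h1 := (mem_boxChart_source S hl hr0).1 hz i
    rw [coordChart, if_pos hi] at h1
    exact ⟨h1.1, h1.2.trans_eq hexp⟩
  have hRO : R.source ⊆ O := by
    intro z hz
    rw [hmemO]
    intro i
    split_ifs with hi
    · exact mem_ball_zero_iff.2 (hRcusp z hz i hi).2
    · have h1 := (mem_boxChart_source S hl hr0).1 hz i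
      rwa [coordChart, if_neg hi] at h1
  have hOR : ∀ z ∈ O, z ∉ R.source → z ∈ ⋃ i, {z : Cn m | (z i).im = 0} := by
    intro z hz hzR
    rw [mem_boxChart_source] at hzR
    push Not at hzR
    obtain ⟨i, hi⟩ := hzR
    have h1 := (hmemO z).1 hz i
    refine mem_iUnion.2 ⟨i, ?_⟩
    by_cases hiS : i ∈ S
    · rw [if_pos hiS] at h1
      rw [coordChart, if_pos hiS] at hi
      have h2 : z i ∉ Complex.slitPlane := fun h2 =>
        hi ⟨h2, (mem_ball_zero_iff.1 h1).trans_eq hexp.symm⟩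
      rw [Complex.mem_slitPlane_iff, not_or, not_not] at h2
      exact h2.2
    · rw [if_neg hiS] at h1
      rw [coordChart, if_neg hiS] at hi
      exact absurd h1 hi
  set ψ : OpenPartialHomeomorph (complement σ) (Cn m) := Z.subtypeRestr hne with hψ
  have hψm : ψ ∈ IsManifold.maximalAtlas 𝓘(ℂ, Cn m) ω (complement σ) :=
    subtypeRestr_mem_maximalAtlas (contDiffGroupoid ω 𝓘(ℂ, Cn m)) hZ.mem_maximalAtlas hne
  have hψZ : ∀ z ∈ ψ.target, (ψ.symm z : X) = Z.symm z := fun z hz =>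
    Z.subtypeRestr_symm_apply hne hz
  have hψs : ψ.source = Subtype.val ⁻¹' Z.source := Z.subtypeRestr_source hne
  have hψa : ∀ x, ψ x = Z x.1 := fun x => rfl
  have hsub : R.source ⊆ ψ.target := by
    intro z hz
    have h1 : z ∈ Z.target := hKZ (hOK (hRO hz))
    -- The slit plane omits 0, so no section vanishes on the domain of the box chart.
    have h2 : Z.symm z ∈ complement σ := hZ.mem_complement h1 fun j =>
      Complex.slitPlane_ne_zero (hRcusp z hz (ι j) (mem_range_self j)).1
    have h3 := Z.map_subtype_source hne (x := ⟨Z.symm z, h2⟩) (Z.map_target h1)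
    rwa [Z.right_inv h1] at h3
  obtain ⟨c, C, hc, hC, hb⟩ := exists_metricAt_bound Ω h hρ hA hlam hpos g hg hZ hK hKZ hK1 hψm hψZ
  have hcube : IsCubeChart g (ψ ≫ₕ R) := isCubeChart_trans_boxChart S hl hr0 g
    (real_mem_maximalAtlas hψm) hsub ⟨c, C, hc, hC, fun z hz => hb z (hsub hz) (hOK (hRO hz))⟩
  have hsrc : (ψ ≫ₕ R).source = {x | x.1 ∈ Z.source ∧ Z x.1 ∈ R.source} := by
    rw [OpenPartialHomeomorph.trans_source, hψs]; rfl
  have hWo : IsOpen (Z.source ∩ Z ⁻¹' O) := Z.isOpen_inter_preimage hOo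
  refine ⟨Z.source ∩ Z ⁻¹' O, hWo, ⟨hZ.mem_source, ?_⟩, inter_subset_left.trans hZW, ψ ≫ₕ R, hcube,
    ?_, ?_⟩
  · rw [mem_preimage, hZ.apply_self]; exact h0O
  · intro x hx
    rw [hsrc] at hx
    exact ⟨hx.1, hRO hx.2⟩
  · refine riemannianVolume_null g (real_mem_maximalAtlas hψm) ?_ ?_
      (measure_mono_null ?_ (lebesgue_iUnion_im_eq_zero m))
    · exact (hWo.preimage continuous_subtype_val).measurableSet.inter
        (ψ ≫ₕ R).open_source.measurableSet.compl
    · rintro x ⟨hx, -⟩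
      rw [hψs]; exact hx.1
    · rintro z ⟨hz, hx, hxR⟩
      have hzZ : Z (ψ.symm z).1 = z := ψ.right_inv hz
      rw [hsrc] at hxR
      have h1 : z ∈ O := by rw [← hzZ]; exact hx.2
      refine hOR z h1 fun h2 => hxR ⟨hx.1, ?_⟩
      rw [hzZ]; exact h2

/-- In a connected space, any two members of an open cover by nonempty sets are joined by a chain
of intersecting members. -/
theorem reflTransGen_of_isOpen_cover {α ι : Type*} [TopologicalSpace α] [PreconnectedSpace α]
    {W : ι → Set α} (hW : ∀ i, IsOpen (W i)) (hne : ∀ i, (W i).Nonempty) (hcov : ⋃ i, W i = univ)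
    (i j : ι) : Relation.ReflTransGen (fun i j => (W i ∩ W j).Nonempty) i j := by
  by_contra hij
  -- The members reachable from `i` and the others have open unions that cover the space. Both are
  -- nonempty, so by connectedness they meet, and a common point would make an unreachable member
  -- reachable.
  set T := {k | Relation.ReflTransGen (fun i j => (W i ∩ W j).Nonempty) i k} with hT
  have h1 := isPreconnected_univ (α := α) (⋃ k ∈ T, W k) (⋃ k ∈ Tᶜ, W k)
    (isOpen_biUnion fun k _ => hW k) (isOpen_biUnion fun k _ => hW k)
    (fun x _ => by
      obtain ⟨k, hk⟩ := mem_iUnion.1 (hcov.symm ▸ mem_univ x : x ∈ ⋃ i, W i)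
      by_cases hkT : k ∈ T
      · exact Or.inl (mem_biUnion hkT hk)
      · exact Or.inr (mem_biUnion hkT hk))
    (by
      obtain ⟨x, hx⟩ := hne i
      exact ⟨x, mem_univ x, mem_biUnion (show i ∈ T from Relation.ReflTransGen.refl) hx⟩)
    (by
      obtain ⟨x, hx⟩ := hne j
      exact ⟨x, mem_univ x, mem_biUnion (show j ∈ Tᶜ from hij) hx⟩)
  obtain ⟨x, -, hx1, hx2⟩ := h1
  obtain ⟨k, hk, hxk⟩ := mem_iUnion₂.1 hx1
  obtain ⟨k', hk', hxk'⟩ := mem_iUnion₂.1 hx2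
  exact hk' (Relation.ReflTransGen.tail hk ⟨x, hxk, hxk'⟩)

end Gluing

end

end PoincareType
-- The Poincaré inequality on `X ∖ D`.
theorem lemma1p10 {m N : ℕ} {X : Type*} [TopologicalSpace X] [T2Space X] [CompactSpace X]
    [ConnectedSpace X] [ChartedSpace (PoincareType.Cn m) X]
    [IsManifold 𝓘(ℂ, PoincareType.Cn m) ω X] [MeasurableSpace X] [BorelSpace X]
    (Ω₀ : PoincareType.KahlerForm m X)
    (L : Fin N → X → Type*) [∀ j x, AddCommGroup (L j x)] [∀ j x, Module ℂ (L j x)]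
    [∀ j x, TopologicalSpace (L j x)] [∀ j, TopologicalSpace (TotalSpace ℂ (L j))]
    [∀ j, FiberBundle ℂ (L j)] [∀ j, VectorBundle ℂ ℂ (L j)]
    [∀ j, ContMDiffVectorBundle ω ℂ (L j) 𝓘(ℂ, PoincareType.Cn m)]
    (σ : ∀ j, Cₛ^ω⟮𝓘(ℂ, PoincareType.Cn m); ℂ, L j⟯)
    (hσ : PoincareType.IsSNCDivisor σ)
    (h : ∀ j, PoincareType.HermitianMetric m (L j))
    (hρ : ∀ j x, (h j).normSq x (σ j x) ≤ Real.exp (-1))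
    (A : Fin N → ℝ) (hA : ∀ j, 0 < A j) (lam : ℝ) (hlam : 0 ≤ lam)
    (hpos : ∃ ε : ℝ, 0 < ε ∧ ∀ (x : PoincareType.complement σ)
      (v : TangentSpace 𝓘(ℝ, PoincareType.Cn m) x),
      ε * Ω₀.restrict (PoincareType.complement σ) x v (PoincareType.J x v) ≤
        PoincareType.modelForm Ω₀ σ h A lam x v (PoincareType.J x v))
    (g : PoincareType.SmoothMetric (PoincareType.Cn m) (PoincareType.complement σ))
    (hg : PoincareType.IsQuasiIsometric Ω₀ σ h A lam g) :
    ∃ C : ℝ, 0 < C ∧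
      ∀ (v : PoincareType.complement σ → ℝ)
        (dv : PoincareType.CovectorField (PoincareType.Cn m) (PoincareType.complement σ)),
        PoincareType.MemH1 g v dv →
        ∫ x, v x ∂(PoincareType.riemannianVolume g) = 0 →
        ∫ x, |v x| ^ 2 ∂(PoincareType.riemannianVolume g) ≤
          C * ∫ x, PoincareType.normSq g dv x ∂(PoincareType.riemannianVolume g) := by
  have : SecondCountableTopology X :=
    ChartedSpace.secondCountable_of_sigmaCompact (PoincareType.Cn m) X
  -- On an empty complement all integrals vanish; charts can be restricted to the complement only
  -- when it has a point.
  rcases isEmpty_or_nonempty (PoincareType.complement σ) with hemp | hne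
  · refine ⟨1, one_pos, fun v dv _ _ => ?_⟩
    have h0 : PoincareType.riemannianVolume g = 0 := MeasureTheory.Measure.eq_zero_of_isEmpty _
    simp [h0]
  have hloc := fun (p : X) (W₀ : Set X) (hW₀ : W₀ ∈ 𝓝 p) =>
    PoincareType.exists_isCubeChart Ω₀ hσ h hρ hA hlam hpos g hg p hW₀
  -- The sets `W p` are open in `X` and include neighbourhoods of the points of `D`, so compactness
  -- of `X` applies although `X ∖ D` need not be compact.
  choose W hWo hpW _ φ hφ hφW hφ0 using fun p => hloc p Set.univ Filter.univ_mem
  obtain ⟨t, ht⟩ := isCompact_univ.elim_finite_subcover W hWo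
    fun p _ => Set.mem_iUnion.2 ⟨p, hpW p⟩
  have hcov : ⋃ p : t, W p = Set.univ := by
    rw [Set.eq_univ_iff_forall]
    intro x
    obtain ⟨p, hp, hx⟩ := Set.mem_iUnion₂.1 (ht (Set.mem_univ x))
    exact Set.mem_iUnion.2 ⟨⟨p, hp⟩, hx⟩
  refine PoincareType.poincare_of_cubeCharts g (fun p : t => φ p) (fun p => hφ p) ?_ fun p q => ?_
  · refine measure_mono_null (fun x hx => ?_) (measure_iUnion_null fun p : t => hφ0 p)
    obtain ⟨p, hp⟩ := Set.mem_iUnion.1 (hcov.symm ▸ Set.mem_univ x.1 : x.1 ∈ ⋃ p : t, W p)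
    exact Set.mem_iUnion.2 ⟨p, hp, fun h1 => hx (Set.mem_iUnion.2 ⟨p, h1⟩)⟩
  · refine Relation.ReflTransGen.mono ?_ _ _ (PoincareType.reflTransGen_of_isOpen_cover
      (fun p : t => hWo p) (fun p => ⟨p, hpW p⟩) hcov p q)
    rintro p q ⟨x, hxp, hxq⟩ hvol
    -- Two members may meet only at points that include some of `D`. A cube chart near such a point,
    -- inside `W p ∩ W q`, has positive volume and lies in the overlap of the two chart domains up
    -- to a null set.
    obtain ⟨W', -, -, hW', φ', hφ', hφW', -⟩ :=
      hloc x (W p ∩ W q) (((hWo p).inter (hWo q)).mem_nhds ⟨hxp, hxq⟩)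
    refine hφ'.riemannianVolume_source_ne_zero (measure_mono_null (fun y hy => ?_)
      (measure_union_null hvol (measure_union_null (hφ0 p) (hφ0 q))))
    have hy' := hW' (hφW' y hy)
    by_cases h1 : y ∈ (φ p).source
    · by_cases h2 : y ∈ (φ q).source
      · exact Or.inl ⟨h1, h2⟩
      · exact Or.inr (Or.inr ⟨hy'.2, h2⟩)
    · exact Or.inr (Or.inl ⟨hy'.1, h1⟩)
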